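/- Let $\mu>0$, $2\mu+3\lambda\ge 0$ and $\lambda<\frac{29\mu}{3}$. All function spaces are over $\mathbb{R}^3$, derivatives are weak, and $D^2\cap D^1_0=\{w\in L^6:\ \nabla w\in L^2,\ \nabla^2w\in L^2\}$, $D^1_0=\{w\in L^6:\nabla w\in L^2\}$, $D^{2,q}=\{w\in L^1_{\rm loc}:\nabla^2w\in L^q\}$ (with seminorm $\|\nabla^2w\|_{L^q}$). **Isentropic system.** For $\gamma>1$ and $P=\rho^\gamma$ consider $$\rho_t+\nabla\cdot(\rho u)=0,\qquad \rho u_t+\rho u\cdot\nabla u+\nabla P=\mu\Delta u+(\mu+\lambda)\nabla\operatorname{div}u\quad\text{in }\mathbb{R}^3. \tag{1}$$ $(\rho,u)$ is a *strong solution on $[0,T]$* ($T>0$) if for some $q\in(3,6]$: $0\le\rho\in C([0,T];W^{1,q}\cap H^1\cap L^1)$, $\rho_t\in C([0,T];L^2\cap L^q)$, $u\in C([0,T];D^2\cap D^1_0)\cap L^2(0,T;D^{2,q})$, $u_t\in L^2(0,T;D^1_0)$, $\sqrt\rho\,u_t\in L^\infty(0,T;L^2)$, for every $t\in[0,T]$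 one has $\rho(x,t)\to0$ and $u(x,t)\to0$ as $|x|\to\infty$, and (1) holds a.e. in $\mathbb{R}^3\times(0,T]$. Initial data $(\rho_0,u_0)$ are *admissible* if $0\le\rho_0\in L^1\cap H^1\cap W^{1,q}$ for some $q\in(3,6]$, $u_0\in D^2\cap D^1_0$, and $\mu\Delta u_0+(\mu+\lambda)\nabla\operatorname{div}u_0-\nabla P(\rho_0)=\sqrt{\rho_0}\,g$ for some $g\in L^2$. **Full system.** For constants $R,c_v,\kappa>0$ and $P=R\rho\theta$, consider (1) together with $$c_v(\rho\theta_t+\rho u\cdot\nabla\theta)+R\rho\theta\operatorname{div}u=\tfrac{\mu}{2}|\nabla u+(\nabla u)'|^2+\lambda(\operatorname{div}u)^2+\kappa\Delta\theta. \tag{2}$$ A strong solution $(\rho,u,\theta)$ on $[0,T]$ is defined in the same way, $\theta$ being in the same class as $u$ (including $\theta_t\in L^2(0,T;D^1_0)$, $\sqrt\rho\,\theta_t\in L^\infty(0,T;L^2)$ and $\theta\to0$ at infinity). Data $(\rho_0,u_0,\theta_0)$ are admissible if $0\le\rho_0\in L^1\cap H^1\cap W^{1,q}$ for some $q\in(3,6]$,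 $u_0,\theta_0\in D^2\cap D^1_0$, and $\mu\Delta u_0+(\mu+\lambda)\nabla\operatorname{div}u_0-\nabla(R\rho_0\theta_0)=\sqrt{\rho_0}\,g_1$, $\kappa\Delta\theta_0+\frac{\mu}{2}|\nabla u_0+(\nabla u_0)'|^2+\lambda(\operatorname{div}u_0)^2=\sqrt{\rho_0}\,g_2$ for some $g_1,g_2\in L^2$. **Claim.** There is $r\in(3,\frac72)$, depending only on $\mu$ and $\lambda$, such that: (a) For every $\gamma>1$ and every sufficiently large finite $q_1$ (how large depends only on $\mu,\lambda,\gamma$), all admissible data $(\rho_0,u_0)$, all $0<T^*<\infty$ and all $M\ge0$, there is a constant $C$, depending only on $\mu,\lambda,\gamma,q_1,\rho_0,u_0,T^*,M$, such that if $(\rho,u)$ with $(\rho,u)|_{t=0}=(\rho_0,u_0)$ is a strong solution of the isentropic system on $[0,T]$ for every $0<T<T^*$ (for instance, if $T^*$ is its maximal time of existence) and $\|\rho\|_{L^\infty(0,T^*;L^{q_1})}\le M$, then $$\sup_{0\le t\le T}\int_{\mathbb{R}^3}\rho|u|^r\,dx\le C\qquad\text{for all }T\in[0,T^*).$$ (b)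 The same holds for the full system when the temperature is bounded: for every sufficiently large finite $q_1$ (how large depends only on $\mu,\lambda$), all $R,c_v,\kappa>0$, all admissible $(\rho_0,u_0,\theta_0)$, all $0<T^*<\infty$ and $M\ge0$, there is $C$, depending only on $\mu,\lambda,R,c_v,\kappa,q_1,\rho_0,u_0,\theta_0,T^*,M$, such that the same bound holds, with the same $r$, for every $(\rho,u,\theta)$ with initial values $(\rho_0,u_0,\theta_0)$ that is a strong solution of the full system on $[0,T]$ for every $0<T<T^*$ and satisfies $\|\rho\|_{L^\infty(0,T^*;L^{q_1})}+\|\theta\|_{L^\infty(0,T^*;L^\infty)}\le M$. -/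

import Mathlib

open MeasureTheory Set Filter Topology
open scoped NNReal ENNReal

noncomputable section

namespace CNS

/-- Three-dimensional Euclidean space. -/
abbrev E3 : Type := EuclideanSpace ℝ (Fin 3)

/-- The standard basis vectors of `E3`. -/
def e (i : Fin 3) : E3 := EuclideanSpace.single i (1 : ℝ)

/-! ### Weak derivatives and function spaces -/

section Spaces

variable {F : Type} [NormedAddCommGroup F] [NormedSpace ℝ F] [CompleteSpace F]

/-- `Df` is the weak (distributional) derivative of `f` on the whole space. -/
def HasWeakFDeriv (f : E3 → F) (Df : E3 → E3 →L[ℝ] F) : Prop :=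
  LocallyIntegrable f volume ∧ LocallyIntegrable Df volume ∧
    ∀ φ : E3 → ℝ, ContDiff ℝ ((⊤ : ℕ∞) : WithTop ℕ∞) φ → HasCompactSupport φ →
      ∀ v : E3, ∫ x, (fderiv ℝ φ x v) • f x = - ∫ x, φ x • Df x v

/-- `ft` is the weak (distributional) derivative of `f` in time on `(0,T) × ℝ³`. -/
def HasWeakTimeDeriv (T : ℝ) (f ft : ℝ → E3 → F) : Prop :=
  LocallyIntegrableOn (Function.uncurry f) (Ioo 0 T ×ˢ (univ : Set E3)) volume ∧
  LocallyIntegrableOn (Function.uncurry ft) (Ioo 0 T ×ˢ (univ : Set E3)) volume ∧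
    ∀ φ : ℝ × E3 → ℝ, ContDiff ℝ ((⊤ : ℕ∞) : WithTop ℕ∞) φ → HasCompactSupport φ →
      tsupport φ ⊆ Ioo 0 T ×ˢ (univ : Set E3) →
      ∫ z : ℝ × E3, (fderiv ℝ φ z ((1 : ℝ), (0 : E3))) • f z.1 z.2 =
        - ∫ z : ℝ × E3, φ z • ft z.1 z.2

/-- `f ∈ C([0,T]; L^p(ℝ³))`. -/
def ContLp (T : ℝ) (p : ℝ≥0∞) (f : ℝ → E3 → F) : Prop :=
  AEStronglyMeasurable (Function.uncurry f)
      (volume.restrict (Icc 0 T ×ˢ (univ : Set E3))) ∧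
  (∀ t ∈ Icc 0 T, MemLp (f t) p volume) ∧
  ∀ s ∈ Icc 0 T,
    Tendsto (fun t => eLpNorm (fun x => f t x - f s x) p volume) (𝓝[Icc 0 T] s) (𝓝 0)

/-- The norm of `f` in `L^a(0,T; L^p(ℝ³))`. -/
def timeNorm (T : ℝ) (a p : ℝ≥0∞) (f : ℝ → E3 → F) : ℝ≥0∞ :=
  eLpNorm (fun t => eLpNorm (f t) p volume) a (volume.restrict (Ioo 0 T))

/-- `f ∈ L^a(0,T; L^p(ℝ³))`. -/
def MemTimeLp (T : ℝ) (a p : ℝ≥0∞) (f : ℝ → E3 → F) : Prop :=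
  AEStronglyMeasurable (Function.uncurry f)
      (volume.restrict (Ioo 0 T ×ˢ (univ : Set E3))) ∧
  timeNorm T a p f < ⊤

/-- `f(x) → 0` as `|x| → ∞`, for a function that is determined almost everywhere. -/
def VanishesAtInfinity (f : E3 → F) : Prop :=
  Tendsto f (cocompact E3 ⊓ ae volume) (𝓝 0)

/-- `w ∈ D² ∩ D¹₀`, that is `w ∈ L⁶`, `∇w ∈ L²`, `∇²w ∈ L²`, where `Dw = ∇w` and `D2w = ∇²w`. -/
def InD2D10 (w : E3 → F) (Dw : E3 → E3 →L[ℝ] F) (D2w : E3 → E3 →L[ℝ] E3 →L[ℝ] F) : Prop :=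
  HasWeakFDeriv w Dw ∧ HasWeakFDeriv Dw D2w ∧
    MemLp w 6 volume ∧ MemLp Dw 2 volume ∧ MemLp D2w 2 volume

/-- `0 ≤ r ∈ L¹ ∩ H¹ ∩ W^{1,q}`. -/
def IsDensityDatum (q : ℝ) (r : E3 → ℝ) : Prop :=
  (∀ᵐ x, 0 ≤ r x) ∧
  ∃ Dr : E3 → E3 →L[ℝ] ℝ, HasWeakFDeriv r Dr ∧
    MemLp r 1 volume ∧ MemLp r 2 volume ∧ MemLp r (ENNReal.ofReal q) volume ∧
    MemLp Dr 2 volume ∧ MemLp Dr (ENNReal.ofReal q) volume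

/-- The regularity class of the density on `[0,T]`:
`0 ≤ ρ ∈ C([0,T]; W^{1,q} ∩ H¹ ∩ L¹)`, `ρ_t ∈ C([0,T]; L² ∩ L^q)`, and `ρ → 0` at infinity.
Here `Dρ = ∇ρ` and `ρt = ρ_t`. -/
structure InDensityClass (T q : ℝ) (ρ : ℝ → E3 → ℝ) (Dρ : ℝ → E3 → E3 →L[ℝ] ℝ)
    (ρt : ℝ → E3 → ℝ) : Prop where
  nonneg : ∀ t ∈ Icc 0 T, ∀ᵐ x, 0 ≤ ρ t x
  weakGrad : ∀ t ∈ Icc 0 T, HasWeakFDeriv (ρ t) (Dρ t)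
  contL1 : ContLp T 1 ρ
  contL2 : ContLp T 2 ρ
  contLq : ContLp T (ENNReal.ofReal q) ρ
  gradL2 : ContLp T 2 Dρ
  gradLq : ContLp T (ENNReal.ofReal q) Dρ
  weakTime : HasWeakTimeDeriv T ρ ρt
  timeL2 : ContLp T 2 ρt
  timeLq : ContLp T (ENNReal.ofReal q) ρt
  decay : ∀ t ∈ Icc 0 T, VanishesAtInfinity (ρ t)

/-- The regularity class of the velocity (and of the temperature) on `[0,T]`:
`w ∈ C([0,T]; D² ∩ D¹₀) ∩ L²(0,T; D^{2,q})`, `w_t ∈ L²(0,T; D¹₀)`,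
`√ρ w_t ∈ L^∞(0,T; L²)`, and `w → 0` at infinity.
Here `Dw = ∇w`, `D2w = ∇²w`, `wt = w_t` and `Dwt = ∇w_t`. -/
structure InVelocityClass (T q : ℝ) (ρ : ℝ → E3 → ℝ) (w : ℝ → E3 → F)
    (Dw : ℝ → E3 → E3 →L[ℝ] F) (D2w : ℝ → E3 → E3 →L[ℝ] E3 →L[ℝ] F)
    (wt : ℝ → E3 → F) (Dwt : ℝ → E3 → E3 →L[ℝ] F) : Prop where
  weakGrad : ∀ t ∈ Icc 0 T, HasWeakFDeriv (w t) (Dw t)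
  weakHess : ∀ t ∈ Icc 0 T, HasWeakFDeriv (Dw t) (D2w t)
  contL6 : ContLp T 6 w
  gradL2 : ContLp T 2 Dw
  hessL2 : ContLp T 2 D2w
  hessLq : MemTimeLp T 2 (ENNReal.ofReal q) D2w
  weakTime : HasWeakTimeDeriv T w wt
  weakGradTime : ∀ᵐ t ∂(volume.restrict (Ioo 0 T)), HasWeakFDeriv (wt t) (Dwt t)
  timeL6 : MemTimeLp T 2 6 wt
  timeGradL2 : MemTimeLp T 2 2 Dwt
  sqrtTime : MemTimeLp T ⊤ 2 (fun t x => Real.sqrt (ρ t x) • wt t x)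
  decay : ∀ t ∈ Icc 0 T, VanishesAtInfinity (w t)

end Spaces

/-! ### Differential expressions, in terms of first derivatives `A` and second derivatives `B`
(`A v` is the derivative in direction `v`, and `B v w = ∂_v ∂_w`) -/

/-- The divergence `∑ᵢ ∂ᵢ uᵢ`. -/
def divOf (A : E3 →L[ℝ] E3) : ℝ := ∑ i, A (e i) i

/-- The `j`-th component of `μ Δu + (μ + λ) ∇ div u`. -/
def lameOp (μ lam : ℝ) (B : E3 →L[ℝ] E3 →L[ℝ] E3) (j : Fin 3) : ℝ :=
  μ * (∑ i, B (e i) (e i) j) + (μ + lam) * (∑ i, B (e j) (e i) i)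

/-- The viscous heating `(μ/2) |∇u + (∇u)'|² + λ (div u)²`, with the Frobenius norm. -/
def heating (μ lam : ℝ) (A : E3 →L[ℝ] E3) : ℝ :=
  μ / 2 * (∑ i, ∑ j, (A (e i) j + A (e j) i) ^ 2) + lam * (divOf A) ^ 2

/-- Conservation of mass `ρ_t + ∇·(ρu) = 0`, where `∇·(ρu) = u·∇ρ + ρ div u`,
almost everywhere in `ℝ³ × (0,T]`. -/
def MassEq (T : ℝ) (ρ ρt : ℝ → E3 → ℝ) (Dρ : ℝ → E3 → E3 →L[ℝ] ℝ)
    (u : ℝ → E3 → E3) (Du : ℝ → E3 → E3 →L[ℝ] E3) : Prop :=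
  ∀ᵐ z : ℝ × E3 ∂(volume.restrict (Ioc 0 T ×ˢ (univ : Set E3))),
    ρt z.1 z.2 + (Dρ z.1 z.2 (u z.1 z.2) + ρ z.1 z.2 * divOf (Du z.1 z.2)) = 0

/-- Balance of momentum `ρ u_t + ρ u·∇u + ∇P = μ Δu + (μ+λ) ∇ div u`
almost everywhere in `ℝ³ × (0,T]`, where `DP = ∇P` is the weak gradient of the pressure `P`. -/
def MomentumEq (μ lam T : ℝ) (P : ℝ → E3 → ℝ) (ρ : ℝ → E3 → ℝ) (u : ℝ → E3 → E3)
    (Du : ℝ → E3 → E3 →L[ℝ] E3) (D2u : ℝ → E3 → E3 →L[ℝ] E3 →L[ℝ] E3)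
    (ut : ℝ → E3 → E3) : Prop :=
  ∃ DP : ℝ → E3 → E3 →L[ℝ] ℝ, (∀ t ∈ Icc 0 T, HasWeakFDeriv (P t) (DP t)) ∧
    ∀ᵐ z : ℝ × E3 ∂(volume.restrict (Ioc 0 T ×ˢ (univ : Set E3))), ∀ j : Fin 3,
      ρ z.1 z.2 * ut z.1 z.2 j + ρ z.1 z.2 * (Du z.1 z.2 (u z.1 z.2)) j + DP z.1 z.2 (e j)
        = lameOp μ lam (D2u z.1 z.2) j

/-- Balance of energy
`cv (ρ θ_t + ρ u·∇θ) + R ρ θ div u = (μ/2)|∇u + (∇u)'|² + λ (div u)² + κ Δθ`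
almost everywhere in `ℝ³ × (0,T]`. -/
def EnergyEq (μ lam R cv κ T : ℝ) (ρ : ℝ → E3 → ℝ) (u : ℝ → E3 → E3)
    (Du : ℝ → E3 → E3 →L[ℝ] E3) (θ : ℝ → E3 → ℝ) (Dθ : ℝ → E3 → E3 →L[ℝ] ℝ)
    (D2θ : ℝ → E3 → E3 →L[ℝ] E3 →L[ℝ] ℝ) (θt : ℝ → E3 → ℝ) : Prop :=
  ∀ᵐ z : ℝ × E3 ∂(volume.restrict (Ioc 0 T ×ˢ (univ : Set E3))),
    cv * (ρ z.1 z.2 * θt z.1 z.2 + ρ z.1 z.2 * Dθ z.1 z.2 (u z.1 z.2))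
        + R * ρ z.1 z.2 * θ z.1 z.2 * divOf (Du z.1 z.2)
      = heating μ lam (Du z.1 z.2) + κ * (∑ i, D2θ z.1 z.2 (e i) (e i))

/-! ### The isentropic system, `P = ρ^γ` -/

/-- `(ρ, u)` is a strong solution of the isentropic compressible Navier-Stokes equations
on `ℝ³ × [0,T]`. -/
def IsStrongSolution (μ lam γ T : ℝ) (ρ : ℝ → E3 → ℝ) (u : ℝ → E3 → E3) : Prop :=
  ∃ q : ℝ, 3 < q ∧ q ≤ 6 ∧
  ∃ (Dρ : ℝ → E3 → E3 →L[ℝ] ℝ) (ρt : ℝ → E3 → ℝ)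
    (Du : ℝ → E3 → E3 →L[ℝ] E3) (D2u : ℝ → E3 → E3 →L[ℝ] E3 →L[ℝ] E3)
    (ut : ℝ → E3 → E3) (Dut : ℝ → E3 → E3 →L[ℝ] E3),
    InDensityClass T q ρ Dρ ρt ∧ InVelocityClass T q ρ u Du D2u ut Dut ∧
    MassEq T ρ ρt Dρ u Du ∧
    MomentumEq μ lam T (fun t x => (ρ t x) ^ γ) ρ u Du D2u ut

/-- Admissible initial data for the isentropic system: `0 ≤ ρ₀ ∈ L¹ ∩ H¹ ∩ W^{1,q}` for some
`q ∈ (3,6]`, `u₀ ∈ D² ∩ D¹₀`, and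
`μ Δu₀ + (μ+λ) ∇ div u₀ - ∇P(ρ₀) = √ρ₀ g` for some `g ∈ L²`. -/
def IsInitialDatum (μ lam γ : ℝ) (ρ₀ : E3 → ℝ) (u₀ : E3 → E3) : Prop :=
  (∃ q : ℝ, 3 < q ∧ q ≤ 6 ∧ IsDensityDatum q ρ₀) ∧
  ∃ (Du₀ : E3 → E3 →L[ℝ] E3) (D2u₀ : E3 → E3 →L[ℝ] E3 →L[ℝ] E3)
    (DP₀ : E3 → E3 →L[ℝ] ℝ) (g : E3 → E3),
    InD2D10 u₀ Du₀ D2u₀ ∧ HasWeakFDeriv (fun x => (ρ₀ x) ^ γ) DP₀ ∧ MemLp g 2 volume ∧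
    ∀ᵐ x, ∀ j : Fin 3, lameOp μ lam (D2u₀ x) j - DP₀ x (e j) = Real.sqrt (ρ₀ x) * g x j

/-! ### The full system, `P = R ρ θ`, internal energy `cv θ`, heat conductivity `κ` -/

/-- `(ρ, u, θ)` is a strong solution of the full compressible Navier-Stokes equations
on `ℝ³ × [0,T]`. -/
def IsStrongSolutionFull (μ lam R cv κ T : ℝ) (ρ : ℝ → E3 → ℝ) (u : ℝ → E3 → E3)
    (θ : ℝ → E3 → ℝ) : Prop :=
  ∃ q : ℝ, 3 < q ∧ q ≤ 6 ∧
  ∃ (Dρ : ℝ → E3 → E3 →L[ℝ] ℝ) (ρt : ℝ → E3 → ℝ)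
    (Du : ℝ → E3 → E3 →L[ℝ] E3) (D2u : ℝ → E3 → E3 →L[ℝ] E3 →L[ℝ] E3)
    (ut : ℝ → E3 → E3) (Dut : ℝ → E3 → E3 →L[ℝ] E3)
    (Dθ : ℝ → E3 → E3 →L[ℝ] ℝ) (D2θ : ℝ → E3 → E3 →L[ℝ] E3 →L[ℝ] ℝ)
    (θt : ℝ → E3 → ℝ) (Dθt : ℝ → E3 → E3 →L[ℝ] ℝ),
    InDensityClass T q ρ Dρ ρt ∧ InVelocityClass T q ρ u Du D2u ut Dut ∧
    InVelocityClass T q ρ θ Dθ D2θ θt Dθt ∧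
    MassEq T ρ ρt Dρ u Du ∧
    MomentumEq μ lam T (fun t x => R * ρ t x * θ t x) ρ u Du D2u ut ∧
    EnergyEq μ lam R cv κ T ρ u Du θ Dθ D2θ θt

/-- Admissible initial data for the full system: `0 ≤ ρ₀ ∈ L¹ ∩ H¹ ∩ W^{1,q}` for some
`q ∈ (3,6]`, `u₀, θ₀ ∈ D² ∩ D¹₀`, and, for some `g₁, g₂ ∈ L²`,
`μ Δu₀ + (μ+λ) ∇ div u₀ - ∇P(ρ₀,θ₀) = √ρ₀ g₁` and
`κ Δθ₀ + (μ/2)|∇u₀ + (∇u₀)'|² + λ (div u₀)² = √ρ₀ g₂`. -/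
def IsInitialDatumFull (μ lam R κ : ℝ) (ρ₀ : E3 → ℝ) (u₀ : E3 → E3) (θ₀ : E3 → ℝ) : Prop :=
  (∃ q : ℝ, 3 < q ∧ q ≤ 6 ∧ IsDensityDatum q ρ₀) ∧
  ∃ (Du₀ : E3 → E3 →L[ℝ] E3) (D2u₀ : E3 → E3 →L[ℝ] E3 →L[ℝ] E3)
    (Dθ₀ : E3 → E3 →L[ℝ] ℝ) (D2θ₀ : E3 → E3 →L[ℝ] E3 →L[ℝ] ℝ)
    (DP₀ : E3 → E3 →L[ℝ] ℝ) (g₁ : E3 → E3) (g₂ : E3 → ℝ),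
    InD2D10 u₀ Du₀ D2u₀ ∧ InD2D10 θ₀ Dθ₀ D2θ₀ ∧
    HasWeakFDeriv (fun x => R * ρ₀ x * θ₀ x) DP₀ ∧ MemLp g₁ 2 volume ∧ MemLp g₂ 2 volume ∧
    (∀ᵐ x, ∀ j : Fin 3, lameOp μ lam (D2u₀ x) j - DP₀ x (e j) = Real.sqrt (ρ₀ x) * g₁ x j) ∧
    ∀ᵐ x, κ * (∑ i, D2θ₀ x (e i) (e i)) + heating μ lam (Du₀ x) = Real.sqrt (ρ₀ x) * g₂ x

end CNS

end

/-! The exponent is r = 61/20 for every admissible pair (μ, λ). Formally, multiplying the momentum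
equation by r F with F = |u|^{r-2} u and using conservation of mass gives d/dt ∫ρ|u|^r = r ∫ (P div
F - μ ∇u:∇F - (μ+λ) div u div F).

The heart of the matter is the pointwise inequality `pressure_le_dissipation`. Let a be the
component of ∇u in the direction u ⊗ u/|u|², y = div u - a and m = r - 2. Then |∇u|² ≥ a² + y²/2 and
|∇|u||² ≥ a², so the dissipation divided by |u|^{r-2} is at least μ(a² + y²/2 + m a²) +
(μ+λ)(a+y)((1+m)a + y). This binary form still controls the square of (1+m)a + y, that is of div
F/|u|^{r-2}, as long as μ+λ ≤ 32μ/3 and m ≤ 21/20 (`viscous_form_nonneg`); this is where λ < 29μ/3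
enters, and it leaves room for an exponent slightly above 3. Young's inequality absorbs the pressure
work at the price of C ∫P²|u|^{r-2}. Since |P| ≤ Bρ^γ, with γ = 1 and B = R sup|θ| for the full
system, a second Young inequality bounds this by ∫ρ^{q₁} and ∫ρ|u|^r (`rpow_mul_wt_le`), and
Gronwall's lemma closes the estimate.

Most of the work is to justify this computation. The power of |u| is replaced by a weight `wt ε`
that is bounded with bounded derivative, and |u|^r by the potential `pot ε`, whose gradient in u is
the new test function. At almost every time the integrations by parts are local: every product is
dominated by the cube of one locally L⁶ majorant, and ∇P is locally square integrable because the
momentum equation expresses it through such products and ∇²u (`Slice.dP_locL2`). In time, ρ and u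
are primitives of their weak derivatives along almost every line {x} × (0,T), so the classical chain
rule holds there and Fubini's theorem gives the energy balance (`integral_energy_eq`).

A spatial cutoff of radius R produces errors carrying ∇χ. These vanish as R → ∞ because ∇χ is
bounded in L³ uniformly in R, u has uniformly small tails in L⁶, and the remaining factors are
controlled in L² (`exists_energyRHS_le`). The Gronwall constants depend neither on ε nor on R, so ε
→ 0 by Fatou's lemma (`integral_moment_le`), and the final bound involves only the initial data, the
norm bounds and the final time. -/

namespace CNS

/-! ### Mollification: commutation with weak derivatives and convergence in L². -/

section Mollification
open scoped Convolution

/-- A sequence of bump functions on `E3` shrinking to the origin. -/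
noncomputable def bump (n : ℕ) : ContDiffBump (0 : E3) where
  rIn := 1 / (2 * (n + 1))
  rOut := 1 / (n + 1)
  rIn_pos := by positivity
  rIn_lt_rOut := by
    apply one_div_lt_one_div_of_lt <;> nlinarith [(Nat.cast_nonneg n : (0:ℝ) ≤ n)]

lemma bump_rOut_le_one (n : ℕ) : (bump n).rOut ≤ 1 := by
  change (1 : ℝ) / (n + 1) ≤ 1
  rw [div_le_one (by positivity)]
  linarith [(Nat.cast_nonneg n : (0:ℝ) ≤ n)]

lemma tendsto_bump_rOut : Tendsto (fun n => (bump n).rOut) atTop (𝓝 0) :=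
  tendsto_one_div_add_atTop_nhds_zero_nat

variable {F : Type*} [NormedAddCommGroup F] [NormedSpace ℝ F]

/-- Mollification of `f` at scale `1 / (n + 1)`. -/
noncomputable def mollify (n : ℕ) (f : E3 → F) : E3 → F :=
  (bump n).normed volume ⋆[ContinuousLinearMap.lsmul ℝ ℝ, volume] f

lemma mollify_apply (n : ℕ) (f : E3 → F) (x : E3) :
    mollify n f x = ∫ t, (bump n).normed volume t • f (x - t) := by
  simp [mollify, convolution_def]

lemma mollify_apply' (n : ℕ) (f : E3 → F) (x : E3) :
    mollify n f x = ∫ t, (bump n).normed volume (x - t) • f t := by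
  simp [mollify, convolution_eq_swap]

lemma contDiff_mollify (n : ℕ) {f : E3 → F} (hf : LocallyIntegrable f volume) :
    ContDiff ℝ ((⊤ : ℕ∞) : WithTop ℕ∞) (mollify n f) :=
  (bump n).hasCompactSupport_normed.contDiff_convolution_left _ (bump n).contDiff_normed hf

lemma mollify_congr_of_ball {n : ℕ} {f g : E3 → F} {R : ℝ}
    (hfg : ∀ x ∈ Metric.ball (0 : E3) (R + 1), f x = g x) {x : E3}
    (hx : x ∈ Metric.ball (0 : E3) R) : mollify n f x = mollify n g x := by
  rw [mollify_apply, mollify_apply]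
  congr 1
  ext t
  by_cases ht : t ∈ Function.support ((bump n).normed volume)
  · rw [(bump n).support_normed_eq, mem_ball_zero_iff] at ht
    rw [hfg]
    rw [mem_ball_zero_iff] at hx ⊢
    linarith [norm_sub_le x t, bump_rOut_le_one n]
  · rw [Function.notMem_support] at ht
    simp [ht]

/-- Differentiation falls on the kernel; the reflected kernel t ↦ φ(x - t) is itself a test
function, so the definition of the weak derivative moves the derivative onto `f`. The sign from the
reflection cancels the one from the integration by parts. -/
lemma fderiv_mollify {F : Type} [NormedAddCommGroup F] [NormedSpace ℝ F] [CompleteSpace F]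
    (n : ℕ) {f : E3 → F} {Df : E3 → E3 →L[ℝ] F} (h : HasWeakFDeriv f Df) (x : E3) :
    fderiv ℝ (mollify n f) x = mollify n Df x := by
  obtain ⟨hf, hDf, hw⟩ := h
  have hb1 : ContDiff ℝ 1 ((bump n).normed volume) := (bump n).contDiff_normed
  have hbs := (bump n).hasCompactSupport_normed (μ := volume)
  have hd := hbs.hasFDerivAt_convolution_left
    (ContinuousLinearMap.lsmul ℝ ℝ) hb1 hf x
  rw [mollify, hd.fderiv]
  ext v
  rw [convolution_eq_swap, mollify_apply']
  have hcs : HasCompactSupport (fun t => (bump n).normed volume (x - t)) :=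
    hbs.comp_homeomorph (Homeomorph.subLeft x)
  have hcd : ContDiff ℝ ((⊤ : ℕ∞) : WithTop ℕ∞) (fun t => (bump n).normed volume (x - t)) :=
    (bump n).contDiff_normed.comp (contDiff_const.sub contDiff_id)
  have hint1 : Integrable (fun t => (ContinuousLinearMap.precompL E3
      (ContinuousLinearMap.lsmul ℝ ℝ (E := F)) (fderiv ℝ ((bump n).normed volume) (x - t)))
        (f t)) volume := by
    have := (hbs.fderiv (𝕜 := ℝ)).convolutionExists_left (ContinuousLinearMap.precompL E3
      (ContinuousLinearMap.lsmul ℝ ℝ (E := F))) (hb1.continuous_fderiv one_ne_zero) hf x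
    rw [ConvolutionExistsAt] at this
    have h2 := this.comp_sub_left x
    simpa using h2
  have hint2 : Integrable (fun t => (bump n).normed volume (x - t) • Df t) volume :=
    hDf.integrable_smul_left_of_hasCompactSupport hcd.continuous hcs
  rw [ContinuousLinearMap.integral_apply hint1, ContinuousLinearMap.integral_apply hint2]
  have := hw _ hcd hcs v
  simp only [smul_apply]
  rw [eq_neg_iff_add_eq_zero, add_comm, ← eq_neg_iff_add_eq_zero] at this
  rw [this, ← integral_neg]
  congr 1
  ext t
  have e1 : fderiv ℝ (fun t => (bump n).normed volume (x - t)) t v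
      = - fderiv ℝ ((bump n).normed volume) (x - t) v := by
    have h1 : HasFDerivAt (fun t : E3 => x - t) (-ContinuousLinearMap.id ℝ E3) t :=
      (hasFDerivAt_id t).const_sub x
    have h2 := ((hb1.differentiable one_ne_zero (x - t)).hasFDerivAt).comp t h1
    have : (fun t => (bump n).normed volume (x - t)) = (bump n).normed volume ∘ fun t => x - t := rfl
    rw [this, h2.fderiv]
    simp
  rw [e1]
  simp [ContinuousLinearMap.precompL_apply]

/-- Cauchy–Schwarz with the kernel split as φ^{1/2} · φ^{1/2}|f|; the factor φ^{1/2} has L² norm one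
because φ has unit mass. -/
lemma enorm_mollify_sq_le (n : ℕ) {f : E3 → F} (hf : AEStronglyMeasurable f volume) (x : E3) :
    ‖mollify n f x‖ₑ ^ (2 : ℝ) ≤
      ∫⁻ t, ENNReal.ofReal ((bump n).normed volume t) * ‖f (x - t)‖ₑ ^ (2 : ℝ) := by
  have hφ : Continuous ((bump n).normed volume) := (bump n).continuous_normed
  have hφ0 : ∀ t, 0 ≤ (bump n).normed volume t := (bump n).nonneg_normed
  have h1 : ‖mollify n f x‖ₑ ≤ ∫⁻ t, ENNReal.ofReal ((bump n).normed volume t) * ‖f (x - t)‖ₑ := by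
    rw [mollify_apply]
    refine (enorm_integral_le_lintegral_enorm _).trans_eq ?_
    congr 1
    ext t
    rw [enorm_smul, Real.enorm_of_nonneg (hφ0 t)]
  have hfx : AEMeasurable (fun t => ‖f (x - t)‖ₑ) volume :=
    (hf.comp_quasiMeasurePreserving
      (quasiMeasurePreserving_sub_left_of_right_invariant volume x)).enorm
  have hφm : AEMeasurable (fun t => ENNReal.ofReal ((bump n).normed volume t)) volume :=
    hφ.measurable.ennreal_ofReal.aemeasurable
  have h2 := ENNReal.lintegral_mul_le_Lp_mul_Lq volume Real.HolderConjugate.two_two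
    (hφm.pow_const (1 / 2 : ℝ)) ((hφm.pow_const (1 / 2 : ℝ)).mul hfx)
  have e1 : ∀ a : ℝ≥0∞, (a ^ (1 / 2 : ℝ)) * a ^ (1 / 2 : ℝ) = a := fun a => by
    rw [← ENNReal.rpow_add_of_nonneg _ _ (by norm_num) (by norm_num)]; norm_num
  have e2 : ∀ a : ℝ≥0∞, (a ^ (1 / 2 : ℝ)) ^ (2 : ℝ) = a := fun a => by
    rw [← ENNReal.rpow_mul]; norm_num
  simp only [Pi.mul_apply, ← mul_assoc, e1, ENNReal.mul_rpow_of_nonneg _ _ zero_le_two, e2] at h2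
  have h3 : ∫⁻ t, ENNReal.ofReal ((bump n).normed volume t) = 1 := by
    rw [← ofReal_integral_eq_lintegral_ofReal (bump n).integrable_normed
      (Eventually.of_forall hφ0), (bump n).integral_normed, ENNReal.ofReal_one]
  rw [h3, ENNReal.one_rpow, one_mul] at h2
  calc _ ≤ ((∫⁻ t, ENNReal.ofReal ((bump n).normed volume t) * ‖f (x - t)‖ₑ ^ (2 : ℝ))
        ^ (1 / 2 : ℝ)) ^ (2 : ℝ) := by gcongr; exact h1.trans h2
    _ = _ := e2 _

lemma eLpNorm_mollify_le (n : ℕ) {f : E3 → F} (hf : AEStronglyMeasurable f volume) :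
    eLpNorm (mollify n f) 2 volume ≤ eLpNorm f 2 volume := by
  rw [eLpNorm_eq_lintegral_rpow_enorm_toReal (by norm_num) (by norm_num),
    eLpNorm_eq_lintegral_rpow_enorm_toReal (by norm_num) (by norm_num)]
  simp only [ENNReal.toReal_ofNat]
  gcongr ?_ ^ _
  have hφ : Continuous ((bump n).normed volume) := (bump n).continuous_normed
  have hφ0 : ∀ t, 0 ≤ (bump n).normed volume t := (bump n).nonneg_normed
  calc ∫⁻ x, ‖mollify n f x‖ₑ ^ (2 : ℝ)
      ≤ ∫⁻ x, ∫⁻ t, ENNReal.ofReal ((bump n).normed volume t) * ‖f (x - t)‖ₑ ^ (2 : ℝ) :=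
        lintegral_mono fun x => enorm_mollify_sq_le n hf x
    _ = ∫⁻ t, ∫⁻ x, ENNReal.ofReal ((bump n).normed volume t) * ‖f (x - t)‖ₑ ^ (2 : ℝ) := by
        apply lintegral_lintegral_swap
        refine AEMeasurable.mul ?_ ?_
        · exact (hφ.measurable.ennreal_ofReal.comp measurable_snd).aemeasurable
        · refine AEMeasurable.pow_const ?_ _
          exact (hf.comp_quasiMeasurePreserving
            (quasiMeasurePreserving_sub_of_right_invariant volume volume)).enorm
    _ = ∫⁻ t, ENNReal.ofReal ((bump n).normed volume t) * ∫⁻ x, ‖f x‖ₑ ^ (2 : ℝ) := by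
        congr 1
        ext t
        rw [lintegral_const_mul' _ _ ENNReal.ofReal_ne_top]
        congr 1
        exact lintegral_sub_right_eq_self (fun x => ‖f x‖ₑ ^ (2 : ℝ)) t
    _ = ∫⁻ x, ‖f x‖ₑ ^ (2 : ℝ) := by
        rw [lintegral_mul_const _ hφ.measurable.ennreal_ofReal,
          ← ofReal_integral_eq_lintegral_ofReal (bump n).integrable_normed
          (Eventually.of_forall hφ0), (bump n).integral_normed, ENNReal.ofReal_one, one_mul]

lemma mollify_sub (n : ℕ) {f g : E3 → F} (hf : LocallyIntegrable f volume)
    (hg : LocallyIntegrable g volume) : mollify n (f - g) = mollify n f - mollify n g := by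
  have key : ∀ {f : E3 → F}, LocallyIntegrable f volume → ∀ x,
      Integrable (fun t => (bump n).normed volume (x - t) • f t) volume := fun hf x => by
    refine hf.integrable_smul_left_of_hasCompactSupport ?_ ?_
    · exact (bump n).continuous_normed.comp (continuous_const.sub continuous_id)
    · exact (bump n).hasCompactSupport_normed.comp_homeomorph (Homeomorph.subLeft x)
  ext x
  simp only [mollify_apply', Pi.sub_apply, smul_sub]
  exact integral_sub (key hf x) (key hg x)

lemma tendsto_mollify_of_continuous [CompleteSpace F] {g : E3 → F} (hg : Continuous g)
    (hgs : HasCompactSupport g) :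
    Tendsto (fun n => eLpNorm (mollify n g - g) 2 volume) atTop (𝓝 0) := by
  obtain ⟨R, hR⟩ := hgs.isCompact.isBounded.subset_closedBall 0
  have huc := hgs.uniformContinuous_of_continuous hg
  set s : Set E3 := Metric.closedBall 0 (R + 1)
  have hs : volume s ≠ ⊤ := (isCompact_closedBall _ _).measure_lt_top.ne
  have hsupp : ∀ n, Function.support (mollify n g) ⊆ s := fun n x hx => by
    have := support_convolution_subset (ContinuousLinearMap.lsmul ℝ ℝ (E := F)) hx
    obtain ⟨a, ha, b, hb, rfl⟩ := this
    rw [(bump n).support_normed_eq, mem_ball_zero_iff] at ha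
    have := hR (subset_tsupport _ hb)
    simp only [s, mem_closedBall_zero_iff] at this ⊢
    linarith [norm_add_le a b, bump_rOut_le_one n]
  have hsupp' : Function.support g ⊆ s := fun x hx => by
    have := hR (subset_tsupport _ hx)
    simp only [s, mem_closedBall_zero_iff] at this ⊢
    linarith
  set c : ℝ≥0∞ := volume s ^ (1 / (2 : ℝ≥0∞).toReal)
  have hc : c ≠ ⊤ := ENNReal.rpow_ne_top_of_nonneg (by positivity) hs
  rw [ENNReal.tendsto_atTop_zero]
  intro ε hε
  -- A uniform error `δ` on the fixed ball `s`, which contains all the supports, costs `δ * c` in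
  -- L². Dividing by `c + 1` avoids a vanishing denominator.
  obtain ⟨δ, hδ, hδε⟩ : ∃ δ : ℝ, 0 < δ ∧ ENNReal.ofReal δ * c ≤ ε := by
    obtain rfl | hε' := eq_or_ne ε ⊤
    · exact ⟨1, one_pos, le_top⟩
    refine ⟨(ε / (c + 1)).toReal, ENNReal.toReal_pos ?_ ?_, ?_⟩
    · exact (ENNReal.div_pos hε.ne' (by simp [hc])).ne'
    · exact (ENNReal.div_lt_top hε' (by simp)).ne
    · rw [ENNReal.ofReal_toReal (ENNReal.div_lt_top hε' (by simp)).ne]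
      calc ε / (c + 1) * c ≤ ε / (c + 1) * (c + 1) := by gcongr; exact le_self_add
        _ = ε := ENNReal.div_mul_cancel (by simp) (by simp [hc])
  obtain ⟨η, hη, hη2⟩ := Metric.uniformContinuous_iff.1 huc δ hδ
  obtain ⟨N, hN⟩ := (tendsto_bump_rOut.eventually (gt_mem_nhds hη)).exists_forall_of_atTop
  refine ⟨N, fun n hn => ?_⟩
  refine le_trans (eLpNorm_sub_le_of_dist_bdd volume (by norm_num)
    Metric.isClosed_closedBall.measurableSet hδ.le (fun x => ?_) (hsupp n) hsupp') hδε
  refine ContDiffBump.dist_normed_convolution_le hg.aestronglyMeasurable fun y hy => ?_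
  exact (hη2 ((Metric.mem_ball.1 hy).trans (hN n hn))).le

/-- Density of compactly supported continuous functions combined with the contraction property of
mollification on L². -/
lemma tendsto_mollify [CompleteSpace F] {f : E3 → F} (hf : MemLp f 2 volume) :
    Tendsto (fun n => eLpNorm (mollify n f - f) 2 volume) atTop (𝓝 0) := by
  rw [ENNReal.tendsto_atTop_zero]
  intro ε hε
  have hε3 : 0 < ε / 3 := ENNReal.div_pos hε.ne' (by norm_num)
  obtain ⟨g, hgs, hfg, hgc, hg2⟩ :=
    hf.exists_hasCompactSupport_eLpNorm_sub_le (by norm_num) hε3.ne'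
  obtain ⟨N, hN⟩ := ENNReal.tendsto_atTop_zero.1 (tendsto_mollify_of_continuous hgc hgs) _ hε3
  refine ⟨N, fun n hn => ?_⟩
  have hlf := hf.locallyIntegrable (by norm_num)
  have hlg := hg2.locallyIntegrable (by norm_num)
  have e : mollify n f - f = mollify n (f - g) + ((mollify n g - g) + (g - f)) := by
    rw [mollify_sub n hlf hlg]; abel
  have m1 : AEStronglyMeasurable (mollify n g - g) volume :=
    (contDiff_mollify n hlg).continuous.aestronglyMeasurable.sub hgc.aestronglyMeasurable
  have m2 : AEStronglyMeasurable (g - f) volume := hgc.aestronglyMeasurable.sub hf.1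
  have m3 : AEStronglyMeasurable (mollify n (f - g)) volume :=
    (contDiff_mollify n (hlf.sub hlg)).continuous.aestronglyMeasurable
  rw [e]
  calc _ ≤ eLpNorm (mollify n (f - g)) 2 volume
          + (eLpNorm (mollify n g - g) 2 volume + eLpNorm (g - f) 2 volume) :=
        (eLpNorm_add_le m3 (m1.add m2) (by norm_num)).trans
          (by gcongr; exact eLpNorm_add_le m1 m2 (by norm_num))
    _ ≤ ε / 3 + (ε / 3 + ε / 3) := by
        gcongr
        · exact (eLpNorm_mollify_le n (hf.1.sub hgc.aestronglyMeasurable)).trans hfg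
        · exact hN n hn
        · rw [eLpNorm_sub_comm]; exact hfg
    _ = ε := by rw [← add_assoc]; exact ENNReal.add_thirds ε

end Mollification

/-! ### Local square integrability and the product rule for weak derivatives. -/

section WeakCalculus

lemma locallyIntegrable_of_ball {F : Type*} [NormedAddCommGroup F] {f : E3 → F}
    (h : ∀ R : ℝ, IntegrableOn f (Metric.ball 0 R) volume) : LocallyIntegrable f volume := by
  intro x
  refine ⟨Metric.ball 0 (‖x‖ + 1), Metric.isOpen_ball.mem_nhds ?_, h _⟩
  simp

/-- Local square integrability on `E3`. -/
def LocL2 {F : Type*} [NormedAddCommGroup F] (f : E3 → F) : Prop :=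
  ∀ R : ℝ, MemLp f 2 (volume.restrict (Metric.ball (0 : E3) R))

lemma _root_.MeasureTheory.MemLp.locL2 {F : Type*} [NormedAddCommGroup F] {f : E3 → F}
    (h : MemLp f 2 volume) : LocL2 f := fun _ => h.restrict _

instance isFiniteMeasure_restrict_ball (R : ℝ) :
    IsFiniteMeasure (volume.restrict (Metric.ball (0 : E3) R)) :=
  ⟨by rw [Measure.restrict_apply_univ]; exact measure_ball_lt_top⟩

lemma LocL2.locallyIntegrable {F : Type*} [NormedAddCommGroup F] {f : E3 → F}
    (h : LocL2 f) : LocallyIntegrable f volume :=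
  locallyIntegrable_of_ball fun R => (h R).integrable (by norm_num)

lemma integral_eq_setIntegral_ball {g : E3 → ℝ} {φ : E3 → ℝ} {R : ℝ}
    (hφ : tsupport φ ⊆ Metric.ball (0 : E3) R) (h : ∀ x, φ x = 0 → fderiv ℝ φ x = 0 → g x = 0) :
    ∫ x, g x = ∫ x in Metric.ball (0 : E3) R, g x := by
  symm
  refine setIntegral_eq_integral_of_forall_compl_eq_zero fun x hx => ?_
  have hx' : x ∉ tsupport φ := fun h' => hx (hφ h')
  exact h x (image_eq_zero_of_notMem_tsupport hx')
    (image_eq_zero_of_notMem_tsupport fun h' => hx' (tsupport_fderiv_subset ℝ h'))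

lemma exists_tsupport_subset_ball {φ : E3 → ℝ} (hφ : HasCompactSupport φ) :
    ∃ R : ℝ, 0 < R ∧ tsupport φ ⊆ Metric.ball (0 : E3) R :=
  hφ.isCompact.isBounded.subset_ball_lt 0 0

/-- One factor converges strongly in L² and the other is fixed, so Hölder's inequality yields L¹
convergence of the products. -/
lemma tendsto_integral_mul {α : Type*} [MeasurableSpace α] {ν : Measure α} {a : ℕ → α → ℝ}
    {b c : α → ℝ} (ha : ∀ n, AEStronglyMeasurable (a n) ν) (hb : MemLp b 2 ν) (hc : MemLp c 2 ν)
    (h : Tendsto (fun n => eLpNorm (a n - b) 2 ν) atTop (𝓝 0)) :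
    Tendsto (fun n => ∫ x, a n x * c x ∂ν) atTop (𝓝 (∫ x, b x * c x ∂ν)) := by
  have hle : ∀ n, eLpNorm ((fun x => a n x * c x) - fun x => b x * c x) 1 ν
      ≤ eLpNorm (a n - b) 2 ν * eLpNorm c 2 ν := fun n => by
    have : ((fun x => a n x * c x) - fun x => b x * c x) = (a n - b) • c := by
      ext x; simp [sub_mul]
    rw [this]
    exact eLpNorm_smul_le_mul_eLpNorm (p := 2) (q := 2) (r := 1) hc.1 ((ha n).sub hb.1)
  refine tendsto_integral_of_L1' _ (hb.1.mul hc.1) ?_ ?_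
  · have h1 : ∀ᶠ n in atTop, eLpNorm (a n - b) 2 ν < 1 :=
      h.eventually (gt_mem_nhds zero_lt_one)
    filter_upwards [h1] with n hn
    have : MemLp (a n - b) 2 ν := ⟨(ha n).sub hb.1, hn.trans ENNReal.one_lt_top⟩
    have h2 : MemLp (a n) 2 ν := by simpa using this.add hb
    exact h2.integrable_mul hc
  · refine tendsto_of_tendsto_of_tendsto_of_le_of_le tendsto_const_nhds ?_
      (fun _ => zero_le) hle
    simpa using ENNReal.Tendsto.mul_const h (Or.inr hc.2.ne)

/-- Functions with locally square integrable weak gradient. -/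
structure LocH1 (f : E3 → ℝ) (Df : E3 → E3 →L[ℝ] ℝ) : Prop where
  weak : HasWeakFDeriv f Df
  locL2 : LocL2 f
  gradLocL2 : LocL2 Df

lemma LocL2.indicator_ball {F : Type*} [NormedAddCommGroup F] {f : E3 → F} (h : LocL2 f) (R : ℝ) :
    MemLp ((Metric.ball (0 : E3) R).indicator f) 2 volume :=
  (memLp_indicator_iff_restrict Metric.isOpen_ball.measurableSet).2 (h R)

/-- The kernels have radius at most one, so on the ball of radius R the mollification only sees
values in the ball of radius R + 1. Truncating there reduces to the global statement. -/
lemma tendsto_mollify_local {F : Type*} [NormedAddCommGroup F] [NormedSpace ℝ F]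
    [CompleteSpace F] {f : E3 → F} (h : LocL2 f) (R : ℝ) :
    Tendsto (fun n => eLpNorm (mollify n f - f) 2 (volume.restrict (Metric.ball (0 : E3) R)))
      atTop (𝓝 0) := by
  have h1 := tendsto_mollify (h.indicator_ball (R + 1))
  refine tendsto_of_tendsto_of_tendsto_of_le_of_le tendsto_const_nhds h1 (fun _ => zero_le) ?_
  intro n
  refine le_trans (le_of_eq ?_) (eLpNorm_mono_measure _
    (Measure.restrict_le_self (s := Metric.ball (0 : E3) R)))
  refine eLpNorm_congr_ae ?_
  filter_upwards [ae_restrict_mem Metric.isOpen_ball.measurableSet] with x hx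
  have hx1 : x ∈ Metric.ball (0 : E3) (R + 1) := Metric.ball_subset_ball (by linarith) hx
  simp only [Pi.sub_apply, indicator_of_mem hx1]
  rw [mollify_congr_of_ball (R := R) (n := n) (f := f)
    (g := (Metric.ball (0 : E3) (R + 1)).indicator f) _ hx]
  intro y hy
  rw [indicator_of_mem hy]

lemma _root_.ContDiff.aestronglyMeasurable_fderiv_apply {g : E3 → ℝ}
    (hg : ContDiff ℝ ((⊤ : ℕ∞) : WithTop ℕ∞) g) (v : E3) (ν : Measure E3) :
    AEStronglyMeasurable (fun x => fderiv ℝ g x v) ν :=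
  ((hg.continuous_fderiv (by simp)).clm_apply continuous_const).aestronglyMeasurable

lemma LocL2.apply {Df : E3 → E3 →L[ℝ] ℝ} (h : LocL2 Df) (v : E3) : LocL2 (fun x => Df x v) :=
  fun R => (ContinuousLinearMap.apply ℝ ℝ v).comp_memLp' (h R)

lemma tendsto_mollify_grad {f : E3 → ℝ} {Df : E3 → E3 →L[ℝ] ℝ} (h : LocH1 f Df) (R : ℝ) (v : E3) :
    Tendsto (fun n => eLpNorm ((fun x => fderiv ℝ (mollify n f) x v) - fun x => Df x v) 2
      (volume.restrict (Metric.ball (0 : E3) R))) atTop (𝓝 0) := by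
  have h1 := tendsto_mollify_local h.gradLocL2 R
  have h2 := ENNReal.Tendsto.const_mul (a := ‖v‖ₑ) h1 (Or.inr (by simp))
  rw [mul_zero] at h2
  refine tendsto_of_tendsto_of_tendsto_of_le_of_le tendsto_const_nhds h2 (fun _ => zero_le) ?_
  intro n
  refine (eLpNorm_le_nnreal_smul_eLpNorm_of_ae_le_mul (c := ‖v‖₊)
    (g := mollify n Df - Df) (Eventually.of_forall fun x => ?_) 2)
  simp only [Pi.sub_apply, fderiv_mollify n h.weak]
  rw [← sub_apply, mul_comm]
  exact ContinuousLinearMap.le_opNNNorm _ _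

lemma LocL2.mul_integrableOn {f g : E3 → ℝ} (hf : LocL2 f) (hg : LocL2 g) (R : ℝ) :
    IntegrableOn (fun x => f x * g x) (Metric.ball (0 : E3) R) volume :=
  (hf R).integrable_mul (hg R)

lemma LocL2.smul_integrableOn {F : Type*} [NormedAddCommGroup F] [NormedSpace ℝ F] {f : E3 → ℝ}
    {g : E3 → F} (hf : LocL2 f) (hg : LocL2 g) (R : ℝ) :
    IntegrableOn (fun x => f x • g x) (Metric.ball (0 : E3) R) volume :=
  memLp_one_iff_integrable.1 (MemLp.smul (p := 2) (q := 2) (r := 1) (hg R) (hf R))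

lemma LocL2.bdd_mul {f g : E3 → ℝ} (hf : LocL2 f) (hg : Continuous g) {C : ℝ}
    (hC : ∀ x, |g x| ≤ C) : LocL2 (fun x => g x * f x) := fun R =>
  (hf R).of_le_mul (c := C) (hg.aestronglyMeasurable.mul (hf R).1)
    (Eventually.of_forall fun x => by rw [norm_mul]; gcongr; exact hC x)

lemma _root_.HasCompactSupport.exists_abs_bound {φ : E3 → ℝ} (hφ : HasCompactSupport φ)
    (hc : Continuous φ) : ∃ C, ∀ x, |φ x| ≤ C :=
  hφ.exists_bound_of_continuous hc

lemma hasCompactSupport_fderiv_apply {φ : E3 → ℝ} (hφ : HasCompactSupport φ) (v : E3) :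
    HasCompactSupport (fun x => fderiv ℝ φ x v) :=
  (hφ.fderiv (𝕜 := ℝ)).comp_left (g := fun A : E3 →L[ℝ] ℝ => A v) (by simp)

lemma _root_.Continuous.locL2 {g : E3 → ℝ} (hg : Continuous g) : LocL2 g := fun R => by
  obtain ⟨K, hK⟩ := (isCompact_closedBall (0 : E3) R).exists_bound_of_continuousOn hg.continuousOn
  refine MemLp.of_bound hg.aestronglyMeasurable K ?_
  filter_upwards [ae_restrict_mem Metric.isOpen_ball.measurableSet] with x hx
  exact hK x (Metric.ball_subset_closedBall hx)

/-- The product rule for weak derivatives. -/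
theorem LocH1.mul {f g : E3 → ℝ} {Df Dg : E3 → E3 →L[ℝ] ℝ} (hf : LocH1 f Df) (hg : LocH1 g Dg) :
    HasWeakFDeriv (fun x => f x * g x) (fun x => f x • Dg x + g x • Df x) := by
  refine ⟨locallyIntegrable_of_ball (hf.locL2.mul_integrableOn hg.locL2),
    locallyIntegrable_of_ball fun R => (hf.locL2.smul_integrableOn hg.gradLocL2 R).add
      (hg.locL2.smul_integrableOn hf.gradLocL2 R), fun φ hφ hφs v => ?_⟩
  obtain ⟨R, -, hR⟩ := exists_tsupport_subset_ball hφs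
  set ν := volume.restrict (Metric.ball (0 : E3) R)
  obtain ⟨C, hC⟩ := hφs.exists_abs_bound hφ.continuous
  have hφ'c : Continuous (fun x => fderiv ℝ φ x v) :=
    (hφ.continuous_fderiv (by simp)).clm_apply continuous_const
  obtain ⟨C', hC'⟩ := (hasCompactSupport_fderiv_apply hφs v).exists_abs_bound hφ'c
  have m1 := hf.locL2.bdd_mul hφ.continuous hC
  have m2 := hf.locL2.bdd_mul hφ'c hC'
  have m3 := (hf.gradLocL2.apply v).bdd_mul hφ.continuous hC
  have hgn : ∀ n, ContDiff ℝ ((⊤ : ℕ∞) : WithTop ℕ∞) (mollify n g) :=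
    fun n => contDiff_mollify n hg.weak.1
  -- Only `g` is mollified: `φ * mollify n g` is then admissible in the weak derivative of `f`, and
  -- every resulting term is a mollified factor times a fixed L² function.
  have key : ∀ n, ∫ x, fderiv ℝ (mollify n g) x v * (φ x * f x) ∂ν
      + ∫ x, mollify n g x * (fderiv ℝ φ x v * f x + φ x * Df x v) ∂ν = 0 := fun n => by
    have h1 := hf.weak.2.2 (fun x => φ x * mollify n g x) (hφ.mul (hgn n)) hφs.mul_right v
    have e1 : ∀ x, fderiv ℝ (fun x => φ x * mollify n g x) x v
        = φ x * fderiv ℝ (mollify n g) x v + mollify n g x * fderiv ℝ φ x v := fun x => by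
      rw [fderiv_fun_mul (hφ.differentiable (by simp) x) ((hgn n).differentiable (by simp) x)]
      simp
    simp only [e1, smul_eq_mul] at h1
    rw [integral_eq_setIntegral_ball (φ := φ) hR, integral_eq_setIntegral_ball (φ := φ) hR] at h1
    rotate_left
    · intro x h _; simp [h]
    · intro x h h'; simp [h, h']
    have mg : LocL2 (mollify n g) := (hgn n).continuous.locL2
    have mg' : LocL2 (fun x => fderiv ℝ (mollify n g) x v) :=
      (((hgn n).continuous_fderiv (by simp)).clm_apply continuous_const).locL2
    have i1 := mg'.mul_integrableOn m1 R
    have i2 := mg.mul_integrableOn m2 R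
    have i3 := mg.mul_integrableOn m3 R
    rw [eq_neg_iff_add_eq_zero, ← integral_add] at h1
    · rw [← integral_add i1]
      · rw [← h1]; congr 1; ext x; ring
      · refine (i2.add i3).congr (Eventually.of_forall fun x => ?_)
        simp only [Pi.add_apply]; ring
    · refine (i1.add i2).congr (Eventually.of_forall fun x => ?_)
      simp only [Pi.add_apply]; ring
    · refine i3.congr (Eventually.of_forall fun x => ?_)
      simp only []; ring
  have t1 := tendsto_integral_mul (ν := ν)
    (fun n => (hgn n).aestronglyMeasurable_fderiv_apply v ν) (hg.gradLocL2.apply v R) (m1 R)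
    (tendsto_mollify_grad hg R v)
  have t2 := tendsto_integral_mul (ν := ν)
    (fun n => (hgn n).continuous.aestronglyMeasurable) (hg.locL2 R) ((m2 R).add (m3 R))
    (tendsto_mollify_local hg.locL2 R)
  have t3 := t1.add t2
  simp only [Pi.add_apply, key] at t3
  have h0 := tendsto_nhds_unique tendsto_const_nhds t3
  simp only [smul_eq_mul, add_apply, smul_apply]
  rw [integral_eq_setIntegral_ball (φ := φ) hR, integral_eq_setIntegral_ball (φ := φ) hR]
  rotate_left
  · intro x h _; simp [h]
  · intro x h h'; simp [h']
  have j1 := (hg.gradLocL2.apply v).mul_integrableOn m1 R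
  have j2 := hg.locL2.mul_integrableOn m2 R
  have j3 := hg.locL2.mul_integrableOn m3 R
  have e : ∀ x, g x * (fderiv ℝ φ x v * f x + φ x * Df x v)
      = g x * (fderiv ℝ φ x v * f x) + g x * (φ x * Df x v) := fun x => by ring
  simp only [e] at h0
  rw [integral_add j2 j3] at h0
  have e2 : ∫ x in Metric.ball (0 : E3) R, φ x * (f x * Dg x v + g x * Df x v)
      = ∫ x, Dg x v * (φ x * f x) ∂ν + ∫ x, g x * (φ x * Df x v) ∂ν := by
    rw [← integral_add j1 j3]; congr 1; ext x; ring
  have e3 : ∫ x in Metric.ball (0 : E3) R, fderiv ℝ φ x v * (f x * g x)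
      = ∫ x, g x * (fderiv ℝ φ x v * f x) ∂ν := by
    congr 1; ext x; ring
  rw [e2, e3]
  linarith

end WeakCalculus

/-! ### Chain rule for weak derivatives. -/

section ChainRule

lemma ae_tendsto_mollify {f : E3 → ℝ} (hf : LocallyIntegrable f volume) :
    ∀ᵐ x, Tendsto (fun n => mollify n f x) atTop (𝓝 (f x)) :=
  -- The constant 2 is the ratio of outer to inner radius built into `bump`; almost everywhere
  -- convergence needs this ratio bounded.
  ContDiffBump.ae_convolution_tendsto_right_of_locallyIntegrable (K := 2)
    tendsto_bump_rOut (Eventually.of_forall fun n => by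
      change (1 : ℝ) / (n + 1) ≤ 2 * (1 / (2 * (n + 1)))
      apply le_of_eq; field_simp) hf

lemma abs_sub_le_of_hasDerivAt {G G' : ℝ → ℝ} (hG : ∀ s, HasDerivAt G (G' s) s) {L : ℝ}
    (hL : ∀ s, |G' s| ≤ L) (a b : ℝ) : |G a - G b| ≤ L * |a - b| := by
  have := Convex.norm_image_sub_le_of_norm_hasDerivWithin_le (f := G) (f' := G') (s := univ)
    (C := L) (x := b) (y := a) (fun x _ => (hG x).hasDerivWithinAt) (fun x _ => hL x)
    convex_univ (mem_univ _) (mem_univ _)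
  simpa [Real.norm_eq_abs] using this

/-- The chain rule for weak derivatives, for functions with bounded continuous derivative. -/
theorem LocH1.comp {f : E3 → ℝ} {Df : E3 → E3 →L[ℝ] ℝ} (hf : LocH1 f Df) {G G' : ℝ → ℝ}
    (hG : ∀ s, HasDerivAt G (G' s) s) (hG' : Continuous G') {L : ℝ} (hL : ∀ s, |G' s| ≤ L) :
    LocH1 (fun x => G (f x)) (fun x => G' (f x) • Df x) := by
  have hL0 : 0 ≤ L := (abs_nonneg _).trans (hL 0)
  have hGc : Continuous G := continuous_iff_continuousAt.2 fun s => (hG s).continuousAt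
  have hlip := abs_sub_le_of_hasDerivAt hG hL
  have l1 : LocL2 (fun x => G (f x)) := fun R => by
    have hm : AEStronglyMeasurable (fun x => G (f x)) (volume.restrict (Metric.ball (0 : E3) R)) :=
      hGc.comp_aestronglyMeasurable (hf.locL2 R).1
    have h2 : MemLp (fun x => L * |f x| + |G 0|) 2 (volume.restrict (Metric.ball (0 : E3) R)) :=
      ((hf.locL2 R).abs.const_mul L).add (memLp_const _)
    refine h2.mono hm (Eventually.of_forall fun x => ?_)
    rw [Real.norm_eq_abs, Real.norm_of_nonneg (by positivity)]
    have := hlip (f x) 0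
    rw [sub_zero] at this
    calc |G (f x)| = |(G (f x) - G 0) + G 0| := by ring_nf
      _ ≤ |G (f x) - G 0| + |G 0| := abs_add_le _ _
      _ ≤ _ := by gcongr
  have l2 : LocL2 (fun x => G' (f x) • Df x) := fun R => by
    refine (hf.gradLocL2 R).of_le_mul (c := L) ?_ (Eventually.of_forall fun x => ?_)
    · exact (hG'.comp_aestronglyMeasurable (hf.locL2 R).1).smul (hf.gradLocL2 R).1
    · rw [norm_smul]; gcongr; exact hL _
  refine ⟨⟨l1.locallyIntegrable, l2.locallyIntegrable, fun φ hφ hφs v => ?_⟩, l1, l2⟩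
  obtain ⟨R, -, hR⟩ := exists_tsupport_subset_ball hφs
  set ν := volume.restrict (Metric.ball (0 : E3) R)
  obtain ⟨C, hC⟩ := hφs.exists_abs_bound hφ.continuous
  have hφ'c : Continuous (fun x => fderiv ℝ φ x v) :=
    (hφ.continuous_fderiv (by simp)).clm_apply continuous_const
  obtain ⟨C', hC'⟩ := (hasCompactSupport_fderiv_apply hφs v).exists_abs_bound hφ'c
  have hgn : ∀ n, ContDiff ℝ ((⊤ : ℕ∞) : WithTop ℕ∞) (mollify n f) :=
    fun n => contDiff_mollify n hf.weak.1
  have key : ∀ n, ∫ x, G (mollify n f x) * fderiv ℝ φ x v ∂ν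
      + ∫ x, fderiv ℝ (mollify n f) x v * (G' (mollify n f x) * φ x) ∂ν = 0 := fun n => by
    have d1 : ∀ x, HasFDerivAt (fun x => G (mollify n f x))
        (G' (mollify n f x) • fderiv ℝ (mollify n f) x) x := fun x =>
      (hG _).comp_hasFDerivAt x ((hgn n).differentiable (by simp) x).hasFDerivAt
    have c1 : Continuous (fun x => G (mollify n f x)) := hGc.comp (hgn n).continuous
    have c2 : Continuous (fun x => fderiv ℝ (fun x => G (mollify n f x)) x v) := by
      simp only [fun x => (d1 x).fderiv]
      exact ((hG'.comp (hgn n).continuous).smul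
        ((hgn n).continuous_fderiv (by simp))).clm_apply continuous_const
    have h1 := integral_mul_fderiv_eq_neg_fderiv_mul_of_integrable (μ := (volume : Measure E3))
      (f := fun x => G (mollify n f x)) (g := φ) (v := v)
      ((c2.mul hφ.continuous).integrable_of_hasCompactSupport hφs.mul_left)
      ((c1.mul hφ'c).integrable_of_hasCompactSupport
        (hasCompactSupport_fderiv_apply hφs v).mul_left)
      ((c1.mul hφ.continuous).integrable_of_hasCompactSupport hφs.mul_left)
      (fun x _ => (d1 x).differentiableAt) (fun x _ => hφ.differentiable (by simp) x)
    rw [integral_eq_setIntegral_ball (φ := φ) hR, integral_eq_setIntegral_ball (φ := φ) hR] at h1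
    rotate_left
    · intro x h _; simp [h]
    · intro x h h'; simp [h']
    rw [eq_neg_iff_add_eq_zero] at h1
    rw [← h1]
    congr 2
    ext x
    rw [(d1 x).fderiv]
    simp only [smul_apply, smul_eq_mul]
    ring
  have hae : ∀ᵐ x ∂ν, Tendsto (fun n => mollify n f x) atTop (𝓝 (f x)) :=
    ae_restrict_of_ae (ae_tendsto_mollify hf.weak.1)
  have hφL2 : MemLp (fun x => fderiv ℝ φ x v) 2 ν := MemLp.of_bound hφ'c.aestronglyMeasurable C'
    (Eventually.of_forall hC')
  have t1 : Tendsto (fun n => ∫ x, G (mollify n f x) * fderiv ℝ φ x v ∂ν) atTop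
      (𝓝 (∫ x, G (f x) * fderiv ℝ φ x v ∂ν)) := by
    refine tendsto_integral_mul (fun n => (hGc.comp (hgn n).continuous).aestronglyMeasurable)
      (l1 R) hφL2 ?_
    have h2 := ENNReal.Tendsto.const_mul (a := ENNReal.ofReal L) (tendsto_mollify_local hf.locL2 R)
      (Or.inr (by simp))
    rw [mul_zero] at h2
    refine tendsto_of_tendsto_of_tendsto_of_le_of_le tendsto_const_nhds h2 (fun _ => zero_le) ?_
    intro n
    exact eLpNorm_le_mul_eLpNorm_of_ae_le_mul (Eventually.of_forall fun x => hlip _ _) 2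
  -- With f_n the mollification, ∇f_n G'(f_n) is split as ∇f G'(f_n) + (∇f_n - ∇f) G'(f_n). The
  -- first part converges by domination, using f_n → f almost everywhere and the continuity of G';
  -- the second tends to zero in L¹ because G' is bounded.
  have t2 : Tendsto (fun n => ∫ x, Df x v * (G' (mollify n f x) * φ x) ∂ν) atTop
      (𝓝 (∫ x, Df x v * (G' (f x) * φ x) ∂ν)) := by
    refine tendsto_integral_of_dominated_convergence (fun x => |Df x v| * (L * C)) (fun n => ?_)
      ?_ (fun n => Eventually.of_forall fun x => ?_) ?_
    · exact (hf.gradLocL2.apply v R).1.mul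
        ((hG'.comp (hgn n).continuous).mul hφ.continuous).aestronglyMeasurable
    · exact ((hf.gradLocL2.apply v R).integrable (by norm_num)).abs.mul_const _
    · rw [norm_mul, norm_mul]
      gcongr
      · exact le_rfl
      · exact hL _
      · exact hC _
    · filter_upwards [hae] with x hx
      exact (((hG'.tendsto _).comp hx).mul_const _).const_mul _
  have t3 : Tendsto (fun n => ∫ x, (fderiv ℝ (mollify n f) x v - Df x v)
      * (G' (mollify n f x) * φ x) ∂ν) atTop (𝓝 0) := by
    have h2 := tendsto_mollify_grad hf R v
    have h3 := ENNReal.Tendsto.const_mul (a := ENNReal.ofReal (L * C)) h2 (Or.inr (by simp))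
    have h4 := ENNReal.Tendsto.mul_const (b := ν univ ^ (1 / (1 : ℝ≥0∞).toReal
      - 1 / (2 : ℝ≥0∞).toReal)) h3 (Or.inr (by
        refine ENNReal.rpow_ne_top_of_nonneg (by norm_num) (measure_ne_top _ _)))
    rw [mul_zero, zero_mul] at h4
    have m : ∀ n, AEStronglyMeasurable (fun x => (fderiv ℝ (mollify n f) x v - Df x v)
        * (G' (mollify n f x) * φ x)) ν := fun n =>
      (((hgn n).aestronglyMeasurable_fderiv_apply v _).sub (hf.gradLocL2.apply v R).1).mul
        ((hG'.comp (hgn n).continuous).mul hφ.continuous).aestronglyMeasurable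
    have h5 : ∀ n, eLpNorm (fun x => (fderiv ℝ (mollify n f) x v - Df x v)
        * (G' (mollify n f x) * φ x)) 1 ν ≤ ENNReal.ofReal (L * C) *
        eLpNorm ((fun x => fderiv ℝ (mollify n f) x v) - fun x => Df x v) 2 ν *
        ν univ ^ (1 / (1 : ℝ≥0∞).toReal - 1 / (2 : ℝ≥0∞).toReal) := fun n => by
      refine (eLpNorm_le_eLpNorm_mul_rpow_measure_univ (p := 1) (q := 2) (by norm_num) (m n)).trans
        ?_
      gcongr
      refine eLpNorm_le_mul_eLpNorm_of_ae_le_mul (Eventually.of_forall fun x => ?_) 2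
      rw [norm_mul, norm_mul, mul_comm]
      refine mul_le_mul (mul_le_mul (hL _) (hC _) (norm_nonneg _) hL0) le_rfl (norm_nonneg _)
        (mul_nonneg hL0 ((abs_nonneg _).trans (hC 0)))
    have h6 := tendsto_of_tendsto_of_tendsto_of_le_of_le tendsto_const_nhds h4
      (fun _ => zero_le) h5
    have h7 := tendsto_integral_of_L1' (μ := ν) (fun _ : E3 => (0 : ℝ)) aestronglyMeasurable_const
      (F := fun n x => (fderiv ℝ (mollify n f) x v - Df x v) * (G' (mollify n f x) * φ x))
      (l := atTop) ?_ ?_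
    · simpa using h7
    · filter_upwards [h6.eventually (gt_mem_nhds zero_lt_one)] with n hn
      exact memLp_one_iff_integrable.1 ⟨m n, hn.trans ENNReal.one_lt_top⟩
    · refine h6.congr fun n => ?_
      congr 1
      ext x
      simp
  have t4 := (t1.add (t2.add t3))
  have h0 : ∫ x, G (f x) * fderiv ℝ φ x v ∂ν + ∫ x, Df x v * (G' (f x) * φ x) ∂ν = 0 := by
    rw [add_zero] at t4
    refine tendsto_nhds_unique t4 (Tendsto.congr (fun n => ?_) tendsto_const_nhds)
    rw [← key n]
    congr 1
    have i2 : Integrable (fun x => Df x v * (G' (mollify n f x) * φ x)) ν := by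
      refine ((hf.gradLocL2.apply v R).integrable (by norm_num)).mul_bdd (c := L * C) ?_ ?_
      · exact ((hG'.comp (hgn n).continuous).mul hφ.continuous).aestronglyMeasurable
      · refine Eventually.of_forall fun x => ?_
        rw [norm_mul]
        gcongr
        · exact hL _
        · exact hC _
    have i3 : Integrable (fun x => fderiv ℝ (mollify n f) x v * (G' (mollify n f x) * φ x)) ν := by
      have c : Continuous (fun x => fderiv ℝ (mollify n f) x v * (G' (mollify n f x) * φ x)) :=
        (((hgn n).continuous_fderiv (by simp)).clm_apply continuous_const).mul
          ((hG'.comp (hgn n).continuous).mul hφ.continuous)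
      exact (c.integrable_of_hasCompactSupport hφs.mul_left.mul_left).restrict
    rw [← integral_add i2]
    · congr 1; ext x; ring
    · refine (i3.sub i2).congr (Eventually.of_forall fun x => ?_)
      simp only [Pi.sub_apply]; ring
  simp only [smul_eq_mul, smul_apply]
  rw [integral_eq_setIntegral_ball (φ := φ) hR, integral_eq_setIntegral_ball (φ := φ) hR]
  rotate_left
  · intro x h _; simp [h]
  · intro x h h'; simp [h']
  have e2 : ∫ x in Metric.ball (0 : E3) R, φ x * (G' (f x) * Df x v)
      = ∫ x, Df x v * (G' (f x) * φ x) ∂ν := by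
    congr 1; ext x; ring
  have e3 : ∫ x in Metric.ball (0 : E3) R, fderiv ℝ φ x v * G (f x)
      = ∫ x, G (f x) * fderiv ℝ φ x v ∂ν := by
    congr 1; ext x; ring
  rw [e2, e3]
  linarith

end ChainRule

/-! ### Smooth spatial cutoffs at radius R. -/

section Cutoff

/-- The reference cutoff, equal to one on the unit ball and supported in the ball of radius two. -/
noncomputable def unitBump : ContDiffBump (0 : E3) := ⟨1, 2, one_pos, one_lt_two⟩

/-- The smooth cutoff at radius `R`. -/
noncomputable def cutoff (R : ℝ) (x : E3) : ℝ := unitBump (R⁻¹ • x)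

lemma contDiff_cutoff (R : ℝ) : ContDiff ℝ ((⊤ : ℕ∞) : WithTop ℕ∞) (cutoff R) :=
  unitBump.contDiff.comp (contDiff_const_smul _)

lemma cutoff_nonneg (R : ℝ) (x : E3) : 0 ≤ cutoff R x := unitBump.nonneg

lemma cutoff_le_one (R : ℝ) (x : E3) : cutoff R x ≤ 1 := unitBump.le_one

lemma cutoff_eq_one {R : ℝ} (hR : 0 < R) {x : E3} (hx : ‖x‖ ≤ R) : cutoff R x = 1 := by
  refine unitBump.one_of_mem_closedBall ?_
  rw [mem_closedBall_zero_iff, norm_smul, norm_inv, Real.norm_of_nonneg hR.le]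
  change R⁻¹ * ‖x‖ ≤ 1
  rw [inv_mul_le_iff₀ hR]
  linarith

lemma cutoff_eq_zero {R : ℝ} (hR : 0 < R) {x : E3} (hx : 2 * R ≤ ‖x‖) : cutoff R x = 0 := by
  refine unitBump.zero_of_le_dist ?_
  rw [dist_zero_right, norm_smul, norm_inv, Real.norm_of_nonneg hR.le]
  change 2 ≤ R⁻¹ * ‖x‖
  rw [le_inv_mul_iff₀ hR]
  linarith

lemma hasCompactSupport_cutoff {R : ℝ} (hR : 0 < R) : HasCompactSupport (cutoff R) :=
  HasCompactSupport.intro (isCompact_closedBall (0 : E3) (2 * R)) fun x hx => by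
    rw [mem_closedBall_zero_iff, not_le] at hx
    exact cutoff_eq_zero hR hx.le

lemma fderiv_cutoff (R : ℝ) (x : E3) :
    fderiv ℝ (cutoff R) x = R⁻¹ • fderiv ℝ unitBump (R⁻¹ • x) := by
  have h1 : HasFDerivAt (fun x : E3 => R⁻¹ • x) (R⁻¹ • ContinuousLinearMap.id ℝ E3) x :=
    (hasFDerivAt_id x).const_smul R⁻¹
  have h2 := ((unitBump.contDiff (n := 1)).differentiable one_ne_zero (R⁻¹ • x)).hasFDerivAt.comp x h1
  have : cutoff R = unitBump ∘ fun x : E3 => R⁻¹ • x := rfl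
  rw [this, h2.fderiv]
  ext v
  simp

/-- Scaling of one fixed bump. The same constant serves all radii, which is what makes the L³ norm
of the gradient bounded uniformly in R in dimension three. -/
lemma exists_fderiv_cutoff_bound :
    ∃ K : ℝ, 0 < K ∧ ∀ R : ℝ, 0 < R → ∀ x, ‖fderiv ℝ (cutoff R) x‖ ≤ K / R := by
  have hc : Continuous (fderiv ℝ unitBump) :=
    (unitBump.contDiff (n := 1)).continuous_fderiv one_ne_zero
  obtain ⟨K, hK⟩ := (unitBump.hasCompactSupport.fderiv (𝕜 := ℝ)).exists_bound_of_continuous hc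
  refine ⟨max K 1, by positivity, fun R hR x => ?_⟩
  rw [fderiv_cutoff, norm_smul, norm_inv, Real.norm_of_nonneg hR.le, div_eq_inv_mul]
  gcongr
  exact (hK _).trans (le_max_left _ _)

lemma fderiv_cutoff_eq_zero {R : ℝ} (hR : 0 < R) {x : E3} (hx : ‖x‖ < R ∨ 2 * R < ‖x‖) :
    fderiv ℝ (cutoff R) x = 0 := by
  rcases hx with hx | hx
  · have : cutoff R =ᶠ[𝓝 x] fun _ => 1 := by
      filter_upwards [(isOpen_lt continuous_norm continuous_const).mem_nhds hx] with y hy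
      exact cutoff_eq_one hR (le_of_lt hy)
    rw [this.fderiv_eq]; simp
  · have : cutoff R =ᶠ[𝓝 x] fun _ => 0 := by
      filter_upwards [(isOpen_lt continuous_const continuous_norm).mem_nhds hx] with y hy
      exact cutoff_eq_zero hR (le_of_lt hy)
    rw [this.fderiv_eq]; simp

end Cutoff

/-! ### The embedding of H¹ into L⁶. -/

section Sobolev

lemma HasWeakFDeriv.clm_comp {F G : Type} [NormedAddCommGroup F] [NormedSpace ℝ F]
    [CompleteSpace F] [NormedAddCommGroup G] [NormedSpace ℝ G] [CompleteSpace G]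
    {f : E3 → F} {Df : E3 → E3 →L[ℝ] F} (h : HasWeakFDeriv f Df) (A : F →L[ℝ] G) :
    HasWeakFDeriv (fun x => A (f x)) (fun x => A ∘L Df x) := by
  obtain ⟨h1, h2, h3⟩ := h
  refine ⟨fun x => A.integrableAtFilter_comp (h1 x), fun x =>
    (ContinuousLinearMap.compL ℝ E3 F G A).integrableAtFilter_comp (h2 x), fun φ hφ hs v => ?_⟩
  have e := h3 φ hφ hs v
  have i1 : Integrable (fun x => (fderiv ℝ φ x v) • f x) volume :=
    h1.integrable_smul_left_of_hasCompactSupport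
      ((hφ.continuous_fderiv (by simp)).clm_apply continuous_const)
      (hasCompactSupport_fderiv_apply hs v)
  have i2 : Integrable (fun x => φ x • Df x v) volume :=
    ((ContinuousLinearMap.apply ℝ F v).integrable_comp
      (h2.integrable_smul_left_of_hasCompactSupport hφ.continuous hs)).congr
      (Eventually.of_forall fun x => by simp)
  have e1 := A.integral_comp_comm i1
  have e2 := A.integral_comp_comm i2
  simp only [map_smul] at e1 e2
  simp only [ContinuousLinearMap.comp_apply]
  rw [e1, e2, e, map_neg]

/-- Sobolev's inequality in the qualitative form `H¹(ℝ³) ⊆ L⁶(ℝ³)`. -/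
theorem HasWeakFDeriv.memLp_six {f : E3 → ℝ} {Df : E3 → E3 →L[ℝ] ℝ} (h : HasWeakFDeriv f Df)
    (hf : MemLp f 2 volume) (hDf : MemLp Df 2 volume) : MemLp f 6 volume := by
  obtain ⟨K, hK0, hK⟩ := exists_fderiv_cutoff_bound
  set C : ℝ≥0 := SNormLESNormFDerivOfEqConst ℝ (volume : Measure E3) (2 : ℝ≥0)
  set f' : ℕ → E3 → ℝ := fun n x => cutoff (n + 1) x * mollify n f x
  have hR : ∀ n : ℕ, (0 : ℝ) < n + 1 := fun n => by positivity
  have hm : ∀ n, ContDiff ℝ ((⊤ : ℕ∞) : WithTop ℕ∞) (mollify n f) :=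
    fun n => contDiff_mollify n h.1
  have hc : ∀ n, ContDiff ℝ ((⊤ : ℕ∞) : WithTop ℕ∞) (f' n) :=
    fun n => (contDiff_cutoff _).mul (hm n)
  have hs : ∀ n, HasCompactSupport (f' n) := fun n => (hasCompactSupport_cutoff (hR n)).mul_right
  -- Gagliardo–Nirenberg–Sobolev with 1/6 = 1/2 - 1/3, for smooth compactly supported functions; the
  -- constant does not depend on `n`.
  have b1 : ∀ n, eLpNorm (f' n) 6 volume ≤ C * eLpNorm (fderiv ℝ (f' n)) 2 volume := fun n => by
    have := eLpNorm_le_eLpNorm_fderiv_of_eq (μ := (volume : Measure E3)) (F := ℝ) (p := 2)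
      (p' := 6) ((hc n).of_le (by simp)) (hs n) (by norm_num)
      (by rw [finrank_euclideanSpace_fin]; norm_num)
      (by rw [finrank_euclideanSpace_fin]; norm_num)
    simpa [C] using this
  have hd : ∀ n x, fderiv ℝ (f' n) x = cutoff (n + 1) x • mollify n Df x
      + mollify n f x • fderiv ℝ (cutoff (n + 1)) x := fun n x => by
    rw [← fderiv_mollify n h]
    exact fderiv_fun_mul ((contDiff_cutoff _).differentiable (by simp) x)
      ((hm n).differentiable (by simp) x)
  have b2 : ∀ n, eLpNorm (fderiv ℝ (f' n)) 2 volume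
      ≤ eLpNorm Df 2 volume + ENNReal.ofReal K * eLpNorm f 2 volume := fun n => by
    have mDf : AEStronglyMeasurable (mollify n Df) volume :=
      (contDiff_mollify n h.2.1).continuous.aestronglyMeasurable
    have mc : AEStronglyMeasurable (cutoff (n + 1)) volume :=
      (contDiff_cutoff _).continuous.aestronglyMeasurable
    have mf : AEStronglyMeasurable (mollify n f) volume := (hm n).continuous.aestronglyMeasurable
    have mc' : AEStronglyMeasurable (fderiv ℝ (cutoff (n + 1))) volume :=
      ((contDiff_cutoff _).continuous_fderiv (by simp)).aestronglyMeasurable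
    rw [show fderiv ℝ (f' n) = _ from funext (hd n)]
    refine (eLpNorm_add_le (mc.smul mDf) (mf.smul mc') (by norm_num)).trans ?_
    gcongr
    · refine le_trans (eLpNorm_mono fun x => ?_) (eLpNorm_mollify_le n hDf.1)
      rw [Pi.smul_apply', norm_smul, Real.norm_of_nonneg (cutoff_nonneg _ _)]
      exact mul_le_of_le_one_left (norm_nonneg _) (cutoff_le_one _ _)
    · refine le_trans (eLpNorm_le_mul_eLpNorm_of_ae_le_mul (c := K) (g := mollify n f)
        (Eventually.of_forall fun x => ?_) 2) ?_
      · rw [Pi.smul_apply', norm_smul, mul_comm]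
        gcongr
        refine (hK _ (hR n) x).trans (div_le_self hK0.le ?_)
        linarith [(Nat.cast_nonneg n : (0:ℝ) ≤ n)]
      · gcongr
        exact eLpNorm_mollify_le n hf.1
  have hae : ∀ᵐ x, Tendsto (fun n => f' n x) atTop (𝓝 (f x)) := by
    filter_upwards [ae_tendsto_mollify h.1] with x hx
    refine hx.congr' ?_
    filter_upwards [eventually_ge_atTop ⌈‖x‖⌉₊] with n hn
    have : ‖x‖ ≤ n + 1 := by linarith [(Nat.ceil_le.1 hn : ‖x‖ ≤ n)]
    simp [f', cutoff_eq_one (hR n) this]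
  -- The L⁶ norm is lower semicontinuous under almost everywhere convergence, so the uniform bound
  -- passes to `f`.
  refine ⟨hf.1, lt_of_le_of_lt (Lp.eLpNorm_lim_le_liminf_eLpNorm
    (fun n => (hc n).continuous.aestronglyMeasurable) f hae) ?_⟩
  have hB : C * (eLpNorm Df 2 volume + ENNReal.ofReal K * eLpNorm f 2 volume) < ⊤ :=
    ENNReal.mul_lt_top ENNReal.coe_lt_top (ENNReal.add_lt_top.2
      ⟨hDf.2, ENNReal.mul_lt_top ENNReal.ofReal_lt_top hf.2⟩)
  refine lt_of_le_of_lt ?_ hB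
  refine liminf_le_of_frequently_le' (Eventually.of_forall fun n => ?_).frequently
  exact (b1 n).trans (by gcongr; exact b2 n)

end Sobolev

/-! ### The truncated weight and its potential; the argument w stands for |u|², so w^(21/40) is
|u|^{r-2} with r = 61/20. -/

section Weight

/-- The base of the truncated power weight. -/
noncomputable def wbase (ε w : ℝ) : ℝ := (1 + w ^ 2) / (1 + ε * w ^ 2)

/-- The truncated weight, growing like `w ^ (21/40)` until it saturates. -/
noncomputable def wt (ε w : ℝ) : ℝ := wbase ε w ^ (21 / 80 : ℝ)

/-- The derivative of `wbase`. -/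
noncomputable def wbase' (ε w : ℝ) : ℝ := 2 * w * (1 - ε) / (1 + ε * w ^ 2) ^ 2

/-- The derivative of `wt`. -/
noncomputable def wt' (ε w : ℝ) : ℝ := 21 / 80 * wbase ε w ^ (21 / 80 - 1 : ℝ) * wbase' ε w

/-- The convex potential of the truncated weight. -/
noncomputable def pot (ε w : ℝ) : ℝ := 1 + 61 / 40 * ∫ s in (0 : ℝ)..w, wt ε s

lemma one_le_wbase {ε : ℝ} (h0 : 0 < ε) (h1 : ε ≤ 1) (w : ℝ) : 1 ≤ wbase ε w := by
  rw [wbase, le_div_iff₀ (by positivity)]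
  nlinarith [sq_nonneg w]

lemma wbase_pos {ε : ℝ} (h0 : 0 < ε) (h1 : ε ≤ 1) (w : ℝ) : 0 < wbase ε w := one_pos.trans_le (one_le_wbase h0 h1 w)

lemma wbase_le_inv {ε : ℝ} (h0 : 0 < ε) (h1 : ε ≤ 1) (w : ℝ) : wbase ε w ≤ 1 / ε := by
  rw [wbase, div_le_div_iff₀ (by positivity) h0]
  nlinarith [sq_nonneg w]

lemma wbase_le {ε : ℝ} (h0 : 0 < ε) (w : ℝ) : wbase ε w ≤ 1 + w ^ 2 :=
  div_le_self (by positivity) (by nlinarith [mul_nonneg h0.le (sq_nonneg w)])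

lemma hasDerivAt_wbase {ε : ℝ} (h0 : 0 < ε) (w : ℝ) : HasDerivAt (wbase ε) (wbase' ε w) w := by
  have hd : 1 + ε * w ^ 2 ≠ 0 := by positivity
  have a1 : HasDerivAt (fun w : ℝ => 1 + w ^ 2) (2 * w) w := by
    simpa using ((hasDerivAt_id w).pow 2).const_add 1
  have a2 : HasDerivAt (fun w : ℝ => 1 + ε * w ^ 2) (ε * (2 * w)) w := by
    simpa using (((hasDerivAt_id w).pow 2).const_mul ε).const_add 1
  have := a1.div a2 hd
  refine this.congr_deriv ?_
  rw [wbase']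
  congr 1
  ring

lemma hasDerivAt_wt {ε : ℝ} (h0 : 0 < ε) (h1 : ε ≤ 1) (w : ℝ) : HasDerivAt (wt ε) (wt' ε w) w := by
  have := (hasDerivAt_wbase h0 w).rpow_const (p := 21 / 80) (Or.inl (wbase_pos h0 h1 w).ne')
  refine this.congr_deriv ?_
  rw [wt']; ring

lemma continuous_wt {ε : ℝ} (h0 : 0 < ε) (h1 : ε ≤ 1) : Continuous (wt ε) :=
  continuous_iff_continuousAt.2 fun w => (hasDerivAt_wt h0 h1 w).continuousAt

lemma continuous_wt' {ε : ℝ} (h0 : 0 < ε) (h1 : ε ≤ 1) : Continuous (wt' ε) := by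
  have c1 : Continuous (wbase ε) :=
    continuous_iff_continuousAt.2 fun w => (hasDerivAt_wbase h0 w).continuousAt
  have c2 : Continuous (wbase' ε) := by
    unfold wbase'
    refine Continuous.div (by fun_prop) (by fun_prop) fun w => ?_
    positivity
  unfold wt'
  exact (continuous_const.mul (c1.rpow_const fun w => Or.inl (wbase_pos h0 h1 w).ne')).mul c2

lemma one_le_wt {ε : ℝ} (h0 : 0 < ε) (h1 : ε ≤ 1) (w : ℝ) : 1 ≤ wt ε w := Real.one_le_rpow (one_le_wbase h0 h1 w) (by norm_num)

lemma wt_pos {ε : ℝ} (h0 : 0 < ε) (h1 : ε ≤ 1) (w : ℝ) : 0 < wt ε w := one_pos.trans_le (one_le_wt h0 h1 w)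

lemma wt_le_inv {ε : ℝ} (h0 : 0 < ε) (h1 : ε ≤ 1) (w : ℝ) : wt ε w ≤ 1 / ε :=
  (Real.rpow_le_self_of_one_le (one_le_wbase h0 h1 w) (by norm_num)).trans (wbase_le_inv h0 h1 w)

lemma wt_le {ε : ℝ} (h0 : 0 < ε) (h1 : ε ≤ 1) {w : ℝ} (hw : 0 ≤ w) : wt ε w ≤ 1 + w := by
  have h2 : wbase ε w ≤ (1 + w) ^ (2 : ℝ) := by
    refine (wbase_le h0 w).trans ?_
    rw [Real.rpow_two]; nlinarith
  calc wt ε w ≤ ((1 + w) ^ (2 : ℝ)) ^ (21 / 80 : ℝ) :=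
        Real.rpow_le_rpow (wbase_pos h0 h1 w).le h2 (by norm_num)
    _ = (1 + w) ^ (21 / 40 : ℝ) := by rw [← Real.rpow_mul (by linarith)]; norm_num
    _ ≤ 1 + w := Real.rpow_le_self_of_one_le (by linarith) (by norm_num)

lemma wt'_nonneg {ε : ℝ} (h0 : 0 < ε) (h1 : ε ≤ 1) {w : ℝ} (hw : 0 ≤ w) : 0 ≤ wt' ε w := by
  have := wbase_pos h0 h1 w
  have : 0 ≤ wbase' ε w := by
    rw [wbase']; have : 0 ≤ 1 - ε := by linarith
    positivity
  rw [wt']; positivity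

lemma abs_wbase'_le {ε : ℝ} (h0 : 0 < ε) (h1 : ε ≤ 1) (w : ℝ) : |wbase' ε w| ≤ 1 / ε := by
  rw [wbase', abs_div, abs_mul, abs_mul, abs_two, abs_of_nonneg (by linarith : 0 ≤ 1 - ε),
    abs_of_nonneg (by positivity : 0 ≤ (1 + ε * w ^ 2) ^ 2), div_le_div_iff₀ (by positivity) h0]
  have h2 : 2 * |w| ≤ 1 + w ^ 2 := by nlinarith [sq_nonneg (|w| - 1), sq_abs w]
  have hd : 1 ≤ 1 + ε * w ^ 2 := by nlinarith [mul_nonneg h0.le (sq_nonneg w)]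
  have h3 : (1 + w ^ 2) * ε ≤ 1 + ε * w ^ 2 := by nlinarith
  calc 2 * |w| * (1 - ε) * ε ≤ 2 * |w| * 1 * ε := by gcongr; linarith
    _ ≤ (1 + w ^ 2) * ε := by rw [mul_one]; gcongr
    _ ≤ 1 + ε * w ^ 2 := h3
    _ ≤ 1 * (1 + ε * w ^ 2) ^ 2 := by nlinarith

lemma abs_wt'_le {ε : ℝ} (h0 : 0 < ε) (h1 : ε ≤ 1) (w : ℝ) : |wt' ε w| ≤ 1 / ε := by
  have h2 : wbase ε w ^ (21 / 80 - 1 : ℝ) ≤ 1 :=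
    Real.rpow_le_one_of_one_le_of_nonpos (one_le_wbase h0 h1 w) (by norm_num)
  have h3 : 0 ≤ wbase ε w ^ (21 / 80 - 1 : ℝ) := (Real.rpow_pos_of_pos (wbase_pos h0 h1 w) _).le
  rw [wt', abs_mul, abs_of_nonneg (by positivity)]
  calc _ ≤ 1 * |wbase' ε w| := by gcongr; linarith
    _ ≤ _ := by rw [one_mul]; exact abs_wbase'_le h0 h1 w

lemma mul_wbase'_le {ε : ℝ} (h0 : 0 < ε) (w : ℝ) : w * wbase' ε w ≤ 2 * wbase ε w := by
  rw [wbase, wbase', ← mul_div_assoc, ← mul_div_assoc, div_le_div_iff₀ (by positivity)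
    (by positivity)]
  have a : 0 ≤ ε * w ^ 2 := by positivity
  have : w * (2 * w * (1 - ε)) ≤ 2 * (1 + w ^ 2) * (1 + ε * w ^ 2) := by
    nlinarith [mul_nonneg a (sq_nonneg w), sq_nonneg w, mul_nonneg h0.le (sq_nonneg w)]
  nlinarith [mul_le_mul_of_nonneg_right this (by positivity : 0 ≤ 1 + ε * w ^ 2)]

/-- The logarithmic derivative of the truncated weight never exceeds that of w^(21/40), because
truncation only slows the growth of `wbase`. For w = |u|² this is the condition m ≤ 21/20 required
by the coercivity of the viscous form. -/
lemma two_mul_wt'_le {ε : ℝ} (h0 : 0 < ε) (h1 : ε ≤ 1) (w : ℝ) :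
    2 * w * wt' ε w ≤ 21 / 20 * wt ε w := by
  have hp := wbase_pos h0 h1 w
  have e : wt ε w = wbase ε w ^ (21 / 80 - 1 : ℝ) * wbase ε w := by
    rw [wt]; nth_rw 3 [← Real.rpow_one (wbase ε w)]; rw [← Real.rpow_add hp]; norm_num
  rw [e, wt']
  have := mul_wbase'_le h0 w
  have h3 : 0 ≤ wbase ε w ^ (21 / 80 - 1 : ℝ) := (Real.rpow_pos_of_pos hp _).le
  nlinarith [mul_le_mul_of_nonneg_left this h3]

lemma hasDerivAt_pot {ε : ℝ} (h0 : 0 < ε) (h1 : ε ≤ 1) (w : ℝ) : HasDerivAt (pot ε) (61 / 40 * wt ε w) w := by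
  have c := continuous_wt h0 h1
  exact ((intervalIntegral.integral_hasDerivAt_right (c.intervalIntegrable _ _)
    (c.stronglyMeasurableAtFilter _ _) c.continuousAt).const_mul _).const_add _

@[simp] lemma pot_zero {ε : ℝ} : pot ε 0 = 1 := by simp [pot]

/-- Both sides equal 1 at w = 0. The derivative of the left-hand side is (61/80) wt · wbase'/√wbase,
and wbase' ≤ 2√wbase makes it at most that of `pot`. This is the bound that recovers |u|^(61/20)
when ε tends to zero. -/
lemma pot_ge {ε : ℝ} (h0 : 0 < ε) (h1 : ε ≤ 1) {w : ℝ} (hw : 0 ≤ w) : wbase ε w ^ (61 / 80 : ℝ) ≤ pot ε w := by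
  set g : ℝ → ℝ := fun w => pot ε w - wbase ε w ^ (61 / 80 : ℝ)
  have hd : ∀ w, HasDerivAt g (61 / 40 * wt ε w
      - wbase' ε w * (61 / 80) * wbase ε w ^ (61 / 80 - 1 : ℝ)) w := fun w =>
    (hasDerivAt_pot h0 h1 w).sub
      ((hasDerivAt_wbase h0 w).rpow_const (p := 61 / 80) (Or.inl (wbase_pos h0 h1 w).ne'))
  have hm : MonotoneOn g (Ici 0) := by
    refine monotoneOn_of_deriv_nonneg (convex_Ici 0) (fun w _ => (hd w).continuousAt.continuousWithinAt)
      (fun w _ => (hd w).differentiableAt.differentiableWithinAt) fun w hw => ?_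
    rw [interior_Ici, mem_Ioi] at hw
    rw [(hd w).deriv]
    have hp := wbase_pos h0 h1 w
    have e : wbase ε w ^ (61 / 80 - 1 : ℝ) = wt ε w * wbase ε w ^ (-(1 / 2) : ℝ) := by
      rw [wt, ← Real.rpow_add hp]; norm_num
    have hX : wbase' ε w * wbase ε w ^ (-(1 / 2) : ℝ) ≤ 2 := by
      rw [Real.rpow_neg hp.le, ← Real.sqrt_eq_rpow, ← div_eq_mul_inv, div_le_iff₀ (Real.sqrt_pos.2 hp)]
      have hD : 0 < 1 + ε * w ^ 2 := by positivity
      have hD1 : 1 ≤ 1 + ε * w ^ 2 := by nlinarith [mul_nonneg h0.le (sq_nonneg w)]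
      have s1 : w / (1 + ε * w ^ 2) ≤ Real.sqrt (wbase ε w) := by
        apply Real.le_sqrt_of_sq_le
        rw [wbase, div_pow, div_le_div_iff₀ (by positivity) hD]
        nlinarith [mul_nonneg (sq_nonneg w) hD.le, mul_nonneg h0.le (sq_nonneg w)]
      have s2 : wbase' ε w ≤ 2 * (w / (1 + ε * w ^ 2)) := by
        rw [wbase', ← mul_div_assoc, div_le_div_iff₀ (by positivity) hD]
        have : (1 - ε) * (1 + ε * w ^ 2) ≤ (1 + ε * w ^ 2) ^ 2 := by nlinarith
        nlinarith [mul_le_mul_of_nonneg_left this (by positivity : 0 ≤ 2 * w)]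
      linarith
    rw [e]
    have := mul_le_mul_of_nonneg_left hX (wt_pos h0 h1 w).le
    nlinarith
  have := hm (mem_Ici.2 le_rfl) (mem_Ici.2 hw) hw
  simp only [g, pot_zero] at this
  have e0 : wbase ε 0 = 1 := by simp [wbase]
  rw [e0, Real.one_rpow] at this
  linarith

lemma one_le_pot {ε : ℝ} (h0 : 0 < ε) (h1 : ε ≤ 1) {w : ℝ} (hw : 0 ≤ w) : 1 ≤ pot ε w :=
  (Real.one_le_rpow (one_le_wbase h0 h1 w) (by norm_num)).trans (pot_ge h0 h1 hw)

lemma pot_le_of_bound {ε : ℝ} (h0 : 0 < ε) (h1 : ε ≤ 1) {w c : ℝ} (hw : 0 ≤ w) (hc : ∀ s ∈ Icc 0 w, wt ε s ≤ c) :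
    pot ε w ≤ 1 + 61 / 40 * (w * c) := by
  have := intervalIntegral.integral_mono_on hw ((continuous_wt h0 h1).intervalIntegrable 0 w)
    (_root_.intervalIntegrable_const (μ := volume) (c := c)) hc
  rw [intervalIntegral.integral_const, smul_eq_mul, sub_zero] at this
  rw [pot]
  linarith

/-- The point is independence of ε: the initial energy is thereby bounded by the initial data alone.
-/
lemma pot_le {ε : ℝ} (h0 : 0 < ε) (h1 : ε ≤ 1) {w : ℝ} (hw : 0 ≤ w) : pot ε w ≤ 4 * (1 + w ^ 2) := by
  have := pot_le_of_bound h0 h1 hw (c := 1 + w) fun s hs =>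
    (wt_le h0 h1 hs.1).trans (by linarith [hs.2])
  nlinarith [sq_nonneg (w - 1)]

/-- Saturation of the weight gives linear growth in w = |u|² at the price of 1/ε. This keeps the
flux ρ|u|·pot cubic in |u|, hence within reach of ρ ∈ L³ and u ∈ L⁶; the factor 1/ε is harmless
since R tends to infinity before ε tends to zero. -/
lemma pot_le_inv {ε : ℝ} (h0 : 0 < ε) (h1 : ε ≤ 1) {w : ℝ} (hw : 0 ≤ w) : pot ε w ≤ 2 / ε * (1 + w) := by
  have := pot_le_of_bound h0 h1 hw (c := 1 / ε) fun s _ => wt_le_inv h0 h1 s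
  have h2 : 1 ≤ 1 / ε := by rw [le_div_iff₀ h0]; linarith
  have e : 2 / ε = 2 * (1 / ε) := by ring
  rw [e]
  nlinarith [mul_nonneg hw (by linarith : (0:ℝ) ≤ 1 / ε)]

/-- The weighted pressure is controlled by a power of the density and by the potential. -/
lemma rpow_mul_wt_le {ε : ℝ} (h0 : 0 < ε) (h1 : ε ≤ 1) {s γ q w : ℝ} (hs : 0 ≤ s) (hγ : 1 ≤ γ) (hq : 4 * γ ≤ q) (hw : 0 ≤ w) :
    s ^ (2 * γ) * wt ε w ≤ s ^ q + 2 * (s * pot ε w) := by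
  have hp1 := one_le_pot h0 h1 hw
  rcases hs.eq_or_lt with rfl | hs0
  · rw [Real.zero_rpow (by positivity), zero_mul, zero_mul]
    have : 0 ≤ (0 : ℝ) ^ q := Real.rpow_nonneg le_rfl _
    linarith
  have e1 : s ^ (2 * γ) = s * s ^ (2 * γ - 1) := by
    nth_rw 2 [← Real.rpow_one s]; rw [← Real.rpow_add hs0]; norm_num
  -- The exponent 61/21 = r/(r-2) turns the weight wbase^(21/80) into wbase^(61/80), which `pot`
  -- dominates.
  have hconj : Real.HolderConjugate (61 / 40) (61 / 21) := by
    rw [Real.holderConjugate_iff]; norm_num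
  have hy := Real.young_inequality_of_nonneg (Real.rpow_nonneg hs (2 * γ - 1))
    (wt_pos h0 h1 w).le hconj
  rw [← Real.rpow_mul hs, wt, ← Real.rpow_mul (wbase_pos h0 h1 w).le] at hy
  have h61 : (21 / 80 * (61 / 21) : ℝ) = 61 / 80 := by norm_num
  rw [h61] at hy
  have hG := pot_ge h0 h1 hw
  have hA : 0 ≤ s ^ ((2 * γ - 1) * (61 / 40)) := Real.rpow_nonneg hs _
  have hG0 : 0 ≤ wbase ε w ^ (61 / 80 : ℝ) := Real.rpow_nonneg (wbase_pos h0 h1 w).le _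
  have hle : s ^ (2 * γ - 1) * wt ε w ≤ s ^ ((2 * γ - 1) * (61 / 40)) + pot ε w := by
    rw [wt]; linarith
  -- The total exponent 1 + (2γ-1)·61/40 lies between 1 and 4γ when γ ≥ 1; hence the threshold 4γ
  -- for the Lebesgue exponent of the density. The term `s` is absorbed later because `pot` is at
  -- least 1.
  have hpow : s * s ^ ((2 * γ - 1) * (61 / 40)) ≤ s + s ^ q := by
    have e2 : s * s ^ ((2 * γ - 1) * (61 / 40)) = s ^ (1 + (2 * γ - 1) * (61 / 40)) := by
      rw [Real.rpow_add hs0, Real.rpow_one]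
    rw [e2]
    have hsq : 0 ≤ s ^ q := Real.rpow_nonneg hs _
    rcases le_total s 1 with h | h
    · have := Real.rpow_le_rpow_of_exponent_ge hs0 h
        (by nlinarith : (1 : ℝ) ≤ 1 + (2 * γ - 1) * (61 / 40))
      rw [Real.rpow_one] at this
      linarith
    · have := Real.rpow_le_rpow_of_exponent_le h
        (by nlinarith : 1 + (2 * γ - 1) * (61 / 40) ≤ q)
      linarith
  rw [e1, mul_assoc]
  have := mul_le_mul_of_nonneg_left hle hs
  nlinarith

end Weight

/-! ### Algebraic coercivity of the viscous dissipation. -/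

section Coercivity

/-- Positivity of the viscous quadratic form in the radial and transversal parts of the gradient. -/
lemma viscous_form_nonneg {μ ν m : ℝ} (hμ : 0 < μ) (h1 : μ / 3 ≤ ν) (h2 : ν ≤ 32 * μ / 3)
    (hm0 : 0 ≤ m) (hm : m ≤ 21 / 20) (a y : ℝ) :
    μ / 10 * ((1 + m) * a + y) ^ 2 ≤
      μ * (a ^ 2 + y ^ 2 / 2 + m * a ^ 2) + ν * (a + y) * ((1 + m) * a + y) := by
  set α := (1 + m) * (μ + ν) - μ / 10 * (1 + m) ^ 2 with hα
  set β := ν * (2 + m) - 2 * (μ / 10) * (1 + m) with hβ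
  set δ := μ / 2 + ν - μ / 10 with hδ
  have hδ0 : 0 < δ := by rw [hδ]; linarith
  have hν : 0 < ν := by linarith
  -- Here α, β, δ are the coefficients of a², ay, y² in the difference of the two sides, so the
  -- claim is a discriminant condition. It is strict at m = 1, ν = 32μ/3, which leaves the room to
  -- go up to m = 21/20; the auxiliary products express nonnegativity on the rectangle of admissible
  -- (ν, m).
  have hD : 0 ≤ 4 * α * δ - β ^ 2 := by
    have e : 4 * α * δ - β ^ 2 = 4 * (1 + m) * (μ + ν) * (μ / 2 + ν) - ν ^ 2 * (2 + m) ^ 2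
        - μ ^ 2 / 5 * (1 + m) * (3 + m) := by rw [hα, hβ, hδ]; ring
    rw [e]
    have k : 0 ≤ (ν - μ / 3) * (32 * μ / 3 - ν) := mul_nonneg (by linarith) (by linarith)
    have k1 : 0 ≤ m * (21 / 20 - m) := mul_nonneg hm0 (by linarith)
    have k2 : 0 ≤ m * ((ν - μ / 3) * (32 * μ / 3 - ν)) := mul_nonneg hm0 k
    have k3 : 0 ≤ m * (21 / 20 - m) * ν ^ 2 := by positivity
    have k4 : 0 ≤ m * (21 / 20 - m) * μ ^ 2 := by positivity
    have k5 : 0 ≤ (21 / 20 - m) * (μ * (ν - μ / 3)) :=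
      mul_nonneg (by linarith) (mul_nonneg hμ.le (by linarith))
    have k6 : 0 ≤ m * (μ * (ν - μ / 3)) := mul_nonneg hm0 (mul_nonneg hμ.le (by linarith))
    have k7 : 0 ≤ m * μ ^ 2 := by positivity
    have k8 : 0 ≤ (21 / 20 - m) * μ ^ 2 := mul_nonneg (by linarith) (by positivity)
    nlinarith
  have key : 0 ≤ 4 * δ * (α * a ^ 2 + β * a * y + δ * y ^ 2) := by
    have : 4 * δ * (α * a ^ 2 + β * a * y + δ * y ^ 2)
        = (2 * δ * y + β * a) ^ 2 + (4 * α * δ - β ^ 2) * a ^ 2 := by ring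
    rw [this]; positivity
  have key2 : 0 ≤ α * a ^ 2 + β * a * y + δ * y ^ 2 := nonneg_of_mul_nonneg_right key (by positivity)
  have e : μ * (a ^ 2 + y ^ 2 / 2 + m * a ^ 2) + ν * (a + y) * ((1 + m) * a + y)
      - μ / 10 * ((1 + m) * a + y) ^ 2 = α * a ^ 2 + β * a * y + δ * y ^ 2 := by
    rw [hα, hβ, hδ]; ring
  linarith

/-- The viscous dissipation dominates the work of the pressure. `A i j` stands for `∂ᵢ uⱼ`,
`k` for the derivative of the weight `h`. -/
lemma pressure_le_dissipation {μ lam : ℝ} (hμ : 0 < μ) (hphys : 0 ≤ 2 * μ + 3 * lam)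
    (hvisc : lam < 29 * μ / 3) (A : Fin 3 → Fin 3 → ℝ) (u : Fin 3 → ℝ) {h k P : ℝ}
    (hh : 0 < h) (hk : 0 ≤ k) (hhk : 2 * (∑ i, u i ^ 2) * k ≤ 21 / 20 * h) :
    P * (∑ i, (h * A i i + 2 * k * (∑ l, A i l * u l) * u i))
      - μ * (∑ i, ∑ j, A i j * (h * A i j + 2 * k * (∑ l, A i l * u l) * u j))
      - (μ + lam) * (∑ i, A i i) * (∑ i, (h * A i i + 2 * k * (∑ l, A i l * u l) * u i))
      ≤ 5 / (2 * μ) * (P ^ 2 * h) := by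
  set ν := μ + lam with hν
  have n1 : μ / 3 ≤ ν := by rw [hν]; linarith
  have n2 : ν ≤ 32 * μ / 3 := by rw [hν]; linarith
  set w := ∑ i, u i ^ 2 with hw
  set d := ∑ i, A i i with hd
  set b : Fin 3 → ℝ := fun i => ∑ l, A i l * u l with hb
  set B := ∑ i, b i * u i with hB
  set S := ∑ i, ∑ j, A i j ^ 2 with hS
  set b2 := ∑ i, b i ^ 2 with hb2
  have e1 : ∑ i, (h * A i i + 2 * k * b i * u i) = h * d + 2 * k * B := by
    simp only [hd, hB, Fin.sum_univ_three]; ring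
  have e2 : ∑ i, ∑ j, A i j * (h * A i j + 2 * k * b i * u j) = h * S + 2 * k * b2 := by
    simp only [hS, hb2, hb, Fin.sum_univ_three]; ring
  have hw0 : 0 ≤ w := by positivity
  -- Completing the square: the coercivity reserve μ/10 absorbs the pressure work and produces the
  -- constant 5/(2μ).
  have hC : ∀ t : ℝ, P * t - μ / 10 * t ^ 2 ≤ 5 / (2 * μ) * P ^ 2 := fun t => by
    have : 5 / (2 * μ) * P ^ 2 - (P * t - μ / 10 * t ^ 2) = μ / 10 * (t - 5 * P / μ) ^ 2 := by
      field_simp; ring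
    have h3 : 0 ≤ μ / 10 * (t - 5 * P / μ) ^ 2 := by positivity
    linarith
  rw [e1, e2]
  -- Reduction to two scalars: `a` is the entry of the gradient along u ⊗ u/|u|² and m = 2k|u|²/h
  -- measures the growth of the weight.
  obtain ⟨a, m, hm0, hm, hSa, hb2m, hBm⟩ : ∃ a m : ℝ, 0 ≤ m ∧ m ≤ 21 / 20 ∧
      a ^ 2 + (d - a) ^ 2 / 2 ≤ S ∧ h * m * a ^ 2 ≤ 2 * k * b2 ∧ 2 * k * B = h * m * a := by
    rcases hw0.eq_or_lt with h0 | h0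
    · have hu : ∀ i, u i = 0 := fun i => by
        have := (Finset.sum_eq_zero_iff_of_nonneg (fun i _ => sq_nonneg (u i))).1 h0.symm i
          (Finset.mem_univ _)
        exact pow_eq_zero_iff (two_ne_zero) |>.1 this
      -- Where u = 0 there is no preferred direction; with a = d/3 the sum a² + (d-a)²/2 equals
      -- d²/3, and the claim is the trace inequality.
      refine ⟨d / 3, 0, le_rfl, by norm_num, ?_, ?_, ?_⟩
      · have : 0 ≤ ∑ i, ∑ j, (A i j - if i = j then d / 3 else 0) ^ 2 := by positivity
        have e : ∑ i, ∑ j, (A i j - if i = j then d / 3 else 0) ^ 2 = S - d ^ 2 / 3 := by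
          simp only [hS, hd, Fin.sum_univ_three]
          simp
          ring
        rw [e] at this
        nlinarith
      · have : 0 ≤ b2 := by positivity
        simp only [mul_zero, zero_mul]; positivity
      · simp [hB, hu]
    · refine ⟨B / w, 2 * k * w / h, by positivity, ?_, ?_, ?_, ?_⟩
      · rw [div_le_iff₀ hh]; linarith
      · set a := B / w with ha
        have hBw : B = a * w := by rw [ha]; field_simp
        set y := d - a with hy
        -- The comparison matrix t u ⊗ u + (y/2) I has eigenvalue a along u and y/2 twice on the
        -- orthogonal plane. It is the orthogonal projection of the gradient onto such matrices, so
        -- the nonnegative squared distance is S - a² - y²/2.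
        set t := (a - y / 2) / w with ht
        have htw : t * w = a - y / 2 := by rw [ht]; field_simp
        have h3 : 0 ≤ ∑ i, ∑ j, (A i j - t * u i * u j - if i = j then y / 2 else 0) ^ 2 := by
          positivity
        have e : ∑ i, ∑ j, (A i j - t * u i * u j - if i = j then y / 2 else 0) ^ 2
            = S + (t * w) ^ 2 + 3 * y ^ 2 / 4 - 2 * t * B - y * d + t * w * y := by
          simp only [hS, hd, hw, hB, hb, Fin.sum_univ_three]
          simp
          ring
        rw [e, hBw] at h3
        have e3 : 2 * t * (a * w) = 2 * a * (a - y / 2) := by rw [← htw]; ring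
        rw [e3, htw] at h3
        have e4 : d = a + y := by rw [hy]; ring
        rw [e4] at h3
        nlinarith
      -- Cauchy–Schwarz in the form |b|² ≥ (b·u)²/|u|².
      · have h3 : 0 ≤ ∑ i, (b i - B / w * u i) ^ 2 := by positivity
        have e : ∑ i, (b i - B / w * u i) ^ 2 = b2 - 2 * (B / w) * B + (B / w) ^ 2 * w := by
          simp only [hb2, hB, hw, Fin.sum_univ_three]; ring
        rw [e] at h3
        have e5 : h * (2 * k * w / h) * (B / w) ^ 2 = 2 * k * (w * (B / w) ^ 2) := by
          field_simp
        rw [e5]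
        have e6 : (B / w) * B = w * (B / w) ^ 2 := by field_simp
        gcongr
        nlinarith
      · field_simp
  rw [hBm]
  have hv := viscous_form_nonneg hμ n1 n2 hm0 hm a (d - a)
  have hv2 : μ / 10 * (d + m * a) ^ 2 ≤ μ * (S + m * a ^ 2) + ν * d * (d + m * a) := by
    have : (1 + m) * a + (d - a) = d + m * a := by ring
    rw [this] at hv
    have : a + (d - a) = d := by ring
    rw [this] at hv
    linarith [mul_le_mul_of_nonneg_left hSa hμ.le]
  have hfin := mul_le_mul_of_nonneg_left (add_le_add hv2 (hC (d + m * a))) hh.le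
  have hb3 := mul_le_mul_of_nonneg_left hb2m hμ.le
  clear_value w d b B S b2 ν
  linarith

end Coercivity

/-! ### Coordinates of vectors and linear maps on `E3`. -/

section Basis

lemma eq_sum_e (v : E3) : v = ∑ i, v i • e i := by
  ext j
  simp [e, Finset.sum_apply, Pi.single_apply]

@[simp] lemma norm_e (i : Fin 3) : ‖e i‖ = 1 := by simp [e]

lemma abs_coord_le (v : E3) (i : Fin 3) : |v i| ≤ ‖v‖ := PiLp.norm_apply_le v i

lemma norm_le_sum_coord (v : E3) : ‖v‖ ≤ ∑ i, |v i| := by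
  conv_lhs => rw [eq_sum_e v]
  refine (norm_sum_le _ _).trans (Finset.sum_le_sum fun i _ => ?_)
  rw [norm_smul, norm_e, mul_one, Real.norm_eq_abs]

lemma norm_sq_eq_sum_coord (v : E3) : ‖v‖ ^ 2 = ∑ i, v i ^ 2 := by
  rw [EuclideanSpace.norm_sq_eq]
  simp

lemma clm_apply_eq_sum {F : Type*} [NormedAddCommGroup F] [NormedSpace ℝ F] (A : E3 →L[ℝ] F)
    (v : E3) : A v = ∑ i, v i • A (e i) := by
  conv_lhs => rw [eq_sum_e v]
  simp

lemma clm_norm_le_sum {F : Type*} [NormedAddCommGroup F] [NormedSpace ℝ F] (A : E3 →L[ℝ] F) :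
    ‖A‖ ≤ ∑ i, ‖A (e i)‖ := by
  refine A.opNorm_le_bound (by positivity) fun v => ?_
  rw [clm_apply_eq_sum, Finset.sum_mul]
  refine (norm_sum_le _ _).trans (Finset.sum_le_sum fun i _ => ?_)
  rw [norm_smul, mul_comm]
  gcongr
  exact abs_coord_le v i

lemma norm_clm_e_le {F : Type*} [NormedAddCommGroup F] [NormedSpace ℝ F] (A : E3 →L[ℝ] F)
    (i : Fin 3) : ‖A (e i)‖ ≤ ‖A‖ := by
  simpa using A.le_opNorm (e i)

lemma abs_clm_e_coord_le (A : E3 →L[ℝ] E3) (i j : Fin 3) : |A (e i) j| ≤ ‖A‖ :=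
  (abs_coord_le _ _).trans (norm_clm_e_le A i)

/-- The `j`-th coordinate as a continuous linear functional. -/
noncomputable def coordL (j : Fin 3) : E3 →L[ℝ] ℝ := EuclideanSpace.proj j

@[simp] lemma coordL_apply (j : Fin 3) (v : E3) : coordL j v = v j := rfl

/-- The functional `A ↦ (A eᵢ)ⱼ`. -/
noncomputable def entryL (i j : Fin 3) : (E3 →L[ℝ] E3) →L[ℝ] ℝ :=
  coordL j ∘L ContinuousLinearMap.apply ℝ E3 (e i)

@[simp] lemma entryL_apply (i j : Fin 3) (A : E3 →L[ℝ] E3) : entryL i j A = A (e i) j := rfl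

end Basis

/-! ### Sums of weak derivatives and integration by parts against a cutoff. -/

section WeakSums

lemma _root_.MeasureTheory.LocallyIntegrable.integrableOn_ball {F : Type*} [NormedAddCommGroup F]
    {f : E3 → F} (h : LocallyIntegrable f volume) (R : ℝ) :
    IntegrableOn f (Metric.ball 0 R) volume :=
  (h.integrableOn_isCompact (isCompact_closedBall 0 R)).mono_set Metric.ball_subset_closedBall

lemma HasWeakFDeriv.add {f g : E3 → ℝ} {Df Dg : E3 → E3 →L[ℝ] ℝ} (hf : HasWeakFDeriv f Df)
    (hg : HasWeakFDeriv g Dg) : HasWeakFDeriv (fun x => f x + g x) (fun x => Df x + Dg x) := by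
  obtain ⟨f1, f2, f3⟩ := hf
  obtain ⟨g1, g2, g3⟩ := hg
  refine ⟨f1.add g1, locallyIntegrable_of_ball fun R =>
    (f2.integrableOn_ball R).add (g2.integrableOn_ball R), fun φ hφ hs v => ?_⟩
  have c := (hφ.continuous_fderiv (by simp)).clm_apply (continuous_const (y := v))
  have cs := hasCompactSupport_fderiv_apply hs v
  have i1 : Integrable (fun x => fderiv ℝ φ x v * f x) volume :=
    f1.integrable_smul_left_of_hasCompactSupport c cs
  have i2 : Integrable (fun x => fderiv ℝ φ x v * g x) volume :=
    g1.integrable_smul_left_of_hasCompactSupport c cs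
  have k : ∀ D : E3 → E3 →L[ℝ] ℝ, LocallyIntegrable D volume →
      Integrable (fun x => φ x * D x v) volume := fun D hD =>
    ((ContinuousLinearMap.apply ℝ ℝ v).integrable_comp
      (hD.integrable_smul_left_of_hasCompactSupport hφ.continuous hs)).congr
      (Eventually.of_forall fun x => by simp)
  have e1 := f3 φ hφ hs v
  have e2 := g3 φ hφ hs v
  have e3 := integral_add i1 i2
  have e4 := integral_add (k Df f2) (k Dg g2)
  simp only [smul_eq_mul] at e1 e2
  simp only [smul_eq_mul, add_apply, mul_add]
  rw [e3, e4, e1, e2, neg_add]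

lemma HasWeakFDeriv.sum_three {f : Fin 3 → E3 → ℝ} {Df : Fin 3 → E3 → E3 →L[ℝ] ℝ}
    (h : ∀ i, HasWeakFDeriv (f i) (Df i)) :
    HasWeakFDeriv (fun x => ∑ i, f i x) (fun x => ∑ i, Df i x) := by
  simp only [Fin.sum_univ_three]
  exact ((h 0).add (h 1)).add (h 2)

/-- Integration by parts against a cutoff, as an integrable function with vanishing integral. -/
lemma LocH1.integral_mul_cutoff {f g χ : E3 → ℝ} {Df Dg : E3 → E3 →L[ℝ] ℝ} (hf : LocH1 f Df)
    (hg : LocH1 g Dg) (hχ : ContDiff ℝ ((⊤ : ℕ∞) : WithTop ℕ∞) χ) (hs : HasCompactSupport χ)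
    (v : E3) :
    Integrable (fun x => χ x * (f x * Dg x v + g x * Df x v)
      + fderiv ℝ χ x v * (f x * g x)) volume ∧
    ∫ x, (χ x * (f x * Dg x v + g x * Df x v) + fderiv ℝ χ x v * (f x * g x)) = 0 := by
  obtain ⟨h1, h2, h3⟩ := hf.mul hg
  have i1 := h1.integrable_smul_left_of_hasCompactSupport
    ((hχ.continuous_fderiv (by simp)).clm_apply (continuous_const (y := v)))
    (hasCompactSupport_fderiv_apply hs v)
  have i2 : Integrable (fun x => χ x * (f x * Dg x v + g x * Df x v)) volume :=
    ((ContinuousLinearMap.apply ℝ ℝ v).integrable_comp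
      (h2.integrable_smul_left_of_hasCompactSupport hχ.continuous hs)).congr
      (Eventually.of_forall fun x => by simp [mul_add])
  have e := h3 χ hχ hs v
  simp only [smul_eq_mul, add_apply, smul_apply] at e i1
  refine ⟨i2.add i1, ?_⟩
  rw [integral_add i2 i1, e]
  ring

end WeakSums

/-! ### Local square integrability by domination. -/

section Domination

lemma MemLp.cube_locL2 {m : E3 → ℝ} (h : ∀ R, MemLp m 6 (volume.restrict (Metric.ball (0 : E3) R))) :
    LocL2 (fun x => m x ^ 3) := fun R => by
  have hm := (h R).1
  refine (memLp_two_iff_integrable_sq (hm.pow 3)).2 ?_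
  have := (h R).integrable_norm_pow (p := 6) (by norm_num)
  refine this.congr (Eventually.of_forall fun x => ?_)
  simp only [Pi.pow_apply]
  rw [← pow_mul, Real.norm_eq_abs]
  exact Even.pow_abs (by decide) _

lemma LocL2.of_le {F : Type*} [NormedAddCommGroup F] {f : E3 → F} {g : E3 → ℝ} {C : ℝ}
    (hg : LocL2 g) (hf : AEStronglyMeasurable f volume) (h : ∀ᵐ x, ‖f x‖ ≤ C * g x) : LocL2 f :=
  fun R => (hg R).of_le_mul (c := |C|) hf.restrict (ae_restrict_of_ae (h.mono fun x hx => by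
    rw [Real.norm_eq_abs, ← abs_mul]; exact hx.trans (le_abs_self _)))

end Domination

/-! ### The pointwise energy identity and its cutoff fluxes. -/

section SpatialAlgebra

/-- The pointwise identity behind the energy estimate, tested with `F j = c * u j`. -/
lemma energy_identity {μ ν : ℝ} (A : Fin 3 → Fin 3 → ℝ) (B : Fin 3 → Fin 3 → Fin 3 → ℝ)
    (G : Fin 3 → Fin 3 → ℝ) (u ut Dρ DP Dχ Ds F : Fin 3 → ℝ) {ρ ρt P χ Φ c : ℝ}
    (hF : ∀ j, F j = 2 * c * u j)
    (hDs : ∀ i, Ds i = 2 * ∑ l, u l * A i l)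
    (hmass : ρt + ((∑ i, u i * Dρ i) + ρ * ∑ i, A i i) = 0)
    (hmom : ∀ j, ρ * ut j + ρ * (∑ i, u i * A i j) + DP j
      = μ * (∑ i, B i i j) + ν * (∑ i, B j i i)) :
    χ * (ρt * Φ + ρ * ∑ j, F j * ut j)
      + (∑ j, (χ * (ρ * (u j * (c * Ds j) + Φ * A j j) + u j * Φ * Dρ j)
          + Dχ j * (ρ * (u j * Φ))))
      + (∑ j, (χ * (P * G j j + F j * DP j) + Dχ j * (P * F j)))
      - μ * (∑ i, ∑ j, (χ * (A i j * G i j + F j * B i i j) + Dχ i * (A i j * F j)))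
      - ν * (∑ i, ∑ j, (χ * (A i i * G j j + F j * B j i i) + Dχ j * (A i i * F j)))
    = χ * (P * (∑ j, G j j) - μ * (∑ i, ∑ j, A i j * G i j) - ν * (∑ i, A i i) * ∑ j, G j j)
      + (∑ j, Dχ j * (ρ * (u j * Φ))) + (∑ j, Dχ j * (P * F j))
      - μ * (∑ i, ∑ j, Dχ i * (A i j * F j)) - ν * (∑ i, ∑ j, Dχ j * (A i i * F j)) := by
  have m0 := hmom 0
  have m1 := hmom 1
  have m2 := hmom 2
  simp only [hDs, hF, Fin.sum_univ_three] at *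
  -- Conservation of mass is tested with χΦ and the momentum balance with χF; the convective terms
  -- combine because F = 2cu while Φ has gradient c ∇|u|².
  linear_combination (χ * Φ) * hmass + (χ * (2 * c * u 0)) * m0 + (χ * (2 * c * u 1)) * m1
    + (χ * (2 * c * u 2)) * m2

/-- Crude coordinatewise bounds suffice, since all these terms disappear when the cutoff radius
tends to infinity. -/
lemma boundary_terms_le {μ ν : ℝ} (hμ : 0 ≤ μ) (hν : 0 ≤ ν) (A : Fin 3 → Fin 3 → ℝ)
    (u Dχ F : Fin 3 → ℝ) {ρ P Φ K U a f : ℝ} (hΦ : 0 ≤ Φ) (hK : ∀ j, |Dχ j| ≤ K)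
    (hU : ∀ j, |u j| ≤ U) (hA : ∀ i j, |A i j| ≤ a) (hF : ∀ j, |F j| ≤ f) :
    (∑ j, Dχ j * (ρ * (u j * Φ))) + (∑ j, Dχ j * (P * F j))
      - μ * (∑ i, ∑ j, Dχ i * (A i j * F j)) - ν * (∑ i, ∑ j, Dχ j * (A i i * F j))
    ≤ K * (3 * |ρ| * U * Φ + f * (3 * |P| + 9 * (μ + ν) * a)) := by
  have K0 : 0 ≤ K := (abs_nonneg _).trans (hK 0)
  have U0 : 0 ≤ U := (abs_nonneg _).trans (hU 0)
  have a0 : 0 ≤ a := (abs_nonneg _).trans (hA 0 0)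
  have f0 : 0 ≤ f := (abs_nonneg _).trans (hF 0)
  have b1 : ∀ j, Dχ j * (ρ * (u j * Φ)) ≤ K * (|ρ| * (U * Φ)) := fun j => by
    refine (le_abs_self _).trans ?_
    rw [abs_mul, abs_mul, abs_mul, abs_of_nonneg hΦ]
    gcongr
    · exact hK j
    · exact hU j
  have b2 : ∀ j, Dχ j * (P * F j) ≤ K * (|P| * f) := fun j => by
    refine (le_abs_self _).trans ?_
    rw [abs_mul, abs_mul]
    gcongr
    · exact hK j
    · exact hF j
  have b3 : ∀ i j k l, -(Dχ i * (A k l * F j)) ≤ K * (a * f) := fun i j k l => by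
    refine (neg_le_abs _).trans ?_
    rw [abs_mul, abs_mul]
    gcongr
    · exact hK i
    · exact hA k l
    · exact hF j
  have c1 : ∑ j, Dχ j * (ρ * (u j * Φ)) ≤ 3 * (K * (|ρ| * (U * Φ))) := by
    simp only [Fin.sum_univ_three]; linarith [b1 0, b1 1, b1 2]
  have c2 : ∑ j, Dχ j * (P * F j) ≤ 3 * (K * (|P| * f)) := by
    simp only [Fin.sum_univ_three]; linarith [b2 0, b2 1, b2 2]
  have c3 : -(∑ i, ∑ j, Dχ i * (A i j * F j)) ≤ 9 * (K * (a * f)) := by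
    rw [← Finset.sum_neg_distrib]
    simp only [← Finset.sum_neg_distrib]
    refine (Finset.sum_le_sum fun i _ => Finset.sum_le_sum fun j _ => b3 i j i j).trans ?_
    simp; linarith
  have c4 : -(∑ i, ∑ j, Dχ j * (A i i * F j)) ≤ 9 * (K * (a * f)) := by
    rw [← Finset.sum_neg_distrib]
    simp only [← Finset.sum_neg_distrib]
    refine (Finset.sum_le_sum fun i _ => Finset.sum_le_sum fun j _ => b3 j j i i).trans ?_
    simp; linarith
  have d3 := mul_le_mul_of_nonneg_left c3 hμ
  have d4 := mul_le_mul_of_nonneg_left c4 hν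
  linarith

end SpatialAlgebra

/-! ### Spatial regularity at a fixed time. -/

/-- The state of a flow at a fixed time, with the regularity needed for the energy estimate. -/
structure Slice (μ lam : ℝ) (ρ ρt P : E3 → ℝ) (Dρ DP : E3 → E3 →L[ℝ] ℝ) (u ut : E3 → E3)
    (Du : E3 → E3 →L[ℝ] E3) (D2u : E3 → E3 →L[ℝ] E3 →L[ℝ] E3) : Prop where
  rho_weak : HasWeakFDeriv ρ Dρ
  rho_L2 : MemLp ρ 2 volume
  drho_L2 : MemLp Dρ 2 volume
  u_weak : HasWeakFDeriv u Du
  du_weak : HasWeakFDeriv Du D2u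
  u_L6 : MemLp u 6 volume
  du_L2 : MemLp Du 2 volume
  d2u_L2 : MemLp D2u 2 volume
  ut_L6 : MemLp ut 6 volume
  P_weak : HasWeakFDeriv P DP
  P_L2 : MemLp P 2 volume
  mass : ∀ᵐ x, ρt x + (Dρ x (u x) + ρ x * divOf (Du x)) = 0
  momentum : ∀ᵐ x, ∀ j : Fin 3,
    ρ x * ut x j + ρ x * (Du x (u x)) j + DP x (e j) = lameOp μ lam (D2u x) j

/-- A common majorant of the quantities in a slice. -/
noncomputable def maj (ρ : E3 → ℝ) (u ut : E3 → E3) (Du : E3 → E3 →L[ℝ] E3) (x : E3) : ℝ :=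
  1 + ‖u x‖ + ‖Du x‖ + |ρ x| + ‖ut x‖

lemma one_le_maj (ρ : E3 → ℝ) (u ut : E3 → E3) (Du : E3 → E3 →L[ℝ] E3) (x : E3) :
    1 ≤ maj ρ u ut Du x := by
  unfold maj; linarith [norm_nonneg (u x), norm_nonneg (Du x), abs_nonneg (ρ x), norm_nonneg (ut x)]

lemma norm_u_le_maj (ρ : E3 → ℝ) (u ut : E3 → E3) (Du : E3 → E3 →L[ℝ] E3) (x : E3) :
    ‖u x‖ ≤ maj ρ u ut Du x := by
  unfold maj; linarith [norm_nonneg (u x), norm_nonneg (Du x), abs_nonneg (ρ x), norm_nonneg (ut x)]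

lemma norm_Du_le_maj (ρ : E3 → ℝ) (u ut : E3 → E3) (Du : E3 → E3 →L[ℝ] E3) (x : E3) :
    ‖Du x‖ ≤ maj ρ u ut Du x := by
  unfold maj; linarith [norm_nonneg (u x), norm_nonneg (Du x), abs_nonneg (ρ x), norm_nonneg (ut x)]

lemma abs_rho_le_maj (ρ : E3 → ℝ) (u ut : E3 → E3) (Du : E3 → E3 →L[ℝ] E3) (x : E3) :
    |ρ x| ≤ maj ρ u ut Du x := by
  unfold maj; linarith [norm_nonneg (u x), norm_nonneg (Du x), abs_nonneg (ρ x), norm_nonneg (ut x)]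

lemma norm_ut_le_maj (ρ : E3 → ℝ) (u ut : E3 → E3) (Du : E3 → E3 →L[ℝ] E3) (x : E3) :
    ‖ut x‖ ≤ maj ρ u ut Du x := by
  unfold maj; linarith [norm_nonneg (u x), norm_nonneg (Du x), abs_nonneg (ρ x), norm_nonneg (ut x)]

namespace Slice

variable {μ lam : ℝ} {ρ ρt P : E3 → ℝ} {Dρ DP : E3 → E3 →L[ℝ] ℝ} {u ut : E3 → E3}
  {Du : E3 → E3 →L[ℝ] E3} {D2u : E3 → E3 →L[ℝ] E3 →L[ℝ] E3}

lemma entry_weak (S : Slice μ lam ρ ρt P Dρ DP u ut Du D2u) (i j : Fin 3) :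
    HasWeakFDeriv (fun x => Du x (e i) j) (fun x => entryL i j ∘L D2u x) :=
  S.du_weak.clm_comp (entryL i j)

lemma entry_L2 (S : Slice μ lam ρ ρt P Dρ DP u ut Du D2u) (i j : Fin 3) :
    MemLp (fun x => Du x (e i) j) 2 volume := (entryL i j).comp_memLp' S.du_L2

lemma norm_d2u_L2 (S : Slice μ lam ρ ρt P Dρ DP u ut Du D2u) :
    MemLp (fun x => ‖D2u x‖) 2 volume :=
  MemLp.norm (E := E3 →L[ℝ] E3 →L[ℝ] E3) (f := D2u) S.d2u_L2

lemma dentry_L2 (S : Slice μ lam ρ ρt P Dρ DP u ut Du D2u) (i j : Fin 3) :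
    MemLp (fun x => entryL i j ∘L D2u x) 2 volume := by
  have hm : AEStronglyMeasurable (fun x => entryL i j ∘L D2u x) volume :=
    (ContinuousLinearMap.compL ℝ E3 (E3 →L[ℝ] E3) ℝ
      (entryL i j)).continuous.comp_aestronglyMeasurable S.d2u_L2.1
  have hn := S.norm_d2u_L2
  refine hn.of_le_mul (c := ‖entryL i j‖) hm (Eventually.of_forall fun x => ?_)
  exact ((entryL i j).opNorm_comp_le (D2u x)).trans
    (mul_le_mul_of_nonneg_left (le_abs_self _) (norm_nonneg _))

lemma rho_L6 (S : Slice μ lam ρ ρt P Dρ DP u ut Du D2u) : MemLp ρ 6 volume :=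
  S.rho_weak.memLp_six S.rho_L2 S.drho_L2

/-- Each entry of the gradient has its weak gradient in L², so Sobolev's embedding applies
entrywise. -/
lemma du_L6 (S : Slice μ lam ρ ρt P Dρ DP u ut Du D2u) : MemLp Du 6 volume := by
  have h : ∀ i j, MemLp (fun x => Du x (e i) j) 6 volume := fun i j =>
    (S.entry_weak i j).memLp_six (S.entry_L2 i j) (S.dentry_L2 i j)
  have hs : MemLp (fun x => ∑ i, ∑ j, |Du x (e i) j|) 6 volume :=
    memLp_finsetSum _ fun i _ => memLp_finsetSum _ fun j _ => (h i j).abs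
  refine hs.of_le S.du_L2.1 (Eventually.of_forall fun x => ?_)
  refine ((clm_norm_le_sum (Du x)).trans (Finset.sum_le_sum fun i _ => norm_le_sum_coord _)).trans ?_
  exact le_abs_self _

lemma maj_L6 (S : Slice μ lam ρ ρt P Dρ DP u ut Du D2u) (R : ℝ) :
    MemLp (maj ρ u ut Du) 6 (volume.restrict (Metric.ball (0 : E3) R)) := by
  set B := volume.restrict (Metric.ball (0 : E3) R)
  have h0 : MemLp (fun _ : E3 => (1 : ℝ)) 6 B := memLp_const 1
  have h1 : MemLp (fun x => ‖u x‖) 6 B := S.u_L6.norm.restrict _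
  have h2 : MemLp (fun x => ‖Du x‖) 6 B := S.du_L6.norm.restrict _
  have h3 : MemLp (fun x => |ρ x|) 6 B := S.rho_L6.abs.restrict _
  have h4 : MemLp (fun x => ‖ut x‖) 6 B := S.ut_L6.norm.restrict _
  have h5 : MemLp (fun x => 1 + ‖u x‖) 6 B := h0.add h1
  have h6 : MemLp (fun x => 1 + ‖u x‖ + ‖Du x‖) 6 B := h5.add h2
  have h7 : MemLp (fun x => 1 + ‖u x‖ + ‖Du x‖ + |ρ x|) 6 B := h6.add h3
  exact h7.add h4

/-- Local square integrability of the cube is the common threshold of the energy argument: the test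
function, the mass flux potential and their gradients are all at most cubic in the majorant. -/
lemma maj_cube (S : Slice μ lam ρ ρt P Dρ DP u ut Du D2u) :
    LocL2 (fun x => maj ρ u ut Du x ^ 3) := MemLp.cube_locL2 S.maj_L6

lemma abs_lameOp_le (μ lam : ℝ) (B : E3 →L[ℝ] E3 →L[ℝ] E3) (j : Fin 3) :
    |lameOp μ lam B j| ≤ 3 * (|μ| + |μ + lam|) * ‖B‖ := by
  have h : ∀ i k l, |B (e i) (e k) l| ≤ ‖B‖ := fun i k l =>
    (abs_clm_e_coord_le _ _ _).trans (norm_clm_e_le B i)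
  have h1 : ∀ f : Fin 3 → ℝ, (∀ i, |f i| ≤ ‖B‖) → |∑ i, f i| ≤ 3 * ‖B‖ := fun f hf => by
    refine (Finset.abs_sum_le_sum_abs _ _).trans ((Finset.sum_le_sum fun i _ => hf i).trans ?_)
    simp
  rw [lameOp]
  refine (abs_add_le _ _).trans ?_
  rw [abs_mul, abs_mul]
  have a1 := mul_le_mul_of_nonneg_left (h1 _ fun i => h i i j) (abs_nonneg μ)
  have a2 := mul_le_mul_of_nonneg_left (h1 _ fun i => h j i i) (abs_nonneg (μ + lam))
  linarith

lemma abs_dP_le {m r c d : ℝ} {v w : E3} {A : E3 →L[ℝ] E3} {l p : ℝ} {j : Fin 3} (hm : 1 ≤ m)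
    (hr : |r| ≤ m) (hv : ‖v‖ ≤ m) (hw : ‖w‖ ≤ m) (hA : ‖A‖ ≤ m) (hl : |l| ≤ c * d)
    (h : r * w j + r * (A v) j + p = l) : |p| ≤ c * d + 2 * m ^ 3 := by
  have b1 : |r * w j| ≤ m * m := by
    rw [abs_mul]
    exact mul_le_mul hr ((abs_coord_le _ _).trans hw) (abs_nonneg _) (by linarith)
  have b2 : |r * (A v) j| ≤ m * (m * m) := by
    rw [abs_mul]
    refine mul_le_mul hr ?_ (abs_nonneg _) (by linarith)
    refine (abs_coord_le _ _).trans ((A.le_opNorm _).trans ?_)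
    exact mul_le_mul hA hv (norm_nonneg _) (by linarith)
  have b3 : m * m ≤ m * (m * m) := by
    have : 0 ≤ m * m := by positivity
    nlinarith
  have e3 : m * (m * m) = m ^ 3 := by ring
  rw [abs_le] at *
  constructor <;> linarith [b1.1, b1.2]

/-- The weak gradient of the pressure is only known to be locally integrable, but the momentum
equation equates it with second derivatives of u, in L², minus ρu_t and ρu·∇u, which are at most
cubic in the majorant. -/
lemma dP_locL2 (S : Slice μ lam ρ ρt P Dρ DP u ut Du D2u) : LocL2 DP := by
  obtain ⟨c, hc⟩ : ∃ c, c = 3 * (|μ| + |μ + lam|) := ⟨_, rfl⟩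
  have hg : LocL2 (fun x => c * ‖D2u x‖ + 2 * maj ρ u ut Du x ^ 3) := by
    intro R
    have h1 : MemLp (fun x => c * ‖D2u x‖) 2 (volume.restrict (Metric.ball (0 : E3) R)) :=
      (S.norm_d2u_L2.restrict _).const_mul c
    have h2 : MemLp (fun x => 2 * maj ρ u ut Du x ^ 3) 2
      (volume.restrict (Metric.ball (0 : E3) R)) := (S.maj_cube R).const_mul 2
    exact h1.add h2
  refine hg.of_le (C := 3) S.P_weak.2.1.aestronglyMeasurable ?_
  filter_upwards [S.momentum] with x hx
  refine (clm_norm_le_sum _).trans ?_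
  have hj : ∀ j ∈ Finset.univ, ‖DP x (e j)‖ ≤ c * ‖D2u x‖ + 2 * maj ρ u ut Du x ^ 3 :=
    fun j _ => by
    have hl := abs_lameOp_le μ lam (D2u x) j
    rw [← hc] at hl
    exact abs_dP_le (one_le_maj _ _ _ _ _) (abs_rho_le_maj _ _ _ _ x)
      (norm_u_le_maj _ _ _ _ x) (norm_ut_le_maj _ _ _ _ x) (norm_Du_le_maj _ _ _ _ x) hl (hx j)
  refine (Finset.sum_le_sum hj).trans_eq ?_
  rw [Finset.sum_const, Finset.card_univ, Fintype.card_fin, nsmul_eq_mul]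
  norm_num

lemma of_maj (S : Slice μ lam ρ ρt P Dρ DP u ut Du D2u) {F : Type*} [NormedAddCommGroup F]
    {f : E3 → F} (hf : AEStronglyMeasurable f volume) (C : ℝ)
    (h : ∀ x, ‖f x‖ ≤ C * maj ρ u ut Du x ^ 3) : LocL2 f :=
  S.maj_cube.of_le hf (Eventually.of_forall h)

lemma rho_locH1 (S : Slice μ lam ρ ρt P Dρ DP u ut Du D2u) : LocH1 ρ Dρ :=
  ⟨S.rho_weak, S.rho_L2.locL2, S.drho_L2.locL2⟩

lemma P_locH1 (S : Slice μ lam ρ ρt P Dρ DP u ut Du D2u) : LocH1 P DP :=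
  ⟨S.P_weak, S.P_L2.locL2, S.dP_locL2⟩

lemma entry_locH1 (S : Slice μ lam ρ ρt P Dρ DP u ut Du D2u) (i j : Fin 3) :
    LocH1 (fun x => Du x (e i) j) (fun x => entryL i j ∘L D2u x) :=
  ⟨S.entry_weak i j, (S.entry_L2 i j).locL2, (S.dentry_L2 i j).locL2⟩

lemma norm_coord_comp_le (j : Fin 3) (A : E3 →L[ℝ] E3) : ‖coordL j ∘L A‖ ≤ ‖A‖ :=
  ContinuousLinearMap.opNorm_le_bound _ (norm_nonneg _) fun v =>
    (abs_coord_le _ _).trans (A.le_opNorm v)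

lemma le_cube_of_le {m a b : ℝ} (hm : 1 ≤ m) (h : a ≤ b * m) (hb : 0 ≤ b) : a ≤ b * m ^ 3 := by
  refine h.trans (mul_le_mul_of_nonneg_left ?_ hb)
  nlinarith [mul_nonneg (by linarith : 0 ≤ m - 1) (by linarith : 0 ≤ m)]

lemma le_cube_of_le_sq {m a b : ℝ} (hm : 1 ≤ m) (h : a ≤ b * m ^ 2) (hb : 0 ≤ b) :
    a ≤ b * m ^ 3 := by
  refine h.trans (mul_le_mul_of_nonneg_left ?_ hb)
  nlinarith [mul_nonneg (by linarith : 0 ≤ m - 1) (sq_nonneg m)]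

lemma aesm_uj (S : Slice μ lam ρ ρt P Dρ DP u ut Du D2u) (j : Fin 3) :
    AEStronglyMeasurable (fun x => u x j) volume := (coordL j).continuous.comp_aestronglyMeasurable S.u_L6.1

lemma aesm_Duj (S : Slice μ lam ρ ρt P Dρ DP u ut Du D2u) (j : Fin 3) :
    AEStronglyMeasurable (fun x => coordL j ∘L Du x) volume :=
  (ContinuousLinearMap.compL ℝ E3 _ ℝ (coordL j)).continuous.comp_aestronglyMeasurable S.du_L2.1

lemma coord_locH1 (S : Slice μ lam ρ ρt P Dρ DP u ut Du D2u) (j : Fin 3) :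
    LocH1 (fun x => u x j) (fun x => coordL j ∘L Du x) := by
  refine ⟨S.u_weak.clm_comp (coordL j), S.of_maj (S.aesm_uj j) 1 fun x => ?_,
    S.of_maj (S.aesm_Duj j) 1 fun x => ?_⟩
  · refine le_cube_of_le (one_le_maj ρ u ut Du x) ?_ zero_le_one
    rw [one_mul]; exact (abs_coord_le _ _).trans (norm_u_le_maj _ _ _ _ x)
  · refine le_cube_of_le (one_le_maj ρ u ut Du x) ?_ zero_le_one
    rw [one_mul]; exact (norm_coord_comp_le _ _).trans (norm_Du_le_maj _ _ _ _ x)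

/-- The weak gradient of `‖u‖ ^ 2`. -/
noncomputable def gradSq (u : E3 → E3) (Du : E3 → E3 →L[ℝ] E3) (x : E3) : E3 →L[ℝ] ℝ :=
  ∑ j, ((u x j) • (coordL j ∘L Du x) + (u x j) • (coordL j ∘L Du x))

lemma gradSq_apply (u : E3 → E3) (Du : E3 → E3 →L[ℝ] E3) (x v : E3) :
    gradSq u Du x v = 2 * ∑ l, u x l * Du x v l := by
  simp only [gradSq, Finset.mul_sum]
  simp only [Fin.sum_univ_three, add_apply, smul_apply, ContinuousLinearMap.comp_apply, coordL,
    smul_eq_mul]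
  simp
  ring

lemma norm_gradSq_le (u : E3 → E3) (Du : E3 → E3 →L[ℝ] E3) (x : E3) :
    ‖gradSq u Du x‖ ≤ 6 * (‖u x‖ * ‖Du x‖) := by
  refine (norm_sum_le _ _).trans ?_
  have : ∀ j ∈ Finset.univ, ‖(u x j) • (coordL j ∘L Du x) + (u x j) • (coordL j ∘L Du x)‖
      ≤ 2 * (‖u x‖ * ‖Du x‖) := fun j _ => by
    refine (norm_add_le _ _).trans ?_
    rw [norm_smul, two_mul]
    have := mul_le_mul (abs_coord_le (u x) j) (norm_coord_comp_le j (Du x)) (norm_nonneg _)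
      (norm_nonneg _)
    exact add_le_add this this
  refine (Finset.sum_le_sum this).trans_eq ?_
  simp; ring

lemma aesm_gradSq (S : Slice μ lam ρ ρt P Dρ DP u ut Du D2u) :
    AEStronglyMeasurable (gradSq u Du) volume := by
  unfold gradSq
  simp only [Fin.sum_univ_three]
  have h := fun j => (S.aesm_uj j).smul (S.aesm_Duj j)
  exact (((h 0).add (h 0)).add ((h 1).add (h 1))).add ((h 2).add (h 2))

lemma aesm_normSq (S : Slice μ lam ρ ρt P Dρ DP u ut Du D2u) :
    AEStronglyMeasurable (fun x => ‖u x‖ ^ 2) volume := S.u_L6.1.norm.pow 2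

lemma normSq_locH1 (S : Slice μ lam ρ ρt P Dρ DP u ut Du D2u) :
    LocH1 (fun x => ‖u x‖ ^ 2) (gradSq u Du) := by
  refine ⟨?_, S.of_maj S.aesm_normSq 1 fun x => ?_, S.of_maj S.aesm_gradSq 6 fun x => ?_⟩
  · have := HasWeakFDeriv.sum_three fun j => (S.coord_locH1 j).mul (S.coord_locH1 j)
    have e1 : (fun x => ‖u x‖ ^ 2) = fun x => ∑ j, u x j * u x j := by
      ext x; rw [norm_sq_eq_sum_coord]; simp only [sq]
    rw [e1]
    exact this
  · refine le_cube_of_le_sq (one_le_maj ρ u ut Du x) ?_ zero_le_one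
    rw [one_mul, Real.norm_of_nonneg (by positivity)]
    gcongr
    exact norm_u_le_maj _ _ _ _ x
  · refine le_cube_of_le_sq (one_le_maj ρ u ut Du x) ?_ (by norm_num)
    refine (norm_gradSq_le u Du x).trans ?_
    have := mul_le_mul (norm_u_le_maj ρ u ut Du x) (norm_Du_le_maj ρ u ut Du x) (norm_nonneg _)
      (by linarith [one_le_maj ρ u ut Du x])
    nlinarith

end Slice

/-! ### The localised energy inequality at a fixed time. -/

/-- The density of the right-hand side of the localised energy estimate. -/
noncomputable def energyRHS (μ lam ε : ℝ) (χ ρ P : E3 → ℝ) (u : E3 → E3)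
    (Du : E3 → E3 →L[ℝ] E3) (x : E3) : ℝ :=
  χ x * (61 / 20 * (5 / (2 * μ) * (P x ^ 2 * wt ε (‖u x‖ ^ 2))))
    + ‖fderiv ℝ χ x‖ * (3 * |ρ x| * ‖u x‖ * pot ε (‖u x‖ ^ 2)
      + 61 / 20 * wt ε (‖u x‖ ^ 2) * ‖u x‖ * (3 * |P x| + 9 * (μ + (μ + lam)) * ‖Du x‖))

/-- With the weight bounded by 1/ε and the potential of linear growth in U², the worst flux r·U·φ
has degree four in m, so everything fits under the square of m³ + p. The statement is about bare
reals in order that `C` be chosen before the point x. -/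
lemma energyRHS_bound {μ lam K ε : ℝ} (hμ : 0 < μ) (hν : 0 ≤ μ + lam) (hε : 0 < ε) (hK : 0 ≤ K) :
    ∃ C : ℝ, ∀ {χ d p r U a w φ m : ℝ}, 1 ≤ m → |χ| ≤ K → 0 ≤ d → d ≤ K → 0 ≤ r → r ≤ m → 0 ≤ U →
      U ≤ m → 0 ≤ a → a ≤ m → 0 ≤ p → 0 ≤ w → w ≤ 1 / ε → 0 ≤ φ → φ ≤ 2 / ε * (1 + U ^ 2) →
      |χ * (61 / 20 * (5 / (2 * μ) * (p ^ 2 * w))) + d * (3 * r * U * φ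
        + 61 / 20 * w * U * (3 * p + 9 * (μ + (μ + lam)) * a))| ≤ C * ((m ^ 3 + p) * (m ^ 3 + p)) := by
  obtain ⟨L, hL⟩ : ∃ L, L = 1 / ε := ⟨_, rfl⟩
  have hL0 : 0 < L := by rw [hL]; positivity
  refine ⟨K * (61 / 20 * (5 / (2 * μ) * L)) + K * (12 * L + 61 / 20 * L * (3 + 9 * (μ + (μ + lam)))), ?_⟩
  intro χ d p r U a w φ m hm hχ hd0 hd hr0 hr hU0 hU ha0 ha hp hw0 hw hφ0 hφ
  rw [← hL] at hw
  have e2 : 2 / ε = 2 * L := by rw [hL]; ring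
  rw [e2] at hφ
  set g := m ^ 3 + p with hg
  have m3 : m ≤ m ^ 3 := by nlinarith [mul_nonneg (by linarith : 0 ≤ m - 1) (by linarith : 0 ≤ m)]
  have gm : m ≤ g := by linarith
  have gp : p ≤ g := by linarith [pow_pos (by linarith : 0 < m) 3]
  have g0 : 0 ≤ g := by linarith
  have k1 : |χ * (61 / 20 * (5 / (2 * μ) * (p ^ 2 * w)))|
      ≤ K * (61 / 20 * (5 / (2 * μ) * (g * g * L))) := by
    rw [abs_mul, abs_of_nonneg (by positivity : 0 ≤ 61 / 20 * (5 / (2 * μ) * (p ^ 2 * w))), sq]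
    gcongr
  have k2 : r * U * φ ≤ 4 * L * (g * g) := by
    have q1 : φ ≤ 2 * L * (2 * m ^ 2) := by
      refine hφ.trans (mul_le_mul_of_nonneg_left ?_ (by positivity))
      have : U ^ 2 ≤ m ^ 2 := by gcongr
      have : 1 ≤ m ^ 2 := one_le_pow₀ hm
      linarith
    have q2 : r * U * φ ≤ m * m * (2 * L * (2 * m ^ 2)) := by gcongr
    have q3 : m * m * m ^ 2 ≤ g * g := by
      have : m * m * m ^ 2 ≤ m ^ 3 * m ^ 3 := by
        rw [← pow_add, ← sq, ← pow_add]
        exact pow_le_pow_right₀ hm (by norm_num)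
      refine this.trans ?_
      gcongr <;> linarith
    calc r * U * φ ≤ m * m * (2 * L * (2 * m ^ 2)) := q2
      _ = 4 * L * (m * m * m ^ 2) := by ring
      _ ≤ _ := by gcongr
  have k3 : w * U * (3 * p + 9 * (μ + (μ + lam)) * a) ≤ L * g * (3 * g + 9 * (μ + (μ + lam)) * g) := by
    gcongr <;> linarith
  have k4 : 0 ≤ 3 * r * U * φ + 61 / 20 * w * U * (3 * p + 9 * (μ + (μ + lam)) * a) := by positivity
  refine (abs_add_le _ _).trans ?_
  rw [abs_mul d, abs_of_nonneg hd0, abs_of_nonneg k4]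
  have k5 : d * (3 * r * U * φ + 61 / 20 * w * U * (3 * p + 9 * (μ + (μ + lam)) * a))
      ≤ K * (12 * L * (g * g) + 61 / 20 * (L * g * (3 * g + 9 * (μ + (μ + lam)) * g))) := by
    refine mul_le_mul hd ?_ k4 hK
    linarith
  refine (add_le_add k1 k5).trans_eq ?_
  ring

namespace Slice

variable {μ lam ε : ℝ} {ρ ρt P χ : E3 → ℝ} {Dρ DP : E3 → E3 →L[ℝ] ℝ} {u ut : E3 → E3}
  {Du : E3 → E3 →L[ℝ] E3} {D2u : E3 → E3 →L[ℝ] E3 →L[ℝ] E3}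

/-- Linear growth of G in |u|² makes the product cubic in the majorant, and boundedness of G' does
the same for its gradient. This covers both the test function and the potential. -/
lemma coord_mul_comp (S : Slice μ lam ρ ρt P Dρ DP u ut Du D2u) (j : Fin 3) {G G' : ℝ → ℝ} {L C : ℝ}
    (hG : ∀ s, HasDerivAt G (G' s) s) (hG' : Continuous G') (hL : ∀ s, |G' s| ≤ L)
    (hC : ∀ s, 0 ≤ s → |G s| ≤ C * (1 + s)) :
    LocH1 (fun x => u x j * G (‖u x‖ ^ 2))
      (fun x => u x j • (G' (‖u x‖ ^ 2) • gradSq u Du x)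
        + G (‖u x‖ ^ 2) • (coordL j ∘L Du x)) := by
  have hL0 : 0 ≤ L := (abs_nonneg _).trans (hL 0)
  have hC0 : 0 ≤ C := by have := (abs_nonneg _).trans (hC 0 le_rfl); linarith
  have hGc : Continuous G := continuous_iff_continuousAt.2 fun s => (hG s).continuousAt
  have mG := hGc.comp_aestronglyMeasurable S.aesm_normSq
  have mG' := hG'.comp_aestronglyMeasurable S.aesm_normSq
  have hb : ∀ x, |G (‖u x‖ ^ 2)| ≤ 2 * C * maj ρ u ut Du x ^ 2 := fun x => by
    refine (hC _ (by positivity)).trans ?_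
    have m1 := one_le_maj ρ u ut Du x
    have : ‖u x‖ ^ 2 ≤ maj ρ u ut Du x ^ 2 := by gcongr; exact norm_u_le_maj _ _ _ _ x
    have : 1 ≤ maj ρ u ut Du x ^ 2 := one_le_pow₀ m1
    have : C * (1 + ‖u x‖ ^ 2) ≤ C * (2 * maj ρ u ut Du x ^ 2) := by gcongr; linarith
    linarith
  refine ⟨(S.coord_locH1 j).mul (S.normSq_locH1.comp hG hG' hL),
    S.of_maj ((S.aesm_uj j).mul mG) (2 * C) fun x => ?_,
    S.of_maj (((S.aesm_uj j).smul (mG'.smul S.aesm_gradSq)).add (mG.smul (S.aesm_Duj j)))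
      (6 * L + 2 * C) fun x => ?_⟩
  · have m1 := one_le_maj ρ u ut Du x
    rw [norm_mul]
    calc ‖u x j‖ * ‖G (‖u x‖ ^ 2)‖ ≤ maj ρ u ut Du x * (2 * C * maj ρ u ut Du x ^ 2) :=
          mul_le_mul ((abs_coord_le _ _).trans (norm_u_le_maj _ _ _ _ x)) (hb x) (norm_nonneg _)
            (by linarith)
      _ = _ := by ring
  · have m1 := one_le_maj ρ u ut Du x
    refine (norm_add_le _ _).trans ?_
    rw [norm_smul, norm_smul, norm_smul]
    have t1 : ‖u x j‖ * (‖G' (‖u x‖ ^ 2)‖ * ‖gradSq u Du x‖)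
        ≤ maj ρ u ut Du x * (L * (6 * (maj ρ u ut Du x * maj ρ u ut Du x))) := by
      refine mul_le_mul ((abs_coord_le _ _).trans (norm_u_le_maj _ _ _ _ x)) ?_ (by positivity)
        (by linarith)
      refine mul_le_mul (hL _) ((norm_gradSq_le _ _ _).trans ?_) (norm_nonneg _) hL0
      gcongr
      exacts [norm_u_le_maj _ _ _ _ x, norm_Du_le_maj _ _ _ _ x]
    have t2 : ‖G (‖u x‖ ^ 2)‖ * ‖coordL j ∘L Du x‖
        ≤ 2 * C * maj ρ u ut Du x ^ 2 * maj ρ u ut Du x :=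
      mul_le_mul (hb x) ((norm_coord_comp_le _ _).trans (norm_Du_le_maj _ _ _ _ x)) (norm_nonneg _)
        (by positivity)
    refine (add_le_add t1 t2).trans_eq ?_
    ring

lemma test_locH1 (S : Slice μ lam ρ ρt P Dρ DP u ut Du D2u) (h0 : 0 < ε) (h1 : ε ≤ 1) (j : Fin 3) :
    LocH1 (fun x => u x j * (61 / 20 * wt ε (‖u x‖ ^ 2)))
      (fun x => u x j • ((61 / 20 * wt' ε (‖u x‖ ^ 2)) • gradSq u Du x)
        + (61 / 20 * wt ε (‖u x‖ ^ 2)) • (coordL j ∘L Du x)) := by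
  refine S.coord_mul_comp j (G := fun s => 61 / 20 * wt ε s) (G' := fun s => 61 / 20 * wt' ε s)
    (L := 61 / 20 * (1 / ε)) (C := 61 / 20 * (1 / ε)) (fun s => (hasDerivAt_wt h0 h1 s).const_mul _)
    ((continuous_wt' h0 h1).const_mul _) (fun s => ?_) (fun s hs => ?_)
  · rw [abs_mul, abs_of_pos (by norm_num : (0 : ℝ) < 61 / 20)]
    gcongr
    exact abs_wt'_le h0 h1 s
  · rw [abs_mul, abs_of_pos (by norm_num : (0 : ℝ) < 61 / 20), abs_of_pos (wt_pos h0 h1 s)]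
    have := wt_le_inv h0 h1 s
    have h : 0 ≤ 1 / ε := by positivity
    nlinarith [mul_nonneg h hs]

lemma pot_locH1 (S : Slice μ lam ρ ρt P Dρ DP u ut Du D2u) (h0 : 0 < ε) (h1 : ε ≤ 1) (j : Fin 3) :
    LocH1 (fun x => u x j * pot ε (‖u x‖ ^ 2))
      (fun x => u x j • ((61 / 40 * wt ε (‖u x‖ ^ 2)) • gradSq u Du x)
        + pot ε (‖u x‖ ^ 2) • (coordL j ∘L Du x)) := by
  refine S.coord_mul_comp j (G := pot ε) (G' := fun s => 61 / 40 * wt ε s)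
    (L := 61 / 40 * (1 / ε)) (C := 2 / ε) (fun s => hasDerivAt_pot h0 h1 s)
    ((continuous_wt h0 h1).const_mul _) (fun s => ?_) (fun s hs => ?_)
  · rw [abs_mul, abs_of_pos (by norm_num : (0 : ℝ) < 61 / 40), abs_of_pos (wt_pos h0 h1 s)]
    gcongr
    exact wt_le_inv h0 h1 s
  · rw [abs_of_nonneg (zero_le_one.trans (one_le_pot h0 h1 hs))]
    exact pot_le_inv h0 h1 hs

lemma continuous_pot (h0 : 0 < ε) (h1 : ε ≤ 1) : Continuous (pot ε) :=
  continuous_iff_continuousAt.2 fun s => (hasDerivAt_pot h0 h1 s).continuousAt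

lemma integrable_energyRHS (S : Slice μ lam ρ ρt P Dρ DP u ut Du D2u) (hμ : 0 < μ)
    (hν : 0 ≤ μ + lam) (h0 : 0 < ε) (h1 : ε ≤ 1)
    (hχ : ContDiff ℝ ((⊤ : ℕ∞) : WithTop ℕ∞) χ) (hs : HasCompactSupport χ) :
    Integrable (energyRHS μ lam ε χ ρ P u Du) volume := by
  obtain ⟨K₁, hK₁⟩ := hs.exists_abs_bound hχ.continuous
  have cd : Continuous (fderiv ℝ χ) := hχ.continuous_fderiv (by simp)
  obtain ⟨K₂, hK₂⟩ := hs.fderiv (𝕜 := ℝ) |>.exists_bound_of_continuous cd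
  obtain ⟨K, hK⟩ : ∃ K, K = max K₁ K₂ := ⟨_, rfl⟩
  have hK0 : 0 ≤ K := by rw [hK]; exact ((abs_nonneg _).trans (hK₁ 0)).trans (le_max_left _ _)
  obtain ⟨C, hC⟩ := energyRHS_bound hμ hν h0 hK0 (lam := lam)
  obtain ⟨R, -, hR⟩ := exists_tsupport_subset_ball hs
  have hm := S.aesm_normSq
  have mw := (continuous_wt h0 h1).comp_aestronglyMeasurable hm
  have mp := (continuous_pot h0 h1).comp_aestronglyMeasurable hm
  have meas : AEStronglyMeasurable (energyRHS μ lam ε χ ρ P u Du) volume := by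
    unfold energyRHS
    have a1 := hχ.continuous.aestronglyMeasurable (μ := volume) |>.mul
      ((((S.P_L2.1.pow 2).mul mw).const_mul (5 / (2 * μ))).const_mul (61 / 20))
    have a2 := ((S.rho_L2.1.norm.const_mul 3).mul S.u_L6.1.norm).mul mp
    have a3 := ((mw.const_mul (61 / 20)).mul S.u_L6.1.norm).mul
      ((S.P_L2.1.norm.const_mul 3).add (S.du_L2.1.norm.const_mul (9 * (μ + (μ + lam)))))
    exact a1.add (cd.norm.aestronglyMeasurable.mul (a2.add a3))
  have hg : LocL2 (fun x => maj ρ u ut Du x ^ 3 + |P x|) := fun R => by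
    have b1 := S.maj_cube R
    have b2 : MemLp (fun x => |P x|) 2 (volume.restrict (Metric.ball (0 : E3) R)) :=
      S.P_L2.abs.restrict _
    exact b1.add b2
  refine (integrableOn_iff_integrable_of_support_subset (s := Metric.ball (0 : E3) R) ?_).1 ?_
  · intro x hx
    by_contra hxR
    have hn : x ∉ tsupport χ := fun h => hxR (hR h)
    have z1 : χ x = 0 := image_eq_zero_of_notMem_tsupport hn
    have z2 : fderiv ℝ χ x = 0 :=
      image_eq_zero_of_notMem_tsupport fun h => hn (tsupport_fderiv_subset ℝ h)
    exact hx (by simp [energyRHS, z1, z2])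
  · refine Integrable.mono' ((hg.mul_integrableOn hg R).const_mul C) meas.restrict
      (Eventually.of_forall fun x => ?_)
    have hp : 0 ≤ ‖u x‖ ^ 2 := by positivity
    have := hC (one_le_maj ρ u ut Du x) ((hK₁ x).trans (hK ▸ le_max_left _ _))
      (norm_nonneg (fderiv ℝ χ x)) ((hK₂ x).trans (hK ▸ le_max_right _ _)) (abs_nonneg (ρ x))
      (abs_rho_le_maj ρ u ut Du x) (norm_nonneg (u x)) (norm_u_le_maj ρ u ut Du x)
      (norm_nonneg (Du x)) (norm_Du_le_maj ρ u ut Du x) (abs_nonneg (P x))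
      (wt_pos h0 h1 (‖u x‖ ^ 2)).le (wt_le_inv h0 h1 _)
      (zero_le_one.trans (one_le_pot h0 h1 hp)) (pot_le_inv h0 h1 hp)
    rw [sq_abs] at this
    exact this

lemma energyRHS_nonneg (hμ : 0 < μ) (hν : 0 ≤ μ + lam) (h0 : 0 < ε) (h1 : ε ≤ 1)
    (hχ0 : ∀ x, 0 ≤ χ x) (x : E3) : 0 ≤ energyRHS μ lam ε χ ρ P u Du x := by
  have w0 := (wt_pos h0 h1 (‖u x‖ ^ 2)).le
  have p0 := zero_le_one.trans (one_le_pot h0 h1 (by positivity : 0 ≤ ‖u x‖ ^ 2))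
  have c0 := hχ0 x
  unfold energyRHS
  positivity

/-- The localised energy inequality at a fixed time. -/
theorem integral_le_energyRHS (S : Slice μ lam ρ ρt P Dρ DP u ut Du D2u) (hμ : 0 < μ)
    (hphys : 0 ≤ 2 * μ + 3 * lam) (hvisc : lam < 29 * μ / 3) (h0 : 0 < ε) (h1 : ε ≤ 1)
    (hχ : ContDiff ℝ ((⊤ : ℕ∞) : WithTop ℕ∞) χ) (hs : HasCompactSupport χ) (hχ0 : ∀ x, 0 ≤ χ x) :
    ∫ x, χ x * (ρt x * pot ε (‖u x‖ ^ 2)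
        + ρ x * ∑ j, u x j * (61 / 20 * wt ε (‖u x‖ ^ 2)) * ut x j)
      ≤ ∫ x, energyRHS μ lam ε χ ρ P u Du x := by
  have hν : 0 ≤ μ + lam := by linarith
  -- If the left integrand fails to be integrable its integral is zero by convention, and the
  -- nonnegative right-hand side settles the claim.
  by_cases hi : Integrable (fun x => χ x * (ρt x * pot ε (‖u x‖ ^ 2)
      + ρ x * ∑ j, u x j * (61 / 20 * wt ε (‖u x‖ ^ 2)) * ut x j)) volume
  swap
  · rw [integral_undef hi]
    exact integral_nonneg fun x => energyRHS_nonneg hμ hν h0 h1 hχ0 x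
  have hE := S.integrable_energyRHS hμ hν h0 h1 hχ hs
  -- Four families of divergences with vanishing integral: the flux of ρΦ, the pressure work, and
  -- the two viscous terms. Adding them to the left side turns the inequality into the pointwise
  -- one.
  have n1 := fun j => S.rho_locH1.integral_mul_cutoff (S.pot_locH1 h0 h1 j) hχ hs (e j)
  have n2 := fun j => S.P_locH1.integral_mul_cutoff (S.test_locH1 h0 h1 j) hχ hs (e j)
  have n3 := fun i j => (S.entry_locH1 i j).integral_mul_cutoff (S.test_locH1 h0 h1 j) hχ hs (e i)
  have n4 := fun i j => (S.entry_locH1 i i).integral_mul_cutoff (S.test_locH1 h0 h1 j) hχ hs (e j)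
  have s1 := integrable_finsetSum Finset.univ fun j _ => (n1 j).1
  have s2 := integrable_finsetSum Finset.univ fun j _ => (n2 j).1
  have s3 := integrable_finsetSum Finset.univ fun i _ =>
    integrable_finsetSum Finset.univ fun j _ => (n3 i j).1
  have s4 := integrable_finsetSum Finset.univ fun i _ =>
    integrable_finsetSum Finset.univ fun j _ => (n4 i j).1
  have z1 := integral_finsetSum Finset.univ fun j _ => (n1 j).1
  have z2 := integral_finsetSum Finset.univ fun j _ => (n2 j).1
  have z3 := integral_finsetSum Finset.univ fun i _ =>
    integrable_finsetSum Finset.univ fun j _ => (n3 i j).1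
  have z3' := fun i => integral_finsetSum Finset.univ fun j _ => (n3 i j).1
  have z4 := integral_finsetSum Finset.univ fun i _ =>
    integrable_finsetSum Finset.univ fun j _ => (n4 i j).1
  have z4' := fun i => integral_finsetSum Finset.univ fun j _ => (n4 i j).1
  simp only [z3', z4', (n1 _).2, (n2 _).2, (n3 _ _).2, (n4 _ _).2, Finset.sum_const_zero]
    at z1 z2 z3 z4
  have i1 := hi.add s1
  have i2 := i1.add s2
  have i3 := i2.sub (s3.const_mul μ)
  have i4 := i3.sub (s4.const_mul (μ + lam))
  have key : ∫ x, χ x * (ρt x * pot ε (‖u x‖ ^ 2)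
        + ρ x * ∑ j, u x j * (61 / 20 * wt ε (‖u x‖ ^ 2)) * ut x j) = _ :=
    (show _ = ∫ x, _ by
      rw [integral_sub' i3 (s4.const_mul (μ + lam)), integral_sub' i2 (s3.const_mul μ),
        integral_add' i1 s2, integral_add' hi s1, integral_const_mul, integral_const_mul, z1, z2,
        z3, z4]
      ring)
  rw [key]
  refine integral_mono_ae i4 hE ?_
  filter_upwards [S.mass, S.momentum] with x hx1 hx2
  have w0 := wt_pos h0 h1 (‖u x‖ ^ 2)
  have p0 := zero_le_one.trans (one_le_pot h0 h1 (by positivity : 0 ≤ ‖u x‖ ^ 2))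
  have hmass : ρt x + ((∑ i, u x i * Dρ x (e i)) + ρ x * ∑ i, Du x (e i) i) = 0 := by
    rw [← hx1, clm_apply_eq_sum (Dρ x) (u x)]; rfl
  have hmom : ∀ j, ρ x * ut x j + ρ x * (∑ i, u x i * Du x (e i) j) + DP x (e j)
      = μ * (∑ i, D2u x (e i) (e i) j) + (μ + lam) * (∑ i, D2u x (e j) (e i) i) := fun j => by
    have h := hx2 j
    rw [← coordL_apply j (Du x (u x)), ← ContinuousLinearMap.comp_apply,
      clm_apply_eq_sum (coordL j ∘L Du x) (u x)] at h
    exact h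
  have E := energy_identity (μ := μ) (ν := μ + lam) (χ := χ x) (Φ := pot ε (‖u x‖ ^ 2))
    (P := P x) (c := 61 / 40 * wt ε (‖u x‖ ^ 2)) (fun i j => Du x (e i) j)
    (fun i k l => D2u x (e i) (e k) l)
    (fun i j => u x j * (61 / 20 * wt' ε (‖u x‖ ^ 2) * gradSq u Du x (e i))
      + 61 / 20 * wt ε (‖u x‖ ^ 2) * Du x (e i) j)
    (fun j => u x j) (fun j => ut x j) (fun j => Dρ x (e j)) (fun j => DP x (e j))
    (fun j => fderiv ℝ χ x (e j)) (fun j => gradSq u Du x (e j))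
    (fun j => u x j * (61 / 20 * wt ε (‖u x‖ ^ 2)))
    (fun j => by ring) (fun i => gradSq_apply u Du x (e i)) hmass hmom
  have b := boundary_terms_le (μ := μ) (ν := μ + lam) hμ.le hν (fun i j => Du x (e i) j)
    (fun j => u x j) (fun j => fderiv ℝ χ x (e j))
    (fun j => u x j * (61 / 20 * wt ε (‖u x‖ ^ 2))) (ρ := ρ x) (P := P x)
    (Φ := pot ε (‖u x‖ ^ 2)) (K := ‖fderiv ℝ χ x‖) (U := ‖u x‖) (a := ‖Du x‖)
    (f := 61 / 20 * wt ε (‖u x‖ ^ 2) * ‖u x‖) p0 (fun j => by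
      rw [← Real.norm_eq_abs]; exact norm_clm_e_le (fderiv ℝ χ x) j)
    (fun j => abs_coord_le _ j) (fun i j => abs_clm_e_coord_le _ i j) (fun j => by
      rw [abs_mul, mul_comm, abs_of_pos (by positivity : 0 < 61 / 20 * wt ε (‖u x‖ ^ 2))]
      gcongr
      exact abs_coord_le _ j)
  have p := pressure_le_dissipation hμ hphys hvisc (fun i j => Du x (e i) j) (fun j => u x j)
    (h := wt ε (‖u x‖ ^ 2)) (k := wt' ε (‖u x‖ ^ 2)) (P := P x) w0
    (wt'_nonneg h0 h1 (by positivity)) (by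
      rw [← norm_sq_eq_sum_coord]; exact two_mul_wt'_le h0 h1 _)
  have p' : χ x * (P x * (∑ j, (u x j * (61 / 20 * wt' ε (‖u x‖ ^ 2) * gradSq u Du x (e j))
        + 61 / 20 * wt ε (‖u x‖ ^ 2) * Du x (e j) j))
      - μ * (∑ i, ∑ j, Du x (e i) j * (u x j * (61 / 20 * wt' ε (‖u x‖ ^ 2) * gradSq u Du x (e i))
        + 61 / 20 * wt ε (‖u x‖ ^ 2) * Du x (e i) j))
      - (μ + lam) * (∑ i, Du x (e i) i) *
        ∑ j, (u x j * (61 / 20 * wt' ε (‖u x‖ ^ 2) * gradSq u Du x (e j))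
        + 61 / 20 * wt ε (‖u x‖ ^ 2) * Du x (e j) j))
      ≤ χ x * (61 / 20 * (5 / (2 * μ) * (P x ^ 2 * wt ε (‖u x‖ ^ 2)))) := by
    refine mul_le_mul_of_nonneg_left ?_ (hχ0 x)
    refine (le_of_eq ?_).trans (mul_le_mul_of_nonneg_left p (by norm_num : (0 : ℝ) ≤ 61 / 20))
    simp only [gradSq_apply, Fin.sum_univ_three]
    ring
  refine (le_of_eq ?_).trans (E.le.trans ?_)
  · simp only [Pi.sub_apply, Pi.add_apply, add_apply, smul_apply, smul_eq_mul,
      ContinuousLinearMap.comp_apply, coordL_apply, entryL_apply]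
  · unfold energyRHS
    linarith

end Slice

/-! ### Weak derivatives on an interval and the fundamental theorem of calculus. -/

section WeakDerivativeOnInterval

variable {F : Type*} [NormedAddCommGroup F] [NormedSpace ℝ F] [CompleteSpace F]

lemma contDiff_transition : ContDiff ℝ ((⊤ : ℕ∞) : WithTop ℕ∞) Real.smoothTransition :=
  Real.smoothTransition.contDiff

lemma deriv_transition_eq_zero {y : ℝ} (h : y < 0 ∨ 1 < y) : deriv Real.smoothTransition y = 0 := by
  rcases h with h | h
  · have : Real.smoothTransition =ᶠ[𝓝 y] fun _ => 0 := by
      filter_upwards [Iio_mem_nhds h] with z hz using Real.smoothTransition.zero_of_nonpos hz.le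
    rw [this.deriv_eq, deriv_const]
  · have : Real.smoothTransition =ᶠ[𝓝 y] fun _ => 1 := by
      filter_upwards [Ioi_mem_nhds h] with z hz using Real.smoothTransition.one_of_one_le hz.le
    rw [this.deriv_eq, deriv_const]

lemma continuous_deriv_transition : Continuous (deriv Real.smoothTransition) :=
  contDiff_transition.continuous_deriv (by simp)

lemma hasCompactSupport_deriv_transition :
    HasCompactSupport (deriv Real.smoothTransition) :=
  HasCompactSupport.of_support_subset_isCompact (isCompact_Icc (a := (0 : ℝ)) (b := 1)) fun y hy => by
    by_contra h
    refine hy (deriv_transition_eq_zero ?_)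
    rw [mem_Icc, not_and_or, not_le, not_le] at h
    exact h

lemma integral_deriv_transition : ∫ y, deriv Real.smoothTransition y = 1 := by
  have h := intervalIntegral.integral_deriv_eq_sub' (a := (-1 : ℝ)) (b := 2) Real.smoothTransition rfl
    (fun x _ => (contDiff_transition.differentiable (by simp)) x)
    continuous_deriv_transition.continuousOn
  rw [Real.smoothTransition.zero_of_nonpos (by norm_num : (-1 : ℝ) ≤ 0),
    Real.smoothTransition.one_of_one_le (by norm_num : (1 : ℝ) ≤ 2), sub_zero,
    intervalIntegral.integral_of_le (by norm_num)] at h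
  rw [← h]
  refine (setIntegral_eq_integral_of_forall_compl_eq_zero fun x hx => ?_).symm
  refine deriv_transition_eq_zero ?_
  rw [mem_Ioc, not_and_or, not_lt, not_le] at hx
  rcases hx with hx | hx
  · left; linarith
  · right; linarith

lemma tendsto_deriv_transition {M : ℝ → F} (hM : Integrable M volume) {s : ℝ}
    (hs : ContinuousAt M s) :
    Tendsto (fun n : ℕ => ∫ τ, ((n : ℝ) * deriv Real.smoothTransition (n * (τ - s))) • M τ) atTop
      (𝓝 (M s)) := by
  have h := tendsto_integral_comp_smul_smul_of_integrable' (μ := (volume : Measure ℝ))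
    -- The reflection is needed because the approximate identity is evaluated at multiples of s - τ.
    (φ := fun y => deriv Real.smoothTransition (-y))
    (fun y => Real.smoothTransition.monotone.deriv_nonneg)
    (by rw [integral_neg_eq_self (fun y => deriv Real.smoothTransition y)]
        exact integral_deriv_transition)
    (by
      have hc : HasCompactSupport fun y : ℝ => ‖y‖ ^ Module.finrank ℝ ℝ *
          deriv Real.smoothTransition (-y) :=
        (hasCompactSupport_deriv_transition.comp_homeomorph (Homeomorph.neg ℝ)).mul_left
      have := hc.is_zero_at_infty
      rwa [← Metric.cobounded_eq_cocompact] at this) hM hs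
  refine (h.comp tendsto_natCast_atTop_atTop).congr fun n => ?_
  simp only [Function.comp_apply, Module.finrank_self, pow_one, smul_eq_mul]
  congr 1
  ext τ
  congr 3
  ring

/-- The test functions are differences of two steep smooth steps at s and t. Their derivatives are
two approximate identities, which give m s - m t, while the functions themselves tend to the
indicator of (s,t]. -/
lemma sub_eq_integral_of_weak {T : ℝ} {m j : ℝ → F} (hm : ContinuousOn m (Icc 0 T))
    (hj : IntegrableOn j (Ioo 0 T) volume)
    (h : ∀ η : ℝ → ℝ, ContDiff ℝ ((⊤ : ℕ∞) : WithTop ℕ∞) η → HasCompactSupport η →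
      tsupport η ⊆ Ioo 0 T → ∫ τ, deriv η τ • m τ = - ∫ τ, η τ • j τ)
    {s t : ℝ} (hs : 0 < s) (hst : s < t) (ht : t < T) :
    m t - m s = ∫ τ in s..t, j τ := by
  set M := (Ioo 0 T).indicator m with hM
  have Mi : Integrable M volume :=
    (integrable_indicator_iff measurableSet_Ioo).2
      ((hm.integrableOn_compact isCompact_Icc).mono_set Ioo_subset_Icc_self)
  have Mc : ∀ x ∈ Ioo 0 T, ContinuousAt M x := fun x hx => by
    refine (hm.continuousAt (Icc_mem_nhds hx.1 hx.2)).congr ?_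
    filter_upwards [Ioo_mem_nhds hx.1 hx.2] with y hy
    rw [hM, indicator_of_mem hy]
  set J := (Ioo 0 T).indicator j with hJ
  have Ji : Integrable J volume := (integrable_indicator_iff measurableSet_Ioo).2 hj
  set η : ℕ → ℝ → ℝ := fun n τ => Real.smoothTransition (n * (τ - s))
    - Real.smoothTransition (n * (τ - t)) with hη
  have ηd : ∀ n, ContDiff ℝ ((⊤ : ℕ∞) : WithTop ℕ∞) (η n) := fun n =>
    (contDiff_transition.comp (contDiff_const.mul (contDiff_id.sub contDiff_const))).sub
      (contDiff_transition.comp (contDiff_const.mul (contDiff_id.sub contDiff_const)))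
  have ηder : ∀ (n : ℕ) τ, deriv (η n) τ = n * deriv Real.smoothTransition (n * (τ - s))
      - n * deriv Real.smoothTransition (n * (τ - t)) := fun n τ => by
    have key : ∀ a, HasDerivAt (fun τ => Real.smoothTransition (n * (τ - a)))
        (n * deriv Real.smoothTransition (n * (τ - a))) τ := fun a => by
      have h1 := ((contDiff_transition.differentiable (by simp)) (n * (τ - a))).hasDerivAt
      have h2 : HasDerivAt (fun τ : ℝ => (n : ℝ) * (τ - a)) (n * 1) τ :=
        ((hasDerivAt_id τ).sub_const a).const_mul _
      have h3 := h1.comp τ h2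
      rw [mul_one, mul_comm] at h3
      exact h3
    exact ((key s).sub (key t)).deriv
  -- Each step rises over an interval of length 1/n to the right of its base point, so the support
  -- stays below T only once n(T - t) > 1.
  have ηs : ∀ n : ℕ, 1 < n * (T - t) → tsupport (η n) ⊆ Icc s (t + 1 / n) := fun n hn => by
    have n0 : (0 : ℝ) < n := by
      rcases Nat.eq_zero_or_pos n with rfl | h0
      · norm_num at hn
      · exact_mod_cast h0
    refine closure_minimal (fun τ hτ => ?_) isClosed_Icc
    by_contra hc
    refine hτ ?_
    rw [mem_Icc, not_and_or, not_le, not_le] at hc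
    simp only [hη]
    rcases hc with hc | hc
    · rw [Real.smoothTransition.zero_of_nonpos (mul_nonpos_of_nonneg_of_nonpos n0.le (by linarith)),
        Real.smoothTransition.zero_of_nonpos (mul_nonpos_of_nonneg_of_nonpos n0.le (by linarith)),
        sub_self]
    · have : 1 < n * (τ - t) := by
        have : 1 / (n : ℝ) < τ - t := by linarith
        rwa [div_lt_iff₀ n0, mul_comm] at this
      have h2 : 1 ≤ n * (τ - s) := by
        have : n * (τ - t) ≤ n * (τ - s) := by gcongr
        linarith
      rw [Real.smoothTransition.one_of_one_le this.le, Real.smoothTransition.one_of_one_le h2,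
        sub_self]
  have ev : ∀ᶠ n : ℕ in atTop, 1 < n * (T - t) :=
    (tendsto_natCast_atTop_atTop.atTop_mul_const (by linarith)).eventually_gt_atTop 1
  have lim1 : Tendsto (fun n => ∫ τ, deriv (η n) τ • m τ) atTop (𝓝 (m s - m t)) := by
    have a1 := tendsto_deriv_transition Mi (Mc s ⟨hs, hst.trans ht⟩)
    have a2 := tendsto_deriv_transition Mi (Mc t ⟨hs.trans hst, ht⟩)
    have e1 : M s = m s := indicator_of_mem (show s ∈ Ioo 0 T from ⟨hs, hst.trans ht⟩) _
    have e2 : M t = m t := indicator_of_mem (show t ∈ Ioo 0 T from ⟨hs.trans hst, ht⟩) _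
    rw [e1] at a1
    rw [e2] at a2
    refine (a1.sub a2).congr' ?_
    filter_upwards [ev] with n hn
    have n0 : (0 : ℝ) < n := by
      rcases Nat.eq_zero_or_pos n with rfl | h0
      · norm_num at hn
      · exact_mod_cast h0
    have ki : ∀ a, Integrable (fun τ => ((n : ℝ) * deriv Real.smoothTransition (n * (τ - a))) • M τ)
        volume := fun a => by
      obtain ⟨C, hC⟩ := hasCompactSupport_deriv_transition.exists_bound_of_continuous
        continuous_deriv_transition
      refine Mi.bdd_smul (n * C) (Continuous.aestronglyMeasurable ?_)
        (Eventually.of_forall fun τ => ?_)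
      · exact continuous_const.mul (continuous_deriv_transition.comp (by fun_prop))
      · rw [norm_mul, Real.norm_of_nonneg n0.le]
        gcongr
        exact hC _
    rw [← integral_sub (ki s) (ki t)]
    refine integral_congr_ae (Eventually.of_forall fun τ => ?_)
    simp only
    rw [← sub_smul, ← ηder]
    by_cases hτ : τ ∈ Ioo 0 T
    · rw [hM, indicator_of_mem hτ]
    · have : deriv (η n) τ = 0 := by
        refine image_eq_zero_of_notMem_tsupport fun hh => hτ ?_
        have := ηs n hn (tsupport_deriv_subset hh)
        refine ⟨hs.trans_le this.1, this.2.trans_lt ?_⟩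
        have : 1 / (n : ℝ) < T - t := by rw [div_lt_iff₀ n0, mul_comm]; exact hn
        linarith
      rw [this, zero_smul, zero_smul]
  have lim2 : Tendsto (fun n => ∫ τ, η n τ • J τ) atTop (𝓝 (∫ τ, (Ioc s t).indicator J τ)) := by
    refine tendsto_integral_of_dominated_convergence (fun τ => ‖J τ‖)
      (fun n => (ηd n).continuous.aestronglyMeasurable.smul Ji.1) Ji.norm (fun n =>
        Eventually.of_forall fun τ => ?_) (Eventually.of_forall fun τ => ?_)
    · rw [norm_smul]
      refine mul_le_of_le_one_left (norm_nonneg _) ?_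
      rw [Real.norm_eq_abs, abs_le]
      simp only [hη]
      constructor <;> linarith [Real.smoothTransition.nonneg (n * (τ - s)),
        Real.smoothTransition.le_one (n * (τ - s)), Real.smoothTransition.nonneg (n * (τ - t)),
        Real.smoothTransition.le_one (n * (τ - t))]
    · have lim : ∀ a, Tendsto (fun n : ℕ => Real.smoothTransition (n * (τ - a))) atTop
          (𝓝 ((Ioi a).indicator (fun _ => 1) τ)) := fun a => by
        by_cases ha : a < τ
        · rw [indicator_of_mem (mem_Ioi.2 ha)]
          refine tendsto_const_nhds.congr' ?_
          filter_upwards [(tendsto_natCast_atTop_atTop.atTop_mul_const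
            (sub_pos.2 ha)).eventually_ge_atTop 1] with n hn
          rw [Real.smoothTransition.one_of_one_le hn]
        · rw [indicator_of_notMem (by simpa using ha)]
          refine tendsto_const_nhds.congr fun n => ?_
          rw [Real.smoothTransition.zero_of_nonpos
            (mul_nonpos_of_nonneg_of_nonpos (by positivity) (by linarith))]
      have := ((lim s).sub (lim t)).smul_const (J τ)
      convert this using 2
      by_cases h1 : s < τ <;> by_cases h2 : t < τ <;> simp [indicator, h1, h2]
      linarith
  have lim3 : Tendsto (fun n => ∫ τ, deriv (η n) τ • m τ) atTop
      (𝓝 (-∫ τ, (Ioc s t).indicator J τ)) := by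
    refine lim2.neg.congr' ?_
    filter_upwards [ev] with n hn
    have n0 : (0 : ℝ) < n := by
      rcases Nat.eq_zero_or_pos n with rfl | h0
      · norm_num at hn
      · exact_mod_cast h0
    have sub : tsupport (η n) ⊆ Ioo 0 T := fun x hx => by
      have := ηs n hn hx
      refine ⟨hs.trans_le this.1, this.2.trans_lt ?_⟩
      have : 1 / (n : ℝ) < T - t := by rw [div_lt_iff₀ n0, mul_comm]; exact hn
      linarith
    rw [h (η n) (ηd n) (HasCompactSupport.of_support_subset_isCompact (isCompact_Icc)
      ((subset_tsupport _).trans (ηs n hn))) sub]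
    congr 1
    refine integral_congr_ae (Eventually.of_forall fun τ => ?_)
    by_cases hτ : τ ∈ Ioo 0 T
    · simp only [hJ, indicator_of_mem hτ]
    · simp only
      rw [image_eq_zero_of_notMem_tsupport (fun hh => hτ (sub hh)), zero_smul, zero_smul]
  have e := tendsto_nhds_unique lim1 lim3
  rw [integral_indicator measurableSet_Ioc] at e
  rw [intervalIntegral.integral_of_le hst.le, ← neg_sub, e, neg_neg]
  refine setIntegral_congr_fun measurableSet_Ioc fun τ hτ => ?_
  rw [hJ, indicator_of_mem (show τ ∈ Ioo 0 T from ⟨hs.trans hτ.1, hτ.2.trans_lt ht⟩)]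

/-- The difference of m and the primitive is constant on the open interval; continuity on the closed
one carries this to the endpoints, and so brings in the value at time zero. -/
lemma eq_add_integral_of_weak {T : ℝ} (hT : 0 < T) {m j : ℝ → F} (hm : ContinuousOn m (Icc 0 T))
    (hj : IntegrableOn j (Ioo 0 T) volume)
    (h : ∀ η : ℝ → ℝ, ContDiff ℝ ((⊤ : ℕ∞) : WithTop ℕ∞) η → HasCompactSupport η →
      tsupport η ⊆ Ioo 0 T → ∫ τ, deriv η τ • m τ = - ∫ τ, η τ • j τ)
    {t : ℝ} (ht : t ∈ Icc 0 T) : m t = m 0 + ∫ τ in 0..t, j τ := by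
  have ji : IntervalIntegrable j volume 0 T :=
    (intervalIntegrable_iff_integrableOn_Ioo_of_le hT.le).2 hj
  have jsub : ∀ {s}, s ∈ Icc 0 T → IntervalIntegrable j volume 0 s := fun {s} hs =>
    ji.mono_set (by rw [uIcc_of_le hs.1, uIcc_of_le hT.le]; exact Icc_subset_Icc_right hs.2)
  set D : ℝ → F := fun t => m t - ∫ τ in 0..t, j τ with hD
  have Dc : ContinuousOn D (Icc 0 T) := by
    refine hm.sub ?_
    have := intervalIntegral.continuousOn_primitive_interval (μ := volume) (a := 0) (b := T) (f := j)
      (by rw [uIcc_of_le hT.le, integrableOn_Icc_iff_integrableOn_Ioo]; exact hj)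
    rwa [uIcc_of_le hT.le] at this
  have half : T / 2 ∈ Ioo 0 T := ⟨by linarith, by linarith⟩
  have Deq : EqOn D (fun _ => D (T / 2)) (Ioo 0 T) := by
    have lt : ∀ s t, 0 < s → s < t → t < T → D s = D t := fun s t hs hst ht => by
      have e := sub_eq_integral_of_weak hm hj h hs hst ht
      rw [← intervalIntegral.integral_interval_sub_left (jsub ⟨(hs.trans hst).le, ht.le⟩)
        (jsub ⟨hs.le, (hst.trans ht).le⟩)] at e
      simp only [hD]
      rw [sub_eq_sub_iff_add_eq_add] at e ⊢
      rw [add_comm, add_comm (m t), ← sub_eq_zero]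
      rw [← sub_eq_zero] at e
      rw [← neg_eq_zero, ← e]
      abel
    intro s hs
    rcases lt_trichotomy s (T / 2) with h1 | h1 | h1
    · exact lt _ _ hs.1 h1 half.2
    · rw [h1]
    · exact (lt _ _ half.1 h1 hs.2).symm
  have Deq' : EqOn D (fun _ => D (T / 2)) (Icc 0 T) :=
    Deq.of_subset_closure Dc continuousOn_const Ioo_subset_Icc_self (by rw [closure_Ioo hT.ne])
  have e0 := Deq' ⟨le_rfl, hT.le⟩
  have e1 := Deq' ht
  have : D t = D 0 := e1.trans e0.symm
  simp only [hD, intervalIntegral.integral_same, sub_zero] at this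
  rw [← this]
  abel

end WeakDerivativeOnInterval


/-! ### Integrability on bounded space-time cylinders. -/

section Cylinders

variable {F : Type} [NormedAddCommGroup F]

/-- Lebesgue measure on the cylinder `(0,T) × B(0,R)`. -/
noncomputable def cyl (T R : ℝ) : Measure (ℝ × E3) :=
  (volume.restrict (Ioo 0 T)).prod (volume.restrict (Metric.ball (0 : E3) R))

instance (T : ℝ) : IsFiniteMeasure (volume.restrict (Ioo (0 : ℝ) T)) :=
  ⟨by rw [Measure.restrict_apply_univ, Real.volume_Ioo]; exact ENNReal.ofReal_lt_top⟩

instance (T R : ℝ) : IsFiniteMeasure (cyl T R) := by unfold cyl; infer_instance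

lemma cyl_eq (T R : ℝ) : cyl T R = volume.restrict (Ioo 0 T ×ˢ Metric.ball (0 : E3) R) := by
  rw [cyl, Measure.prod_restrict, Measure.volume_eq_prod]

/-- A continuous curve is locally bounded, and compactness of [0,T] makes the bound uniform. -/
lemma ContLp.exists_bound {T : ℝ} {p : ℝ≥0∞} {f : ℝ → E3 → F} (h : ContLp T p f) (hp : 1 ≤ p) :
    ∃ C : ℝ≥0, ∀ t ∈ Icc 0 T, eLpNorm (f t) p volume ≤ C := by
  have key : ∃ C : ℝ≥0, ∀ t ∈ Icc 0 T, t ∈ Icc 0 T → eLpNorm (f t) p volume ≤ C := by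
    refine (isCompact_Icc (a := (0 : ℝ)) (b := T)).induction_on
      (p := fun S => ∃ C : ℝ≥0, ∀ t ∈ S, t ∈ Icc 0 T → eLpNorm (f t) p volume ≤ C) ?_ ?_ ?_ ?_
    · exact ⟨0, by simp⟩
    · rintro s t hst ⟨C, hC⟩
      exact ⟨C, fun x hx => hC x (hst hx)⟩
    · rintro s t ⟨C, hC⟩ ⟨D, hD⟩
      refine ⟨max C D, fun x hx hxT => ?_⟩
      rcases hx with hx | hx
      · exact (hC x hx hxT).trans (by exact_mod_cast le_max_left _ _)
      · exact (hD x hx hxT).trans (by exact_mod_cast le_max_right _ _)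
    · intro s hs
      refine ⟨{t | eLpNorm (fun x => f t x - f s x) p volume < 1},
        (h.2.2 s hs).eventually (gt_mem_nhds zero_lt_one), 1 + (eLpNorm (f s) p volume).toNNReal,
        fun t ht htT => ?_⟩
      have h1 : MemLp (fun x => f t x - f s x) p volume := (h.2.1 t htT).sub (h.2.1 s hs)
      have h2 := eLpNorm_add_le h1.1 (h.2.1 s hs).1 hp
      have e : (fun x => f t x - f s x) + f s = f t := by ext x; simp
      rw [e] at h2
      refine h2.trans ?_
      rw [ENNReal.coe_add, ENNReal.coe_toNNReal (h.2.1 s hs).2.ne]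
      exact add_le_add (le_of_lt ht) le_rfl
  exact key.imp fun C hC t ht => hC t ht ht

lemma ContLp.aesm_cyl {T : ℝ} {p : ℝ≥0∞} {f : ℝ → E3 → F} (h : ContLp T p f) (R : ℝ) :
    AEStronglyMeasurable (Function.uncurry f) (cyl T R) := by
  rw [cyl_eq]
  exact h.1.mono_measure (Measure.restrict_mono (Set.prod_mono Ioo_subset_Icc_self (subset_univ _)) le_rfl)

lemma MemTimeLp.aesm_cyl {T : ℝ} {a p : ℝ≥0∞} {f : ℝ → E3 → F} (h : MemTimeLp T a p f) (R : ℝ) :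
    AEStronglyMeasurable (Function.uncurry f) (cyl T R) := by
  rw [cyl_eq]
  exact h.1.mono_measure (Measure.restrict_mono (Set.prod_mono le_rfl (subset_univ _)) le_rfl)

lemma ContLp.memLp_cyl {T : ℝ} {p : ℝ≥0∞} {f : ℝ → E3 → F} (h : ContLp T p f) (hp : 1 ≤ p)
    (hp' : p ≠ ⊤) (R : ℝ) : MemLp (Function.uncurry f) p (cyl T R) := by
  have p0 : p ≠ 0 := (zero_lt_one.trans_le hp).ne'
  have hm := h.aesm_cyl R
  refine ⟨hm, ?_⟩
  rw [eLpNorm_lt_top_iff_lintegral_rpow_enorm_lt_top p0 hp', cyl]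
  obtain ⟨C, hC⟩ := h.exists_bound hp
  rw [lintegral_prod _ (by rw [cyl] at hm; exact hm.enorm.pow_const _)]
  refine lt_of_le_of_lt (lintegral_mono_ae (g := fun _ => (C : ℝ≥0∞) ^ p.toReal) ?_) ?_
  · filter_upwards [ae_restrict_mem measurableSet_Ioo] with t ht
    have h1 := hC t (Ioo_subset_Icc_self ht)
    refine (setLIntegral_le_lintegral _ _).trans ?_
    refine le_trans ?_ (ENNReal.rpow_le_rpow h1 ENNReal.toReal_nonneg)
    rw [eLpNorm_eq_lintegral_rpow_enorm_toReal p0 hp', ← ENNReal.rpow_mul,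
      one_div_mul_cancel (ENNReal.toReal_pos p0 hp').ne', ENNReal.rpow_one]
    rfl
  · rw [lintegral_const]
    exact ENNReal.mul_lt_top (ENNReal.rpow_lt_top_of_nonneg ENNReal.toReal_nonneg ENNReal.coe_ne_top)
      (measure_lt_top _ _)

lemma MemTimeLp.memLp_cyl {T : ℝ} {f : ℝ → E3 → F} (h : MemTimeLp T 2 6 f) (R : ℝ) :
    MemLp (Function.uncurry f) 2 (cyl T R) := by
  have hm := h.aesm_cyl R
  refine ⟨hm, ?_⟩
  rw [eLpNorm_lt_top_iff_lintegral_rpow_enorm_lt_top (by norm_num) (by norm_num), cyl]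
  rw [cyl] at hm
  rw [lintegral_prod _ (hm.enorm.pow_const _)]
  have h2 := h.2
  rw [timeNorm, eLpNorm_lt_top_iff_lintegral_rpow_enorm_lt_top (by norm_num) (by norm_num)] at h2
  simp only [enorm_eq_self] at h2
  set c : ℝ≥0∞ := ((volume.restrict (Metric.ball (0 : E3) R)) univ) ^
    (1 / (2 : ℝ≥0∞).toReal - 1 / (6 : ℝ≥0∞).toReal) with hc
  have c1 : c ≠ ⊤ := ENNReal.rpow_ne_top_of_nonneg (by norm_num) (measure_ne_top _ _)
  have c2 : c ^ (2 : ℝ≥0∞).toReal ≠ ⊤ := ENNReal.rpow_ne_top_of_nonneg (by norm_num) c1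
  refine lt_of_le_of_lt (lintegral_mono_ae
    (g := fun t => (eLpNorm (f t) 6 volume) ^ (2 : ℝ≥0∞).toReal * c ^ (2 : ℝ≥0∞).toReal) ?_) ?_
  · filter_upwards [hm.prodMk_left] with t ht
    have h3 := eLpNorm_le_eLpNorm_mul_rpow_measure_univ (p := 2) (q := 6) (by norm_num) ht
    have h4 : eLpNorm (fun y => Function.uncurry f (t, y)) 2 (volume.restrict (Metric.ball (0 : E3) R))
        ≤ eLpNorm (f t) 6 volume * c :=
      h3.trans (mul_le_mul_left (eLpNorm_mono_measure _ Measure.restrict_le_self) _)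
    have h5 := ENNReal.rpow_le_rpow h4 (z := (2 : ℝ≥0∞).toReal) ENNReal.toReal_nonneg
    rw [ENNReal.mul_rpow_of_nonneg _ _ ENNReal.toReal_nonneg,
      eLpNorm_eq_lintegral_rpow_enorm_toReal (by norm_num) (by norm_num), ← ENNReal.rpow_mul,
      one_div_mul_cancel (by norm_num), ENNReal.rpow_one] at h5
    exact h5
  · rw [lintegral_mul_const' _ _ c2]
    exact ENNReal.mul_lt_top h2 c2.lt_top

end Cylinders

/-! ### Functions of time as primitives of their weak time derivative. -/

section TimeRepresentation

variable {F : Type} [NormedAddCommGroup F] [NormedSpace ℝ F]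

lemma ContLp.continuousOn_integral {T : ℝ} {p : ℝ≥0∞} {w : ℝ → E3 → F} (h : ContLp T p w)
    (hp : 1 ≤ p) {ψ : E3 → ℝ} (hψ : Continuous ψ) (hs : HasCompactSupport ψ) :
    ContinuousOn (fun t => ∫ x, ψ x • w t x) (Icc 0 T) := by
  obtain ⟨C, hC⟩ := hs.exists_abs_bound hψ
  obtain ⟨R, -, hR⟩ := exists_tsupport_subset_ball hs
  have hi : ∀ t ∈ Icc 0 T, Integrable (fun x => ψ x • w t x) volume := fun t ht =>
    ((h.2.1 t ht).locallyIntegrable hp).integrable_smul_left_of_hasCompactSupport hψ hs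
  intro s hs'
  set c : ℝ≥0∞ := ((volume.restrict (Metric.ball (0 : E3) R)) univ) ^
    (1 / (1 : ℝ≥0∞).toReal - 1 / p.toReal) with hc
  refine tendsto_integral_of_L1 _ (hi s hs').1 (eventually_nhdsWithin_of_forall fun t ht => hi t ht) ?_
  have hlim : Tendsto (fun t => ‖C‖ₑ * (eLpNorm (fun x => w t x - w s x) p volume * c))
      (𝓝[Icc 0 T] s) (𝓝 0) := by
    have hcT : c ≠ ⊤ := by
      refine ENNReal.rpow_ne_top_of_nonneg ?_ (measure_ne_top _ _)
      simp only [ENNReal.toReal_one, one_div, inv_one, sub_nonneg]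
      by_cases hpt : p = ⊤
      · simp [hpt]
      · exact inv_le_one_of_one_le₀ (by
          rw [← ENNReal.toReal_one]; exact ENNReal.toReal_mono hpt hp)
    have h1 := ENNReal.Tendsto.mul_const (h.2.2 s hs') (b := c) (Or.inr hcT)
    rw [zero_mul] at h1
    have h2 := ENNReal.Tendsto.const_mul h1 (a := ‖C‖ₑ) (Or.inr enorm_ne_top)
    rwa [mul_zero] at h2
  refine tendsto_of_tendsto_of_tendsto_of_le_of_le' tendsto_const_nhds hlim
    (Eventually.of_forall fun _ => zero_le) (eventually_nhdsWithin_of_forall fun t ht => ?_)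
  have hm : AEStronglyMeasurable (fun x => w t x - w s x) (volume.restrict (Metric.ball (0 : E3) R)) :=
    ((h.2.1 t ht).1.sub (h.2.1 s hs').1).restrict
  have h3 := eLpNorm_le_eLpNorm_mul_rpow_measure_univ (p := 1) (q := p) hp hm
  have h4 := h3.trans (mul_le_mul_left (eLpNorm_mono_measure _ Measure.restrict_le_self) c)
  rw [eLpNorm_one_eq_lintegral_enorm] at h4
  refine le_trans ?_ (mul_le_mul_right h4 ‖C‖ₑ)
  rw [← lintegral_const_mul' _ _ enorm_ne_top, ← lintegral_indicator measurableSet_ball]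
  refine lintegral_mono fun x => ?_
  by_cases hx : x ∈ Metric.ball (0 : E3) R
  · rw [indicator_of_mem hx, ← smul_sub, enorm_smul]
    gcongr
    rw [enorm_le_iff_norm_le, Real.norm_eq_abs, Real.norm_eq_abs]
    exact (hC x).trans (le_abs_self _)
  · have : ψ x = 0 := image_eq_zero_of_notMem_tsupport fun h => hx (hR h)
    simp [this]

lemma integrable_smul_of_locallyIntegrableOn {T : ℝ} {f : ℝ × E3 → F}
    (hf : LocallyIntegrableOn f (Ioo 0 T ×ˢ (univ : Set E3)) volume) {φ : ℝ × E3 → ℝ}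
    (hφ : Continuous φ) (hs : HasCompactSupport φ) (hsub : tsupport φ ⊆ Ioo 0 T ×ˢ (univ : Set E3)) :
    Integrable (fun z => φ z • f z) volume := by
  have h1 := hf.integrableOn_compact_subset hsub hs
  refine (integrableOn_iff_integrable_of_support_subset (s := tsupport φ) ?_).1
    (h1.continuousOn_smul hφ.continuousOn hs)
  intro z hz
  refine subset_tsupport φ fun h => hz ?_
  simp [h]

/-- Testing with products η(t)ψ(x) separates the variables: the pairing with a fixed ψ has the
pairing with the time derivative as its weak derivative on the interval. -/
lemma HasWeakTimeDeriv.integral_prod [CompleteSpace F] {T : ℝ} {w wt : ℝ → E3 → F} (h : HasWeakTimeDeriv T w wt)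
    {ψ : E3 → ℝ} (hψ : ContDiff ℝ ((⊤ : ℕ∞) : WithTop ℕ∞) ψ) (hs : HasCompactSupport ψ)
    {η : ℝ → ℝ} (hη : ContDiff ℝ ((⊤ : ℕ∞) : WithTop ℕ∞) η) (hηs : HasCompactSupport η)
    (hsub : tsupport η ⊆ Ioo 0 T) :
    ∫ τ, deriv η τ • ∫ x, ψ x • w τ x = - ∫ τ, η τ • ∫ x, ψ x • wt τ x := by
  have tp : ∀ ζ : ℝ → ℝ, tsupport ζ ⊆ tsupport η →
      tsupport (fun z : ℝ × E3 => ζ z.1 * ψ z.2) ⊆ tsupport η ×ˢ tsupport ψ := fun ζ hζ => by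
    refine closure_minimal (fun z hz => ?_) ((isClosed_tsupport _).prod (isClosed_tsupport _))
    rw [Function.mem_support, mul_ne_zero_iff] at hz
    exact ⟨hζ (subset_tsupport _ hz.1), subset_tsupport _ hz.2⟩
  have cs : ∀ ζ : ℝ → ℝ, tsupport ζ ⊆ tsupport η →
      HasCompactSupport (fun z : ℝ × E3 => ζ z.1 * ψ z.2) := fun ζ hζ =>
    HasCompactSupport.of_support_subset_isCompact (hηs.isCompact.prod hs.isCompact)
      ((subset_tsupport _).trans (tp ζ hζ))
  have ss : ∀ ζ : ℝ → ℝ, tsupport ζ ⊆ tsupport η →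
      tsupport (fun z : ℝ × E3 => ζ z.1 * ψ z.2) ⊆ Ioo 0 T ×ˢ (univ : Set E3) := fun ζ hζ =>
    (tp ζ hζ).trans (Set.prod_mono hsub (subset_univ _))
  have fub : ∀ (ζ : ℝ → ℝ) (f : ℝ → E3 → F), Continuous ζ → tsupport ζ ⊆ tsupport η →
      LocallyIntegrableOn (Function.uncurry f) (Ioo 0 T ×ˢ (univ : Set E3)) volume →
      ∫ z : ℝ × E3, (ζ z.1 * ψ z.2) • f z.1 z.2 = ∫ τ, ζ τ • ∫ x, ψ x • f τ x := by
    intro ζ f hζ hζs hf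
    have hi : Integrable (fun z : ℝ × E3 => (ζ z.1 * ψ z.2) • f z.1 z.2) volume :=
      integrable_smul_of_locallyIntegrableOn hf
      ((hζ.comp continuous_fst).mul (hψ.continuous.comp continuous_snd)) (cs ζ hζs) (ss ζ hζs)
    rw [Measure.volume_eq_prod] at hi ⊢
    rw [MeasureTheory.integral_prod _ hi]
    refine integral_congr_ae (Eventually.of_forall fun τ => ?_)
    simp only [mul_smul]
    rw [integral_smul]
  have key := h.2.2 (fun z => η z.1 * ψ z.2)
    ((hη.comp contDiff_fst).mul (hψ.comp contDiff_snd)) (cs η subset_rfl) (ss η subset_rfl)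
  rw [fub η wt hη.continuous subset_rfl h.2.1] at key
  rw [← key, ← fub (deriv η) w (hη.continuous_deriv (by simp)) (tsupport_deriv_subset) h.1]
  refine integral_congr_ae (Eventually.of_forall fun z => ?_)
  simp only
  congr 1
  have d1 : HasFDerivAt (fun z : ℝ × E3 => η z.1) _ z :=
    ((hη.differentiable (by simp) z.1).hasDerivAt.hasFDerivAt).comp z hasFDerivAt_fst
  have d2 : HasFDerivAt (fun z : ℝ × E3 => ψ z.2) _ z :=
    ((hψ.differentiable (by simp) z.2).hasFDerivAt).comp z hasFDerivAt_snd
  rw [(d1.fun_mul d2).fderiv]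
  simp [mul_comm]

/-- A function in `C([0,T]; L^p)` with integrable weak time derivative is the primitive of the latter. -/
theorem HasWeakTimeDeriv.ae_eq_add_integral [CompleteSpace F] {T : ℝ} (hT : 0 < T) {p : ℝ≥0∞} (hp : 1 ≤ p)
    {w wt : ℝ → E3 → F} (h : HasWeakTimeDeriv T w wt) (hw : ContLp T p w)
    (hwt : ∀ R, Integrable (Function.uncurry wt) (cyl T R)) {t : ℝ} (ht : t ∈ Icc 0 T) :
    ∀ᵐ x, w t x = w 0 x + ∫ τ in 0..t, wt τ x := by
  have hwt' : ∀ R, Integrable (Function.uncurry wt)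
      ((volume.restrict (Ioc 0 t)).prod (volume.restrict (Metric.ball (0 : E3) R))) := fun R => by
    have h1 := hwt R
    rw [cyl, restrict_Ioo_eq_restrict_Ioc] at h1
    refine h1.mono_measure ?_
    rw [Measure.prod_restrict, Measure.prod_restrict]
    exact Measure.restrict_mono (Set.prod_mono (Ioc_subset_Ioc_right ht.2) le_rfl) le_rfl
  have l1 : ∀ s ∈ Icc 0 T, LocallyIntegrable (w s) volume := fun s hs =>
    (hw.2.1 s hs).locallyIntegrable hp
  have h0 : (0 : ℝ) ∈ Icc 0 T := ⟨le_rfl, hT.le⟩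
  have l2 : LocallyIntegrable (fun x => ∫ τ in 0..t, wt τ x) volume := by
    refine locallyIntegrable_of_ball fun R => ?_
    simp only [intervalIntegral.integral_of_le ht.1]
    exact (hwt' R).integral_prod_right
  -- Fundamental lemma of the calculus of variations at fixed time, so the exceptional null set
  -- depends on t.
  have key := ae_eq_zero_of_integral_contDiff_smul_eq_zero (μ := (volume : Measure E3))
    (f := fun x => w t x - w 0 x - ∫ τ in 0..t, wt τ x) (((l1 t ht).sub (l1 0 h0)).sub l2) ?_
  · filter_upwards [key] with x hx
    rw [sub_sub, sub_eq_zero] at hx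
    exact hx
  intro ψ hψ hs
  obtain ⟨R, -, hR⟩ := exists_tsupport_subset_ball hs
  obtain ⟨C, hC⟩ := hs.exists_abs_bound hψ.continuous
  have off : ∀ (f : E3 → F), ∫ x in Metric.ball (0 : E3) R, ψ x • f x = ∫ x, ψ x • f x := fun f =>
    setIntegral_eq_integral_of_forall_compl_eq_zero fun x hx => by
      rw [image_eq_zero_of_notMem_tsupport fun h => hx (hR h), zero_smul]
  have prodI : ∀ ν : Measure ℝ, ∀ [SFinite ν], Integrable (Function.uncurry wt)
      (ν.prod (volume.restrict (Metric.ball (0 : E3) R))) →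
      Integrable (fun z : ℝ × E3 => ψ z.2 • wt z.1 z.2)
        (ν.prod (volume.restrict (Metric.ball (0 : E3) R))) := fun ν _ hν =>
    hν.bdd_smul C (hψ.continuous.comp continuous_snd).aestronglyMeasurable
      (Eventually.of_forall fun z => hC z.2)
  have ji : IntegrableOn (fun τ => ∫ x, ψ x • wt τ x) (Ioo 0 T) volume := by
    have := (prodI _ (hwt R)).integral_prod_left
    simp only [off] at this
    exact this
  have e := eq_add_integral_of_weak hT (hw.continuousOn_integral hp hψ.continuous hs) ji
    (fun η hη hηs hsub => h.integral_prod hψ hs hη hηs hsub) ht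
  have i1 := fun s hs' => (l1 s hs').integrable_smul_left_of_hasCompactSupport hψ.continuous hs
  have i2 := l2.integrable_smul_left_of_hasCompactSupport hψ.continuous hs
  simp only [smul_sub]
  rw [integral_sub (f := fun x => ψ x • w t x - ψ x • w 0 x) ((i1 t ht).sub (i1 0 h0)) i2,
    integral_sub (i1 t ht) (i1 0 h0), e]
  have sw : ∫ τ in 0..t, ∫ x, ψ x • wt τ x = ∫ x, ψ x • ∫ τ in 0..t, wt τ x := by
    rw [← off fun x => ∫ τ in 0..t, wt τ x]
    simp only [intervalIntegral.integral_of_le ht.1, ← off (wt _)]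
    rw [integral_integral_swap (prodI _ (hwt' R))]
    refine integral_congr_ae (Eventually.of_forall fun x => ?_)
    simp only
    rw [integral_smul]
  rw [sw]
  abel

end TimeRepresentation


/-! ### Chain rule in time for absolutely continuous functions. -/

section ChainRule

lemma _root_.AbsolutelyContinuousOnInterval.comp_of_hasDerivAt {f : ℝ → ℝ} {a b : ℝ}
    (hf : AbsolutelyContinuousOnInterval f a b) {G g : ℝ → ℝ} {L : ℝ}
    (hG : ∀ s, HasDerivAt G (g s) s) (hL : ∀ s, |g s| ≤ L) :
    AbsolutelyContinuousOnInterval (fun t => G (f t)) a b := by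
  unfold AbsolutelyContinuousOnInterval at *
  have h := hf.const_mul L
  rw [mul_zero] at h
  refine squeeze_zero (fun E => Finset.sum_nonneg fun i _ => dist_nonneg) (fun E => ?_) h
  rw [Finset.mul_sum]
  exact Finset.sum_le_sum fun i _ => abs_sub_le_of_hasDerivAt hG hL _ _

lemma absolutelyContinuous_const_add {c T : ℝ} {f : ℝ → ℝ} (hf : IntervalIntegrable f volume 0 T) :
    AbsolutelyContinuousOnInterval (fun t => c + ∫ τ in 0..t, f τ) 0 T := by
  have h1 := hf.absolutelyContinuousOnInterval_intervalIntegral (c := 0) left_mem_uIcc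
  have h2 : AbsolutelyContinuousOnInterval (fun _ : ℝ => c) 0 T :=
    LipschitzOnWith.absolutelyContinuousOnInterval (K := 0) (LipschitzWith.const c).lipschitzOnWith
  exact h2.add h1

lemma hasDerivAt_mul_comp_sum_sq {A : ℝ → ℝ} {B : Fin 3 → ℝ → ℝ} {a t : ℝ} {b : Fin 3 → ℝ}
    {G g : ℝ → ℝ} (hA : HasDerivAt A a t) (hB : ∀ j, HasDerivAt (B j) (b j) t)
    (hG : ∀ s, HasDerivAt G (g s) s) :
    HasDerivAt (fun t => A t * G (∑ j, B j t ^ 2))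
      (a * G (∑ j, B j t ^ 2) + A t * (g (∑ j, B j t ^ 2) * (2 * ∑ j, B j t * b j))) t := by
  have ds : HasDerivAt (fun t => ∑ j, B j t ^ 2) (2 * ∑ j, B j t * b j) t := by
    have h := HasDerivAt.fun_sum (u := Finset.univ) fun j _ => (hB j).fun_pow 2
    rw [Finset.mul_sum]
    refine h.congr_deriv (Finset.sum_congr rfl fun j _ => ?_)
    norm_num
    ring
  exact hA.mul ((hG (∑ j, B j t ^ 2)).comp t ds)

/-- The fundamental theorem of calculus for `a G(|b|²)` with absolutely continuous `a` and `b`. -/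
lemma integral_chain_rule {T : ℝ} {a₀ : ℝ} {a' : ℝ → ℝ} (ha : IntervalIntegrable a' volume 0 T)
    {b₀ : Fin 3 → ℝ} {b' : Fin 3 → ℝ → ℝ} (hb : ∀ j, IntervalIntegrable (b' j) volume 0 T)
    {G g : ℝ → ℝ} {L : ℝ} (hG : ∀ s, HasDerivAt G (g s) s) (hL : ∀ s, |g s| ≤ L) :
    (a₀ + ∫ τ in 0..T, a' τ) * G (∑ j, (b₀ j + ∫ τ in 0..T, b' j τ) ^ 2) - a₀ * G (∑ j, b₀ j ^ 2)
      = ∫ t in 0..T, (a' t * G (∑ j, (b₀ j + ∫ τ in 0..t, b' j τ) ^ 2)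
        + (a₀ + ∫ τ in 0..t, a' τ) * (g (∑ j, (b₀ j + ∫ τ in 0..t, b' j τ) ^ 2)
          * (2 * ∑ j, (b₀ j + ∫ τ in 0..t, b' j τ) * b' j t))) := by
  have A := absolutelyContinuous_const_add (c := a₀) ha
  have B := fun j => absolutelyContinuous_const_add (c := b₀ j) (hb j)
  have B2 : AbsolutelyContinuousOnInterval (fun t => ∑ j, (b₀ j + ∫ τ in 0..t, b' j τ) ^ 2) 0 T := by
    simp only [Fin.sum_univ_three, sq]
    exact (((B 0).fun_mul (B 0)).fun_add ((B 1).fun_mul (B 1))).fun_add ((B 2).fun_mul (B 2))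
  have key := (A.fun_mul (B2.comp_of_hasDerivAt hG hL)).integral_deriv_eq_sub
  simp only [intervalIntegral.integral_same, add_zero] at key
  refine key.symm.trans ?_
  refine intervalIntegral.integral_congr_ae ?_
  filter_upwards [ha.ae_hasDerivAt_integral, (hb 0).ae_hasDerivAt_integral,
    (hb 1).ae_hasDerivAt_integral, (hb 2).ae_hasDerivAt_integral] with t h h0 h1 h2 ht
  have ht' := uIoc_subset_uIcc ht
  have d := (h ht' 0 left_mem_uIcc).const_add a₀
  have dj : ∀ j, HasDerivAt (fun t => b₀ j + ∫ τ in 0..t, b' j τ) (b' j t) t := fun j => by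
    fin_cases j
    · exact (h0 ht' 0 left_mem_uIcc).const_add _
    · exact (h1 ht' 0 left_mem_uIcc).const_add _
    · exact (h2 ht' 0 left_mem_uIcc).const_add _
  exact (hasDerivAt_mul_comp_sum_sq d dj hG).deriv

end ChainRule

/-! ### Exchanging "for every t, almost every x" with "for almost every x, almost every t". -/

section SpaceTime

variable {F : Type} [NormedAddCommGroup F] [NormedSpace ℝ F]

lemma ae_ae_swap {α β : Type*} [MeasurableSpace α] [MeasurableSpace β] {μ : Measure α}
    {ν : Measure β} [SFinite μ] [SFinite ν] {p : α × β → Prop} (h : ∀ᵐ z ∂μ.prod ν, p z) :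
    ∀ᵐ y ∂ν, ∀ᵐ x ∂μ, p (x, y) := by
  have h2 := (Measure.measurePreserving_swap (μ := ν) (ν := μ)).quasiMeasurePreserving.ae h
  exact Measure.ae_ae_of_ae_prod h2

/-- Interchange of quantifiers in the representation of `f` as a primitive. -/
lemma ae_ae_eq_add_integral {T R : ℝ} {f ft : ℝ → E3 → F}
    (hf : AEStronglyMeasurable (Function.uncurry f) (cyl T R))
    (hf0 : AEStronglyMeasurable (f 0) volume)
    (hft : Integrable (Function.uncurry ft) (cyl T R))
    (h : ∀ t ∈ Icc 0 T, ∀ᵐ x, f t x = f 0 x + ∫ τ in 0..t, ft τ x) :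
    ∀ᵐ x ∂(volume.restrict (Metric.ball (0 : E3) R)), ∀ᵐ t ∂(volume.restrict (Ioo 0 T)),
      f t x = f 0 x + ∫ τ in 0..t, ft τ x := by
  set μ := volume.restrict (Ioo 0 T) with hμ
  set ν := volume.restrict (Metric.ball (0 : E3) R) with hν
  have hfm : AEStronglyMeasurable (Function.uncurry f) (μ.prod ν) := hf
  obtain ⟨φ, hφm, hφ⟩ : AEStronglyMeasurable (Function.uncurry ft) (μ.prod ν) := hft.1
  have hf0m : AEStronglyMeasurable (f 0) ν := hf0.restrict
  set I : ℝ × E3 → F := fun z => ∫ σ, (Ioc 0 z.1).indicator (fun σ => φ (σ, z.2)) σ ∂μ with hI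
  have Im : StronglyMeasurable I := by
    have hm : StronglyMeasurable (fun y : (ℝ × E3) × ℝ =>
        ({y : (ℝ × E3) × ℝ | 0 < y.2 ∧ y.2 ≤ y.1.1}).indicator
          (fun y => φ (y.2, y.1.2)) y) := by
      refine (hφm.comp_measurable (by fun_prop)).indicator ?_
      exact (measurableSet_lt measurable_const measurable_snd).inter
        (measurableSet_le measurable_snd (measurable_fst.comp measurable_fst))
    exact hm.integral_prod_right'
  have Ieq : ∀ᵐ x ∂ν, ∀ t ∈ Ioo 0 T, I (t, x) = ∫ τ in 0..t, ft τ x := by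
    filter_upwards [ae_ae_swap hφ] with x hx t ht
    rw [intervalIntegral.integral_of_le ht.1.le, hI]
    simp only
    rw [integral_indicator measurableSet_Ioc, hμ, Measure.restrict_restrict measurableSet_Ioc,
      inter_eq_left.2 (show Ioc 0 t ⊆ Ioo 0 T from fun σ hσ => ⟨hσ.1, hσ.2.trans_lt ht.2⟩)]
    refine integral_congr_ae ?_
    have := hx.filter_mono (ae_mono (Measure.restrict_mono_set volume
      (show Ioc 0 t ⊆ Ioo 0 T from fun σ hσ => ⟨hσ.1, hσ.2.trans_lt ht.2⟩)))
    exact this.mono fun σ hσ => hσ.symm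
  -- Passing from iterated to product null sets requires a measurable set of equality; hence the
  -- measurable representatives and the jointly measurable primitive `I`.
  have main : ∀ᵐ z ∂μ.prod ν, hfm.mk _ z = hf0m.mk _ z.2 + I z := by
    refine (Measure.ae_prod_iff_ae_ae ?_).2 ?_
    · exact hfm.stronglyMeasurable_mk.measurableSet_eq_fun
        ((hf0m.stronglyMeasurable_mk.comp_measurable measurable_snd).add Im)
    · filter_upwards [Measure.ae_ae_of_ae_prod hfm.ae_eq_mk, ae_restrict_mem measurableSet_Ioo]
        with t ht htT
      filter_upwards [ht, hf0m.ae_eq_mk, Ieq, ae_restrict_of_ae (h t (Ioo_subset_Icc_self htT))]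
        with x h1 h2 h3 h4
      rw [← h1, ← h2, h3 t htT]
      exact h4
  filter_upwards [ae_ae_swap main, ae_ae_swap hfm.ae_eq_mk, hf0m.ae_eq_mk, Ieq] with x h1 h2 h3 h4
  filter_upwards [h1, h2, ae_restrict_mem measurableSet_Ioo] with t k1 k2 k3
  rw [← h4 t k3, h3, ← k1, ← k2]
  rfl

end SpaceTime

/-! ### Evolution of the truncated, localised energy. -/

section EnergyIdentity

variable {T q ε : ℝ} {ρ ρt : ℝ → E3 → ℝ} {u ut : ℝ → E3 → E3} {χ : E3 → ℝ}

/-- The integrand in the time derivative of `∫ χ ρ Φ(u)`. -/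
noncomputable def rate (ε : ℝ) (ρ ρt : ℝ → E3 → ℝ) (u ut : ℝ → E3 → E3) (t : ℝ) (x : E3) : ℝ :=
  ρt t x * pot ε (‖u t x‖ ^ 2)
    + ρ t x * ∑ j, u t x j * (61 / 20 * wt ε (‖u t x‖ ^ 2)) * ut t x j

instance : ENNReal.HolderTriple 3 6 2 := ⟨by
  rw [← ENNReal.toReal_eq_toReal_iff' (by simp) (by simp), ENNReal.toReal_add (by simp) (by simp)]
  norm_num⟩

/-- On a cylinder ρ_t ∈ L² is paired with the potential, which is in L² as it is at most cubic in 1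
+ |u| ∈ L⁶; the other term has ρ ∈ L³, u ∈ L⁶ and u_t ∈ L² with a bounded weight. The condition q >
3 is used for ρ ∈ L³. -/
lemma integrable_rate (h0 : 0 < ε) (h1 : ε ≤ 1) (hq : 3 < q) (hρ : ContLp T (ENNReal.ofReal q) ρ)
    (hρt : ContLp T 2 ρt) (hu : ContLp T 6 u) (hut : MemTimeLp T 2 6 ut) (R : ℝ) :
    Integrable (Function.uncurry (rate ε ρ ρt u ut)) (cyl T R) := by
  have q3 : (3 : ℝ≥0∞) ≤ ENNReal.ofReal q := by
    rw [show (3 : ℝ≥0∞) = ENNReal.ofReal 3 by norm_num]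
    exact ENNReal.ofReal_le_ofReal hq.le
  have mρ : MemLp (Function.uncurry ρ) 3 (cyl T R) :=
    (hρ.memLp_cyl (le_trans (by norm_num) q3) ENNReal.ofReal_ne_top R).mono_exponent q3
  have mρt := hρt.memLp_cyl (by norm_num) (by norm_num) R
  have mu := hu.memLp_cyl (by norm_num) (by norm_num) R
  have mv := hut.memLp_cyl R
  have msq : AEStronglyMeasurable (fun z : ℝ × E3 => ‖u z.1 z.2‖ ^ 2) (cyl T R) := mu.1.norm.pow 2
  have mw := (continuous_wt h0 h1).comp_aestronglyMeasurable msq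
  have mp := (Slice.continuous_pot h0 h1).comp_aestronglyMeasurable msq
  have mone : MemLp (fun z : ℝ × E3 => 1 + ‖u z.1 z.2‖) 6 (cyl T R) := by
    have c1 : MemLp (fun _ : ℝ × E3 => (1 : ℝ)) 6 (cyl T R) := memLp_const 1
    exact c1.add mu.norm
  have mcube : MemLp (fun z : ℝ × E3 => (1 + ‖u z.1 z.2‖) ^ 3) 2 (cyl T R) := by
    refine (memLp_two_iff_integrable_sq (mone.1.pow 3)).2 ?_
    refine (mone.integrable_norm_pow (p := 6) (by norm_num)).congr (Eventually.of_forall fun x => ?_)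
    simp only [Pi.pow_apply]
    rw [← pow_mul, Real.norm_eq_abs]
    exact Even.pow_abs (by decide) _
  have mpot : MemLp (fun z : ℝ × E3 => pot ε (‖u z.1 z.2‖ ^ 2)) 2 (cyl T R) := by
    refine mcube.of_le_mul (c := 2 / ε) mp (Eventually.of_forall fun z => ?_)
    have n0 := norm_nonneg (u z.1 z.2)
    rw [Real.norm_of_nonneg (zero_le_one.trans (one_le_pot h0 h1 (by positivity))),
      Real.norm_of_nonneg (by positivity)]
    refine (pot_le_inv h0 h1 (by positivity)).trans ?_
    gcongr
    nlinarith [mul_nonneg n0 n0, mul_nonneg (mul_nonneg n0 n0) n0]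
  have i1 : Integrable (fun z : ℝ × E3 => ρt z.1 z.2 * pot ε (‖u z.1 z.2‖ ^ 2)) (cyl T R) :=
    mρt.integrable_mul mpot
  have mru : MemLp (fun z : ℝ × E3 => ρ z.1 z.2 * ‖u z.1 z.2‖) 2 (cyl T R) :=
    mu.norm.mul (p := 3) mρ
  have i2 : Integrable (fun z : ℝ × E3 => ρ z.1 z.2 * ‖u z.1 z.2‖ * ‖ut z.1 z.2‖) (cyl T R) :=
    mru.integrable_mul mv.norm
  have mj : ∀ {v : ℝ → E3 → E3} (j : Fin 3), AEStronglyMeasurable (Function.uncurry v) (cyl T R) →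
      AEStronglyMeasurable (fun z : ℝ × E3 => v z.1 z.2 j) (cyl T R) := fun j hv =>
    (coordL j).continuous.comp_aestronglyMeasurable hv
  have i3 : Integrable (fun z : ℝ × E3 => ρ z.1 z.2 *
      ∑ j, u z.1 z.2 j * (61 / 20 * wt ε (‖u z.1 z.2‖ ^ 2)) * ut z.1 z.2 j) (cyl T R) := by
    refine (i2.norm.const_mul (3 * (61 / 20 * (1 / ε)))).mono' (mρ.1.mul ?_)
      (Eventually.of_forall fun z => ?_)
    · simp only [Fin.sum_univ_three]
      have := fun j => ((mj j mu.1).mul (mw.const_mul (61 / 20))).mul (mj j mv.1)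
      exact ((this 0).add (this 1)).add (this 2)
    · rw [norm_mul, norm_mul, norm_mul, norm_norm, norm_norm]
      have : ‖∑ j, u z.1 z.2 j * (61 / 20 * wt ε (‖u z.1 z.2‖ ^ 2)) * ut z.1 z.2 j‖
          ≤ ∑ _j : Fin 3, ‖u z.1 z.2‖ * (61 / 20 * (1 / ε)) * ‖ut z.1 z.2‖ := by
        refine (norm_sum_le _ _).trans (Finset.sum_le_sum fun j _ => ?_)
        rw [norm_mul, norm_mul, Real.norm_of_nonneg
          (mul_nonneg (by norm_num) (wt_pos h0 h1 _).le : 0 ≤ 61 / 20 * wt ε (‖u z.1 z.2‖ ^ 2))]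
        gcongr
        · exact mul_nonneg (by norm_num) (wt_pos h0 h1 _).le
        · exact abs_coord_le _ _
        · exact wt_le_inv h0 h1 _
        · exact abs_coord_le _ _
      refine (mul_le_mul_of_nonneg_left this (norm_nonneg _)).trans_eq ?_
      rw [Finset.sum_const, Finset.card_univ, Fintype.card_fin, nsmul_eq_mul]
      push_cast
      ring
  exact i1.add i3

/-- The evolution of `∫ χ ρ Φ(u)`. -/
theorem integral_energy_eq (hT : 0 < T) (h0 : 0 < ε) (h1 : ε ≤ 1) (hq : 3 < q)
    (hρ2 : ContLp T 2 ρ) (hρ : ContLp T (ENNReal.ofReal q) ρ) (hρw : HasWeakTimeDeriv T ρ ρt)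
    (hρt : ContLp T 2 ρt) (hu : ContLp T 6 u) (huw : HasWeakTimeDeriv T u ut)
    (hut : MemTimeLp T 2 6 ut) (hχ : Continuous χ) (hs : HasCompactSupport χ) :
    IntegrableOn (fun τ => ∫ x, χ x * rate ε ρ ρt u ut τ x) (Ioo 0 T) volume ∧
    ∀ t ∈ Icc 0 T, ∫ x, χ x * (ρ t x * pot ε (‖u t x‖ ^ 2) - ρ 0 x * pot ε (‖u 0 x‖ ^ 2))
      = ∫ τ in 0..t, ∫ x, χ x * rate ε ρ ρt u ut τ x := by
  obtain ⟨C, hC⟩ := hs.exists_abs_bound hχ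
  obtain ⟨R, -, hR⟩ := exists_tsupport_subset_ball hs
  have off : ∀ (f : E3 → ℝ), ∫ x in Metric.ball (0 : E3) R, χ x * f x = ∫ x, χ x * f x := fun f =>
    setIntegral_eq_integral_of_forall_compl_eq_zero fun x hx => by
      rw [image_eq_zero_of_notMem_tsupport fun h => hx (hR h), zero_mul]
  have hrate := integrable_rate h0 h1 hq hρ hρt hu hut R
  have hI : Integrable (fun z : ℝ × E3 => χ z.2 * rate ε ρ ρt u ut z.1 z.2) (cyl T R) :=
    hrate.bdd_smul C (hχ.comp continuous_snd).aestronglyMeasurable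
      (Eventually.of_forall fun z => hC z.2)
  have iρ : ∀ R, Integrable (Function.uncurry ρt) (cyl T R) := fun R =>
    (hρt.memLp_cyl (by norm_num) (by norm_num) R).integrable (by norm_num)
  have iu : ∀ R, Integrable (Function.uncurry ut) (cyl T R) := fun R =>
    (hut.memLp_cyl R).integrable (by norm_num)
  have rρ := fun t ht => hρw.ae_eq_add_integral hT (by norm_num) hρ2 iρ (t := t) ht
  have ru := fun t ht => huw.ae_eq_add_integral hT (by norm_num) hu iu (t := t) ht
  have z0 : (0 : ℝ) ∈ Icc 0 T := ⟨le_rfl, hT.le⟩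
  have sρ := ae_ae_eq_add_integral (hρ2.aesm_cyl R) (hρ2.2.1 0 z0).1 (iρ R) rρ
  have su := ae_ae_eq_add_integral (hu.aesm_cyl R) (hu.2.1 0 z0).1 (iu R) ru
  refine ⟨?_, fun t ht => ?_⟩
  · have := hI.integral_prod_left
    simp only [off] at this
    exact this
  have hI' : Integrable (fun z : ℝ × E3 => χ z.2 * rate ε ρ ρt u ut z.1 z.2)
      ((volume.restrict (Ioc 0 t)).prod (volume.restrict (Metric.ball (0 : E3) R))) := by
    rw [cyl, restrict_Ioo_eq_restrict_Ioc] at hI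
    refine hI.mono_measure ?_
    rw [Measure.prod_restrict, Measure.prod_restrict]
    exact Measure.restrict_mono (Set.prod_mono (Ioc_subset_Ioc_right ht.2) le_rfl) le_rfl
  rw [← off, intervalIntegral.integral_of_le ht.1]
  simp only [← off (rate ε ρ ρt u ut _)]
  rw [integral_integral_swap hI']
  refine integral_congr_ae ?_
  have hsub : Ioc 0 t ⊆ Icc 0 T := fun τ hτ => ⟨hτ.1.le, hτ.2.trans ht.2⟩
  -- The representation at the end time t is required separately: statements for almost every τ say
  -- nothing about τ = t.
  filter_upwards [sρ, su, ae_restrict_of_ae (rρ t ht), ae_restrict_of_ae (ru t ht),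
    (iρ R).prod_left_ae, (iu R).prod_left_ae] with x k1 k2 k3 k4 k5 k6
  have ii : ∀ {f : ℝ → ℝ}, Integrable f (volume.restrict (Ioo 0 T)) → IntervalIntegrable f volume 0 t :=
    fun hf => by
      rw [restrict_Ioo_eq_restrict_Icc] at hf
      exact (intervalIntegrable_iff_integrableOn_Ioc_of_le ht.1).2
        (IntegrableOn.mono_set hf hsub)
  have k6' : IntegrableOn (fun τ => ut τ x) (Icc 0 T) volume := by
    have := k6
    rw [restrict_Ioo_eq_restrict_Icc] at this
    exact this
  have coord : ∀ s ∈ Icc 0 t, ∀ j, u s x = u 0 x + ∫ τ in 0..s, ut τ x →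
      u s x j = u 0 x j + ∫ τ in 0..s, ut τ x j := fun s hs' j hj => by
    have hii : IntervalIntegrable (fun τ => ut τ x) volume 0 s :=
      (intervalIntegrable_iff_integrableOn_Ioc_of_le hs'.1).2
        (k6'.mono_set fun τ hτ => ⟨hτ.1.le, (hτ.2.trans hs'.2).trans ht.2⟩)
    have := congrArg (coordL j) hj
    rw [map_add, ← ContinuousLinearMap.intervalIntegral_comp_comm _ hii] at this
    exact this
  have chain := integral_chain_rule (T := t) (a₀ := ρ 0 x) (a' := fun τ => ρt τ x) (ii k5)
    (b₀ := fun j => u 0 x j) (b' := fun j τ => ut τ x j)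
    (fun j => ii ((coordL j).integrable_comp k6)) (G := pot ε) (g := fun s => 61 / 40 * wt ε s)
    (L := 61 / 40 * (1 / ε)) (fun s => hasDerivAt_pot h0 h1 s) (fun s => by
      rw [abs_mul, abs_of_pos (by norm_num : (0 : ℝ) < 61 / 40), abs_of_pos (wt_pos h0 h1 s)]
      gcongr
      exact wt_le_inv h0 h1 s)
  rw [integral_const_mul]
  congr 1
  rw [← intervalIntegral.integral_of_le ht.1]
  have e1 : ∑ j, (u 0 x j + ∫ τ in 0..t, ut τ x j) ^ 2 = ‖u t x‖ ^ 2 := by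
    rw [norm_sq_eq_sum_coord]
    exact Finset.sum_congr rfl fun j _ => by rw [coord t ⟨ht.1, le_rfl⟩ j k4]
  rw [e1, ← k3, ← norm_sq_eq_sum_coord] at chain
  rw [chain]
  refine intervalIntegral.integral_congr_ae ?_
  rw [uIoc_of_le ht.1]
  have k1' := (ae_restrict_iff' measurableSet_Ioo).1 k1
  have k2' := (ae_restrict_iff' measurableSet_Ioo).1 k2
  have hne : ∀ᵐ τ : ℝ, τ ≠ T := by simp [ae_iff, measure_singleton]
  filter_upwards [k1', k2', hne] with τ l1 l2 l3 hτ
  have hτ' : τ ∈ Ioo 0 T := ⟨hτ.1, lt_of_le_of_ne (hτ.2.trans ht.2) l3⟩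
  have cj := fun j => coord τ ⟨hτ.1.le, hτ.2⟩ j (l2 hτ')
  simp only [← cj, ← l1 hτ', ← norm_sq_eq_sum_coord]
  rw [rate]
  congr 2
  rw [Finset.mul_sum, Finset.mul_sum]
  exact Finset.sum_congr rfl fun j _ => by ring

end EnergyIdentity


/-! ### Elementary inequalities and Gronwall's lemma. -/

section Elementary

/-- Young's inequality twice, with s = 4η² so that s/(4η) = η. The exponents suit the cutoff error:
d = |∇χ| is bounded in L³ and A in L², both allowed a small factor η, while the large constant falls
on U⁶, whose tail is small. -/
lemma exists_young {η : ℝ} (hη : 0 < η) :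
    ∃ C : ℝ, 0 ≤ C ∧ ∀ d U A : ℝ, 0 ≤ d → 0 ≤ U →
      d * U * A ≤ η * (A ^ 2 + d ^ 3) + C * U ^ 6 := by
  obtain ⟨s, hs⟩ : ∃ s, s = 4 * η * η := ⟨_, rfl⟩
  have s0 : 0 < s := by rw [hs]; positivity
  refine ⟨1 / (4 * η * s ^ 2), by positivity, fun d U A hd hU => ?_⟩
  have h1 : d * U * A ≤ η * A ^ 2 + d ^ 2 * U ^ 2 / (4 * η) := by
    have : 0 ≤ (2 * η * A - d * U) ^ 2 / (4 * η) := by positivity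
    have e : (2 * η * A - d * U) ^ 2 / (4 * η) = η * A ^ 2 + d ^ 2 * U ^ 2 / (4 * η) - d * U * A := by
      field_simp; ring
    linarith
  have h2 : d ^ 2 * U ^ 2 ≤ s * d ^ 3 + U ^ 6 / s ^ 2 := by
    rcases le_total (U ^ 2) (s * d) with h | h
    · have : d ^ 2 * U ^ 2 ≤ d ^ 2 * (s * d) := by gcongr
      have h3 : 0 ≤ U ^ 6 / s ^ 2 := by positivity
      nlinarith
    · have h3 : d ≤ U ^ 2 / s := by rw [le_div_iff₀ s0]; linarith
      have h4 : d ^ 2 * U ^ 2 ≤ (U ^ 2 / s) ^ 2 * U ^ 2 := by gcongr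
      have h5 : (U ^ 2 / s) ^ 2 * U ^ 2 = U ^ 6 / s ^ 2 := by field_simp
      have h6 : 0 ≤ s * d ^ 3 := by positivity
      linarith
  have h3 : d ^ 2 * U ^ 2 / (4 * η) ≤ (s * d ^ 3 + U ^ 6 / s ^ 2) / (4 * η) := by gcongr
  have h4 : (s * d ^ 3 + U ^ 6 / s ^ 2) / (4 * η) = η * d ^ 3 + 1 / (4 * η * s ^ 2) * U ^ 6 := by
    rw [hs]; field_simp
  linarith

lemma mul_pow_four_le {r : ℝ} (hr : 0 ≤ r) (U : ℝ) : r * U ^ 4 ≤ r ^ 3 + U ^ 6 := by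
  rcases le_total r (U ^ 2) with h | h
  · have : r * U ^ 4 ≤ U ^ 2 * U ^ 4 := by gcongr
    have h3 : 0 ≤ r ^ 3 := by positivity
    nlinarith
  · have : r * U ^ 4 ≤ r * r ^ 2 := by
      have : U ^ 4 ≤ r ^ 2 := by
        rw [show U ^ 4 = (U ^ 2) ^ 2 by ring]; gcongr
      gcongr
    have h3 : 0 ≤ U ^ 6 := by positivity
    nlinarith

/-- Interpolation: with q > 3 it puts the density in L³ from its L² and L^q bounds. -/
lemma cube_le_sq_add_rpow {r q : ℝ} (hr : 0 ≤ r) (hq : 3 < q) : r ^ 3 ≤ r ^ 2 + r ^ q := by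
  rcases le_total r 1 with h | h
  · have : r ^ 3 ≤ r ^ 2 := pow_le_pow_of_le_one hr h (by norm_num)
    have := Real.rpow_nonneg hr q
    linarith
  · have : r ^ 3 ≤ r ^ q := by
      rw [← Real.rpow_natCast]
      exact Real.rpow_le_rpow_of_exponent_le h (by norm_num; linarith)
    have := sq_nonneg r
    linarith

lemma mul_cubic_le {r : ℝ} (hr : 0 ≤ r) (U : ℝ) :
    r * U * (1 + U ^ 2) ≤ 2 * (r + r ^ 3 + U ^ 6) := by
  have h := mul_pow_four_le hr U
  have h2 : U * (1 + U ^ 2) ≤ 2 * (1 + U ^ 4) := by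
    nlinarith [sq_nonneg (U - 1), sq_nonneg (U ^ 2 - 1), sq_nonneg (U ^ 2 - U), sq_nonneg U]
  have h3 := mul_le_mul_of_nonneg_left h2 hr
  nlinarith

lemma rpow_two_mul_le {r γ q : ℝ} (hr : 0 ≤ r) (hγ : 1 ≤ γ) (hq : 4 * γ ≤ q) :
    r ^ (2 * γ) ≤ r + r ^ q := by
  rcases le_total r 1 with h | h
  · have : r ^ (2 * γ) ≤ r := by
      rcases hr.eq_or_lt with h0 | h0
      · rw [← h0, Real.zero_rpow (by linarith)]
      · calc r ^ (2 * γ) ≤ r ^ (1 : ℝ) := Real.rpow_le_rpow_of_exponent_ge h0 h (by linarith)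
          _ = r := Real.rpow_one r
    have := Real.rpow_nonneg hr q
    linarith
  · have : r ^ (2 * γ) ≤ r ^ q := Real.rpow_le_rpow_of_exponent_le h (by linarith)
    linarith

/-- A Gronwall inequality for integrals with an integrable rate. -/
lemma le_of_integral_rate_le {T a b : ℝ} {I J : ℝ → ℝ} (ha : 0 ≤ a) (hb : 0 ≤ b)
    (hJ : IntegrableOn J (Ioo 0 T) volume) (hI : ∀ t ∈ Icc 0 T, I t = I 0 + ∫ τ in 0..t, J τ)
    (hle : ∀ᵐ t ∂(volume.restrict (Ioo 0 T)), J t ≤ a * I t + b) {t : ℝ} (ht : t ∈ Icc 0 T) :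
    I t ≤ Real.exp (a * t) * (I 0 + b * t) := by
  have hT : 0 ≤ T := ht.1.trans ht.2
  have Ic : ContinuousOn I (Icc 0 T) := by
    have := intervalIntegral.continuousOn_primitive_interval (μ := volume) (a := 0) (b := T) (f := J)
      (by rw [uIcc_of_le hT, integrableOn_Icc_iff_integrableOn_Ioo]; exact hJ)
    rw [uIcc_of_le hT] at this
    exact (continuousOn_const.add this).congr hI
  set g : ℝ → ℝ := fun τ => a * I τ + b with hg
  have gc : ContinuousOn g (Icc 0 T) := (continuousOn_const.mul Ic).add continuousOn_const
  -- `I` is only known to be absolutely continuous, whereas `Y` dominates it and is differentiable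
  -- with Y' = aI + b ≤ aY + b. Then exp(-at)Y - bt is nonincreasing.
  set Y : ℝ → ℝ := fun t => I 0 + ∫ τ in 0..t, g τ with hY
  have IY : ∀ s ∈ Icc 0 T, I s ≤ Y s := fun s hs => by
    rw [hI s hs]
    have hle' : ∀ᵐ τ ∂(volume.restrict (Ioo 0 s)), J τ ≤ g τ :=
      hle.filter_mono (ae_mono (Measure.restrict_mono_set _ (Ioo_subset_Ioo_right hs.2)))
    have j1 : IntervalIntegrable J volume 0 s :=
      (intervalIntegrable_iff_integrableOn_Ioo_of_le hs.1).2 (hJ.mono_set (Ioo_subset_Ioo_right hs.2))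
    have j2 : IntervalIntegrable g volume 0 s :=
      (gc.mono (by rw [uIcc_of_le hs.1]; exact Icc_subset_Icc_right hs.2)).intervalIntegrable
    have := intervalIntegral.integral_mono_ae_restrict hs.1 j1 j2
      (by rw [← restrict_Ioo_eq_restrict_Icc]; exact hle')
    simp only [hY]
    linarith
  have Yd : ∀ s ∈ Ioo 0 T, HasDerivAt Y (g s) s := fun s hs => by
    have hn : Icc 0 T ∈ 𝓝 s := Icc_mem_nhds hs.1 hs.2
    refine HasDerivAt.const_add _ (intervalIntegral.integral_hasDerivAt_right ?_ ?_
      (gc.continuousAt hn))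
    · exact (gc.mono (by rw [uIcc_of_le hs.1.le]; exact Icc_subset_Icc_right hs.2.le)).intervalIntegrable
    · exact (gc.mono Ioo_subset_Icc_self).stronglyMeasurableAtFilter isOpen_Ioo s hs
  have Yc : ContinuousOn Y (Icc 0 T) := by
    have := intervalIntegral.continuousOn_primitive_interval (μ := volume) (a := 0) (b := T) (f := g)
      (by rw [uIcc_of_le hT]; exact gc.integrableOn_compact isCompact_Icc)
    rw [uIcc_of_le hT] at this
    exact continuousOn_const.add this
  set Z : ℝ → ℝ := fun t => Real.exp (-a * t) * Y t - b * t with hZ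
  have Zd : ∀ s ∈ Ioo 0 T, HasDerivAt Z (Real.exp (-a * s) * (-a) * Y s
      + Real.exp (-a * s) * g s - b) s := fun s hs => by
    have e1 : HasDerivAt (fun t => Real.exp (-a * t)) (Real.exp (-a * s) * (-a)) s := by
      simpa using ((hasDerivAt_id s).const_mul (-a)).exp
    have e2 : HasDerivAt (fun t => b * t) b s := by simpa using (hasDerivAt_id s).const_mul b
    exact (e1.mul (Yd s hs)).sub e2
  have Zanti : AntitoneOn Z (Icc 0 T) := by
    refine antitoneOn_of_deriv_nonpos (convex_Icc 0 T) ?_ ?_ ?_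
    · exact ((Real.continuous_exp.comp (continuous_const.mul continuous_id)).continuousOn.mul Yc).sub
        (continuous_const.mul continuous_id).continuousOn
    · rw [interior_Icc]
      exact fun s hs => (Zd s hs).differentiableAt.differentiableWithinAt
    · rw [interior_Icc]
      intro s hs
      rw [(Zd s hs).deriv]
      have k1 := IY s (Ioo_subset_Icc_self hs)
      have k2 : Real.exp (-a * s) ≤ 1 := by
        rw [Real.exp_le_one_iff]
        nlinarith [hs.1]
      have k3 : Real.exp (-a * s) * (a * I s - a * Y s) ≤ 0 :=
        mul_nonpos_of_nonneg_of_nonpos (Real.exp_pos _).le (by nlinarith)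
      have k4 : Real.exp (-a * s) * b ≤ 1 * b := by gcongr
      simp only [hg]
      linarith
  have h := Zanti ⟨le_rfl, hT⟩ ht ht.1
  simp only [hZ, hY, intervalIntegral.integral_same, mul_zero, Real.exp_zero, add_zero, one_mul,
    sub_zero] at h
  have h2 : Real.exp (-a * t) * Y t ≤ I 0 + b * t := by simp only [hY]; linarith
  refine (IY t ht).trans ?_
  have e : Y t = Real.exp (a * t) * (Real.exp (-a * t) * Y t) := by
    rw [← mul_assoc, ← Real.exp_add]
    simp
  rw [e]
  gcongr

end Elementary

/-! ### Bounds and tails uniform in time. -/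

section Uniform

variable {F : Type} [NormedAddCommGroup F]

lemma integral_rpow_norm_le {f : E3 → F} {μ : Measure E3} {p : ℝ} (hp : 0 < p)
    (h : MemLp f (ENNReal.ofReal p) μ) {C : ℝ≥0} (hC : eLpNorm f (ENNReal.ofReal p) μ ≤ C) :
    Integrable (fun x => ‖f x‖ ^ p) μ ∧ ∫ x, ‖f x‖ ^ p ∂μ ≤ (C : ℝ) ^ p := by
  have p0 : ENNReal.ofReal p ≠ 0 := by simpa using hp
  have h1 := h.integrable_norm_rpow p0 ENNReal.ofReal_ne_top
  rw [ENNReal.toReal_ofReal hp.le] at h1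
  refine ⟨h1, ?_⟩
  rw [h.eLpNorm_eq_integral_rpow_norm p0 ENNReal.ofReal_ne_top, ENNReal.toReal_ofReal hp.le] at hC
  have h2 : (∫ x, ‖f x‖ ^ p ∂μ) ^ p⁻¹ ≤ C := by
    have := ENNReal.ofReal_le_iff_le_toReal ENNReal.coe_ne_top |>.1 hC
    simpa using this
  have h3 : 0 ≤ ∫ x, ‖f x‖ ^ p ∂μ := integral_nonneg fun x => by positivity
  calc ∫ x, ‖f x‖ ^ p ∂μ = ((∫ x, ‖f x‖ ^ p ∂μ) ^ p⁻¹) ^ p := by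
        rw [← Real.rpow_mul h3, inv_mul_cancel₀ hp.ne', Real.rpow_one]
    _ ≤ _ := by gcongr

lemma ContLp.exists_integral_rpow_bound {T : ℝ} {p : ℝ} {f : ℝ → E3 → F}
    (h : ContLp T (ENNReal.ofReal p) f) (hp : 1 ≤ p) :
    ∃ C : ℝ, ∀ t ∈ Icc 0 T, Integrable (fun x => ‖f t x‖ ^ p) volume ∧ ∫ x, ‖f t x‖ ^ p ≤ C := by
  obtain ⟨C, hC⟩ := h.exists_bound (by simpa using hp)
  exact ⟨_, fun t ht => integral_rpow_norm_le (by linarith) (h.2.1 t ht) (hC t ht)⟩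

lemma ContLp.exists_integral_pow_bound {T : ℝ} {n : ℕ} {f : ℝ → E3 → F}
    (h : ContLp T n f) (hn : 1 ≤ n) :
    ∃ C : ℝ, ∀ t ∈ Icc 0 T, Integrable (fun x => ‖f t x‖ ^ n) volume ∧ ∫ x, ‖f t x‖ ^ n ≤ C := by
  have h' : ContLp T (ENNReal.ofReal (n : ℝ)) f := by rwa [ENNReal.ofReal_natCast]
  simpa only [Real.rpow_natCast] using h'.exists_integral_rpow_bound (by exact_mod_cast hn)

lemma MemLp.exists_eLpNorm_compl_ball_lt {f : E3 → F} {p : ℝ≥0∞} (h0 : p ≠ 0) (h1 : p ≠ ⊤)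
    (h : MemLp f p volume) {δ : ℝ≥0∞} (hδ : 0 < δ) :
    ∃ R₀ : ℝ, ∀ R ≥ R₀, eLpNorm f p (volume.restrict (Metric.ball (0 : E3) R)ᶜ) < δ := by
  have hlim : Tendsto (fun R : ℝ => eLpNorm f p (volume.restrict (Metric.ball (0 : E3) R)ᶜ)) atTop
      (𝓝 0) := by
    have hi : Tendsto (fun R : ℝ => ∫⁻ x in (Metric.ball (0 : E3) R)ᶜ, ‖f x‖ₑ ^ p.toReal) atTop
        (𝓝 0) := by
      have hfin := (eLpNorm_lt_top_iff_lintegral_rpow_enorm_lt_top h0 h1).1 h.2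
      simp only [← lintegral_indicator measurableSet_ball.compl]
      have hz : (0 : ℝ≥0∞) = ∫⁻ _ : E3, 0 := by simp
      rw [hz]
      have hm : AEMeasurable (fun x => ‖f x‖ₑ ^ p.toReal) volume := h.1.enorm.pow_const _
      refine tendsto_lintegral_filter_of_dominated_convergence' (fun x => ‖f x‖ₑ ^ p.toReal)
        (Eventually.of_forall fun R => hm.indicator measurableSet_ball.compl)
        (Eventually.of_forall fun R => Eventually.of_forall fun x => indicator_le_self _ _ _)
        hfin.ne (Eventually.of_forall fun x => ?_)
      refine tendsto_const_nhds.congr' ?_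
      filter_upwards [eventually_gt_atTop ‖x‖] with R hR
      rw [indicator_of_notMem]
      simpa using hR
    have := hi.ennrpow_const (1 / p.toReal)
    rw [ENNReal.zero_rpow_of_pos (by have := ENNReal.toReal_pos h0 h1; positivity)] at this
    refine this.congr fun R => ?_
    rw [eLpNorm_eq_lintegral_rpow_enorm_toReal h0 h1]
  exact eventually_atTop.1 (hlim.eventually (gt_mem_nhds hδ))

/-- Uniform smallness of the tails of a curve in `L^p`. -/
lemma ContLp.exists_tail {T : ℝ} {p : ℝ≥0∞} {f : ℝ → E3 → F} (h : ContLp T p f) (h0 : 1 ≤ p)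
    (h1 : p ≠ ⊤) {δ : ℝ≥0∞} (hδ : 0 < δ) :
    ∃ R₀ : ℝ, ∀ R ≥ R₀, ∀ t ∈ Icc 0 T,
      eLpNorm (f t) p (volume.restrict (Metric.ball (0 : E3) R)ᶜ) ≤ δ := by
  have key : ∃ R₀ : ℝ, ∀ R ≥ R₀, ∀ t ∈ Icc 0 T, t ∈ Icc 0 T →
      eLpNorm (f t) p (volume.restrict (Metric.ball (0 : E3) R)ᶜ) ≤ δ := by
    refine (isCompact_Icc (a := (0 : ℝ)) (b := T)).induction_on
      (p := fun S => ∃ R₀ : ℝ, ∀ R ≥ R₀, ∀ t ∈ S, t ∈ Icc 0 T →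
        eLpNorm (f t) p (volume.restrict (Metric.ball (0 : E3) R)ᶜ) ≤ δ) ?_ ?_ ?_ ?_
    · exact ⟨0, by simp⟩
    · rintro s t hst ⟨C, hC⟩
      exact ⟨C, fun R hR x hx => hC R hR x (hst hx)⟩
    · rintro s t ⟨C, hC⟩ ⟨D, hD⟩
      refine ⟨max C D, fun R hR x hx hxT => ?_⟩
      rcases hx with hx | hx
      · exact hC R ((le_max_left _ _).trans hR) x hx hxT
      · exact hD R ((le_max_right _ _).trans hR) x hx hxT
    · intro s hs
      have hδ2 : 0 < δ / 2 := ENNReal.half_pos hδ.ne'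
      obtain ⟨R₀, hR₀⟩ := MemLp.exists_eLpNorm_compl_ball_lt (zero_lt_one.trans_le h0).ne' h1
        (h.2.1 s hs) hδ2
      refine ⟨{t | eLpNorm (fun x => f t x - f s x) p volume < δ / 2},
        (h.2.2 s hs).eventually (gt_mem_nhds hδ2), R₀, fun R hR t ht htT => ?_⟩
      have k1 : MemLp (fun x => f t x - f s x) p volume := (h.2.1 t htT).sub (h.2.1 s hs)
      have k2 := eLpNorm_add_le (μ := volume.restrict (Metric.ball (0 : E3) R)ᶜ) k1.1.restrict
        (h.2.1 s hs).1.restrict h0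
      have e : (fun x => f t x - f s x) + f s = f t := by ext x; simp
      rw [e] at k2
      refine k2.trans ((add_le_add ((eLpNorm_mono_measure _ Measure.restrict_le_self).trans
        (le_of_lt ht)) (hR₀ R hR).le).trans_eq (ENNReal.add_halves δ))
  exact key.imp fun R₀ h R hR t ht => h R hR t ht ht

lemma ContLp.exists_tail_integral {T : ℝ} {n : ℕ} {f : ℝ → E3 → F} (h : ContLp T n f) (hn : 1 ≤ n)
    {δ : ℝ} (hδ : 0 < δ) :
    ∃ R₀ : ℝ, ∀ R ≥ R₀, ∀ t ∈ Icc 0 T, ∫ x in (Metric.ball (0 : E3) R)ᶜ, ‖f t x‖ ^ n ≤ δ := by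
  -- The n-th root of δ, so that the bound on the norm becomes δ for the integral.
  obtain ⟨C, hC⟩ : ∃ C : ℝ≥0, C = δ.toNNReal ^ (1 / (n : ℝ)) := ⟨_, rfl⟩
  have n0 : (0 : ℝ) < n := by exact_mod_cast hn
  have C0 : 0 < C := by rw [hC]; exact NNReal.rpow_pos (Real.toNNReal_pos.2 hδ)
  have hn' : (1 : ℝ≥0∞) ≤ n := by exact_mod_cast hn
  obtain ⟨R₀, hR₀⟩ := h.exists_tail hn' (by simp) (δ := C) (by exact_mod_cast C0)
  refine ⟨R₀, fun R hR t ht => ?_⟩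
  have e : ENNReal.ofReal (n : ℝ) = n := ENNReal.ofReal_natCast n
  have := (integral_rpow_norm_le (μ := volume.restrict (Metric.ball (0 : E3) R)ᶜ) n0
    (by rw [e]; exact (h.2.1 t ht).restrict _) (by rw [e]; exact hR₀ R hR t ht)).2
  simp only [Real.rpow_natCast] at this
  refine this.trans_eq ?_
  rw [hC, NNReal.coe_rpow, Real.coe_toNNReal _ hδ.le, ← Real.rpow_natCast, ← Real.rpow_mul hδ.le,
    one_div_mul_cancel n0.ne', Real.rpow_one]

end Uniform

/-! ### Scale invariance of the cutoff gradient in L³. -/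

section CutoffEnergy

/-- The gradient is at most K/R on a ball of volume proportional to R³, so the powers of R cancel.
The bound is uniform but need not tend to zero, which is why this term must carry the small factor
of `exists_young`. -/
lemma exists_integral_fderiv_cutoff_cube_le :
    ∃ C : ℝ, ∀ R : ℝ, 0 < R → Integrable (fun x => ‖fderiv ℝ (cutoff R) x‖ ^ 3) volume ∧
      ∫ x, ‖fderiv ℝ (cutoff R) x‖ ^ 3 ≤ C := by
  obtain ⟨K, hK0, hK⟩ := exists_fderiv_cutoff_bound
  refine ⟨8 * K ^ 3 * volume.real (Metric.ball (0 : E3) 1), fun R hR => ?_⟩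
  have hc : Continuous (fun x => ‖fderiv ℝ (cutoff R) x‖ ^ 3) :=
    (((contDiff_cutoff R).continuous_fderiv (by simp)).norm).pow 3
  have hz : ∀ x ∉ Metric.closedBall (0 : E3) (2 * R), ‖fderiv ℝ (cutoff R) x‖ ^ 3 = 0 := fun x hx => by
    rw [mem_closedBall_zero_iff, not_le] at hx
    rw [fderiv_cutoff_eq_zero hR (Or.inr hx)]
    simp
  refine ⟨hc.integrable_of_hasCompactSupport
    (HasCompactSupport.intro (isCompact_closedBall (0 : E3) (2 * R)) hz), ?_⟩
  rw [← setIntegral_eq_integral_of_forall_compl_eq_zero hz]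
  have h1 : ∫ x in Metric.closedBall (0 : E3) (2 * R), ‖fderiv ℝ (cutoff R) x‖ ^ 3
      ≤ ∫ _ in Metric.closedBall (0 : E3) (2 * R), (K / R) ^ 3 := by
    refine setIntegral_mono (hc.continuousOn.integrableOn_compact (isCompact_closedBall _ _))
      (continuousOn_const.integrableOn_compact (isCompact_closedBall _ _)) fun x => ?_
    exact pow_le_pow_left₀ (norm_nonneg _) (hK R hR x) 3
  refine h1.trans_eq ?_
  rw [setIntegral_const, smul_eq_mul, measureReal_def, Measure.addHaar_closedBall _ _ (by positivity),
    ENNReal.toReal_mul, ENNReal.toReal_ofReal (by positivity), measureReal_def,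
    finrank_euclideanSpace_fin]
  field_simp
  ring

end CutoffEnergy


/-! ### Flows with controlled pressure: removal of the cutoff. -/

/-- A flow on `[0,T]` whose pressure is dominated by a power of the density and whose density is
bounded in a high Lebesgue norm. -/
structure ControlledFlow (μ lam T q γ B q₁ N : ℝ) (P ρ ρt : ℝ → E3 → ℝ) (Dρ : ℝ → E3 → E3 →L[ℝ] ℝ)
    (u ut : ℝ → E3 → E3) (Du Dut : ℝ → E3 → E3 →L[ℝ] E3)
    (D2u : ℝ → E3 → E3 →L[ℝ] E3 →L[ℝ] E3) : Prop where
  T_pos : 0 < T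
  q_gt : 3 < q
  gam : 1 ≤ γ
  expo : 4 * γ ≤ q₁
  dens : InDensityClass T q ρ Dρ ρt
  vel : InVelocityClass T q ρ u Du D2u ut Dut
  mass : MassEq T ρ ρt Dρ u Du
  momentum : MomentumEq μ lam T P ρ u Du D2u ut
  pressure : ∀ᵐ t ∂(volume.restrict (Ioo 0 T)), ∀ᵐ x, |P t x| ≤ B * ρ t x ^ γ
  density : ∀ᵐ t ∂(volume.restrict (Ioo 0 T)),
    Integrable (fun x => ρ t x ^ q₁) volume ∧ ∫ x, ρ t x ^ q₁ ≤ N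

/-- Separates the source from the cutoff errors. The source gives r^q₁ and a multiple of the energy
density; the errors carry κ, of order 1/R, or η, or the tail τ. Where the cutoff gradient is nonzero
τ must equal U⁶; elsewhere only its sign matters. -/
lemma energyRHS_le {μ lam ε B γ q₁ η C : ℝ} (hμ : 0 < μ) (hν : 0 ≤ μ + lam) (h0 : 0 < ε)
    (h1 : ε ≤ 1) (hγ : 1 ≤ γ) (hq : 4 * γ ≤ q₁) (hη : 0 < η)
    (hC : ∀ d U A : ℝ, 0 ≤ d → 0 ≤ U → d * U * A ≤ η * (A ^ 2 + d ^ 3) + C * U ^ 6)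
    {χ d r p U a κ τ : ℝ} (hχ0 : 0 ≤ χ) (hχ1 : χ ≤ 1) (hd0 : 0 ≤ d) (hd : d ≤ κ) (hr : 0 ≤ r)
    (hU : 0 ≤ U) (hp : |p| ≤ B * r ^ γ) (hτ : 0 ≤ C * τ) (hτd : d ≠ 0 → τ = U ^ 6) :
    χ * (61 / 20 * (5 / (2 * μ) * (p ^ 2 * wt ε (U ^ 2))))
      + d * (3 * |r| * U * pot ε (U ^ 2)
        + 61 / 20 * wt ε (U ^ 2) * U * (3 * |p| + 9 * (μ + (μ + lam)) * a))
    ≤ 61 / 20 * (5 / (2 * μ)) * B ^ 2 * r ^ q₁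
      + 2 * (61 / 20 * (5 / (2 * μ)) * B ^ 2) * (χ * (r * pot ε (U ^ 2)))
      + κ * (12 / ε) * (|r| + |r| ^ 3 + U ^ 6)
      + η * ((61 / 20 * (1 / ε)) ^ 2 * (18 * (B ^ 2 * (|r| + r ^ q₁))
        + 162 * (μ + (μ + lam)) ^ 2 * a ^ 2) + d ^ 3) + C * τ := by
  have w0 := wt_pos h0 h1 (U ^ 2)
  have w1 := wt_le_inv h0 h1 (U ^ 2)
  have U2 : 0 ≤ U ^ 2 := by positivity
  have p0 := zero_le_one.trans (one_le_pot h0 h1 U2)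
  have p1 := pot_le_inv h0 h1 U2
  have ar : |r| = r := abs_of_nonneg hr
  have rq := Real.rpow_nonneg hr q₁
  have psq : p ^ 2 ≤ B ^ 2 * r ^ (2 * γ) := by
    have e : (B * r ^ γ) ^ 2 = B ^ 2 * r ^ (2 * γ) := by
      rw [mul_pow, ← Real.rpow_natCast (r ^ γ), ← Real.rpow_mul hr]
      norm_num [mul_comm]
    rw [← sq_abs, ← e]
    gcongr
  have hw := rpow_mul_wt_le h0 h1 hr hγ hq U2
  have hr2 := rpow_two_mul_le hr hγ hq
  rw [ar]
  obtain ⟨c, hc⟩ : ∃ c, c = 61 / 20 * (5 / (2 * μ)) := ⟨_, rfl⟩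
  have c0 : 0 ≤ c := by rw [hc]; positivity
  obtain ⟨n, hn⟩ : ∃ n, n = μ + (μ + lam) := ⟨_, rfl⟩
  have n0 : 0 ≤ n := by rw [hn]; linarith
  obtain ⟨L, hL⟩ : ∃ L, L = 61 / 20 * (1 / ε) := ⟨_, rfl⟩
  have L0 : 0 ≤ L := by rw [hL]; positivity
  obtain ⟨w, hwd⟩ : ∃ w, w = wt ε (U ^ 2) := ⟨_, rfl⟩
  obtain ⟨φ, hφd⟩ : ∃ φ, φ = pot ε (U ^ 2) := ⟨_, rfl⟩
  rw [← hc, ← hn, ← hL, ← hφd]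
  rw [← hφd] at p0 p1 hw
  rw [← hwd] at w0 w1 hw ⊢
  have wL : 61 / 20 * w ≤ L := by rw [hL]; gcongr
  have t1 : χ * (61 / 20 * (5 / (2 * μ) * (p ^ 2 * w)))
      ≤ c * B ^ 2 * r ^ q₁ + 2 * (c * B ^ 2) * (χ * (r * φ)) := by
    have e1 : p ^ 2 * w ≤ B ^ 2 * (r ^ q₁ + 2 * (r * φ)) := by
      calc p ^ 2 * w ≤ B ^ 2 * r ^ (2 * γ) * w := by gcongr
        _ = B ^ 2 * (r ^ (2 * γ) * w) := by ring
        _ ≤ _ := by gcongr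
    have e2 : χ * (c * (p ^ 2 * w)) ≤ χ * (c * (B ^ 2 * (r ^ q₁ + 2 * (r * φ)))) := by gcongr
    have e3 : χ * (c * B ^ 2 * r ^ q₁) ≤ 1 * (c * B ^ 2 * r ^ q₁) := by gcongr
    have e4 : χ * (61 / 20 * (5 / (2 * μ) * (p ^ 2 * w))) = χ * (c * (p ^ 2 * w)) := by rw [hc]; ring
    rw [e4]
    linarith
  have t2 : d * (3 * r * U * φ) ≤ κ * (12 / ε) * (r + r ^ 3 + U ^ 6) := by
    have e1 : 3 * r * U * φ ≤ 3 * r * U * (2 / ε * (1 + U ^ 2)) := by gcongr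
    have e2 := mul_cubic_le hr U
    have e3 : 3 * r * U * (2 / ε * (1 + U ^ 2)) = 6 / ε * (r * U * (1 + U ^ 2)) := by ring
    have e4 : 6 / ε * (r * U * (1 + U ^ 2)) ≤ 6 / ε * (2 * (r + r ^ 3 + U ^ 6)) := by gcongr
    have e5 : 6 / ε * (2 * (r + r ^ 3 + U ^ 6)) = 12 / ε * (r + r ^ 3 + U ^ 6) := by ring
    have e6 : 3 * r * U * φ ≤ 12 / ε * (r + r ^ 3 + U ^ 6) := by linarith
    have e7 : 0 ≤ 3 * r * U * φ := by positivity
    have e8 := mul_le_mul hd e6 e7 (hd0.trans hd)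
    linarith
  have t3 : d * (61 / 20 * w * U * (3 * |p| + 9 * n * a))
      ≤ η * (L ^ 2 * (18 * (B ^ 2 * (r + r ^ q₁)) + 162 * n ^ 2 * a ^ 2) + d ^ 3) + C * τ := by
    have A2 : (61 / 20 * w * (3 * |p| + 9 * n * a)) ^ 2
        ≤ L ^ 2 * (18 * (B ^ 2 * (r + r ^ q₁)) + 162 * n ^ 2 * a ^ 2) := by
      rw [mul_pow]
      have f1 : (61 / 20 * w) ^ 2 ≤ L ^ 2 := by gcongr
      have f2 : (3 * |p| + 9 * n * a) ^ 2 ≤ 18 * p ^ 2 + 162 * n ^ 2 * a ^ 2 := by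
        have := sq_nonneg (3 * |p| - 9 * n * a)
        have s := sq_abs p
        linarith
      have f3 : p ^ 2 ≤ B ^ 2 * (r + r ^ q₁) := psq.trans (by gcongr)
      refine mul_le_mul f1 (f2.trans ?_) (sq_nonneg _) (sq_nonneg _)
      linarith
    by_cases hdz : d = 0
    · rw [hdz]
      have : 0 ≤ L ^ 2 * (18 * (B ^ 2 * (r + r ^ q₁)) + 162 * n ^ 2 * a ^ 2) := by positivity
      have := mul_nonneg hη.le this
      linarith
    · have := hC d U (61 / 20 * w * (3 * |p| + 9 * n * a)) hd0 hU
      have h2 := mul_le_mul_of_nonneg_left A2 hη.le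
      rw [hτd hdz]
      have e : d * (61 / 20 * w * U * (3 * |p| + 9 * n * a))
        = d * U * (61 / 20 * w * (3 * |p| + 9 * n * a)) := by ring
      rw [e]
      linarith
  linarith

namespace ControlledFlow

variable {μ lam T q γ B q₁ N : ℝ} {P ρ ρt : ℝ → E3 → ℝ} {Dρ : ℝ → E3 → E3 →L[ℝ] ℝ}
  {u ut : ℝ → E3 → E3} {Du Dut : ℝ → E3 → E3 →L[ℝ] E3} {D2u : ℝ → E3 → E3 →L[ℝ] E3 →L[ℝ] E3}

/-- `M` depends on the solution itself. This does no harm: in the estimates it only multiplies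
errors that are made arbitrarily small by the choice of η and R. -/
lemma exists_moment_bound (F : ControlledFlow μ lam T q γ B q₁ N P ρ ρt Dρ u ut Du Dut D2u) :
    ∃ M : ℝ, ∀ t ∈ Icc 0 T, Integrable (fun x => |ρ t x|) volume ∧
      Integrable (fun x => ‖u t x‖ ^ 6) volume ∧
      Integrable (fun x => ‖Du t x‖ ^ 2) volume ∧
      Integrable (fun x => |ρ t x| + |ρ t x| ^ 3 + ‖u t x‖ ^ 6) volume ∧
      ∫ x, (|ρ t x| + |ρ t x| ^ 3 + ‖u t x‖ ^ 6) ≤ M ∧ ∫ x, |ρ t x| ≤ M ∧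
      ∫ x, ‖Du t x‖ ^ 2 ≤ M := by
  obtain ⟨C1, h1⟩ := ContLp.exists_integral_pow_bound (n := 1) (by simpa using F.dens.contL1) le_rfl
  obtain ⟨C2, h2⟩ := ContLp.exists_integral_pow_bound (n := 2) (by simpa using F.dens.contL2)
    (by norm_num)
  obtain ⟨C3, h3⟩ := F.dens.contLq.exists_integral_rpow_bound (by linarith [F.q_gt])
  obtain ⟨C4, h4⟩ := ContLp.exists_integral_pow_bound (n := 6) (by simpa using F.vel.contL6)
    (by norm_num)
  obtain ⟨C5, h5⟩ := ContLp.exists_integral_pow_bound (n := 2) (by simpa using F.vel.gradL2)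
    (by norm_num)
  refine ⟨max (C1 + (C2 + C3) + C4) C5, fun t ht => ?_⟩
  obtain ⟨i1, k1⟩ := h1 t ht
  obtain ⟨i2, k2⟩ := h2 t ht
  obtain ⟨i3, k3⟩ := h3 t ht
  obtain ⟨i4, k4⟩ := h4 t ht
  obtain ⟨i5, k5⟩ := h5 t ht
  simp only [pow_one, Real.norm_eq_abs] at i1 k1 i2 k2 i3 k3
  have hc : ∀ x, |ρ t x| ^ 3 ≤ |ρ t x| ^ 2 + |ρ t x| ^ q := fun x =>
    cube_le_sq_add_rpow (abs_nonneg _) F.q_gt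
  have m3 : AEStronglyMeasurable (fun x => |ρ t x| ^ 3) volume := (F.dens.contL2.2.1 t ht).1.norm.pow 3
  have ic : Integrable (fun x => |ρ t x| ^ 3) volume :=
    (i2.add i3).mono' m3 (Eventually.of_forall fun x => by
      rw [Real.norm_of_nonneg (by positivity)]; exact hc x)
  have kc : ∫ x, |ρ t x| ^ 3 ≤ C2 + C3 := by
    have := integral_mono ic (i2.add i3) hc
    rw [integral_add' i2 i3] at this
    linarith
  have itot : Integrable (fun x => |ρ t x| + |ρ t x| ^ 3 + ‖u t x‖ ^ 6) volume := (i1.add ic).add i4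
  have ktot : ∫ x, (|ρ t x| + |ρ t x| ^ 3 + ‖u t x‖ ^ 6) ≤ C1 + (C2 + C3) + C4 := by
    rw [integral_add (f := fun x => |ρ t x| + |ρ t x| ^ 3) (i1.add ic) i4, integral_add i1 ic]
    linarith
  refine ⟨i1, i4, i5, itot, ktot.trans (le_max_left _ _), ?_, k5.trans (le_max_right _ _)⟩
  refine le_trans (integral_mono i1 itot fun x => ?_) (ktot.trans (le_max_left _ _))
  have a1 : 0 ≤ |ρ t x| ^ 3 := by positivity
  have a2 : 0 ≤ ‖u t x‖ ^ 6 := by positivity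
  simp only
  linarith

lemma integrable_initial (F : ControlledFlow μ lam T q γ B q₁ N P ρ ρt Dρ u ut Du Dut D2u) {t : ℝ}
    (ht : t ∈ Icc 0 T) : Integrable (fun x => ρ t x * (4 * (1 + ‖u t x‖ ^ 4))) volume := by
  obtain ⟨M, hM⟩ := F.exists_moment_bound
  obtain ⟨-, -, -, i, -⟩ := hM t ht
  refine (i.const_mul 4).mono' ((F.dens.contL2.2.1 t ht).1.mul
    ((((F.vel.contL6.2.1 t ht).1.norm.pow 4).const_add 1).const_mul 4))
    (Eventually.of_forall fun x => ?_)
  rw [norm_mul, Real.norm_of_nonneg (by positivity : 0 ≤ 4 * (1 + ‖u t x‖ ^ 4)), Real.norm_eq_abs]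
  have := mul_pow_four_le (abs_nonneg (ρ t x)) ‖u t x‖
  linarith

lemma integrable_energy (F : ControlledFlow μ lam T q γ B q₁ N P ρ ρt Dρ u ut Du Dut D2u) {ε : ℝ}
    (h0 : 0 < ε) (h1 : ε ≤ 1) {t : ℝ} (ht : t ∈ Icc 0 T) :
    Integrable (fun x => ρ t x * pot ε (‖u t x‖ ^ 2)) volume := by
  refine (F.integrable_initial ht).mono ((F.dens.contL2.2.1 t ht).1.mul
    ((Slice.continuous_pot h0 h1).comp_aestronglyMeasurable
      ((F.vel.contL6.2.1 t ht).1.norm.pow 2))) (Eventually.of_forall fun x => ?_)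
  have hu : 0 ≤ ‖u t x‖ ^ 2 := by positivity
  rw [norm_mul, norm_mul, Real.norm_of_nonneg (zero_le_one.trans (one_le_pot h0 h1 hu)),
    Real.norm_of_nonneg (by positivity : 0 ≤ 4 * (1 + ‖u t x‖ ^ 4))]
  have := pot_le h0 h1 hu
  rw [← pow_mul] at this
  gcongr

lemma integrable_cutoff_energy (F : ControlledFlow μ lam T q γ B q₁ N P ρ ρt Dρ u ut Du Dut D2u)
    {ε : ℝ} (h0 : 0 < ε) (h1 : ε ≤ 1) {t : ℝ} (ht : t ∈ Icc 0 T) (R : ℝ) :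
    Integrable (fun x => cutoff R x * (ρ t x * pot ε (‖u t x‖ ^ 2))) volume :=
  (F.integrable_energy h0 h1 ht).bdd_smul 1 (contDiff_cutoff R).continuous.aestronglyMeasurable
    (Eventually.of_forall fun x => by
      rw [Real.norm_of_nonneg (cutoff_nonneg R x)]; exact cutoff_le_one R x)

/-- A bound free of ε and R, so that both limits can be taken with the initial datum alone on the
right. -/
lemma cutoff_energy_zero_le (F : ControlledFlow μ lam T q γ B q₁ N P ρ ρt Dρ u ut Du Dut D2u) {ε : ℝ}
    (h0 : 0 < ε) (h1 : ε ≤ 1) (R : ℝ) :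
    ∫ x, cutoff R x * (ρ 0 x * pot ε (‖u 0 x‖ ^ 2)) ≤ ∫ x, ρ 0 x * (4 * (1 + ‖u 0 x‖ ^ 4)) := by
  have z0 : (0 : ℝ) ∈ Icc 0 T := ⟨le_rfl, F.T_pos.le⟩
  refine integral_mono_ae (F.integrable_cutoff_energy h0 h1 z0 R) (F.integrable_initial z0) ?_
  filter_upwards [F.dens.nonneg 0 z0] with x hx
  have hu : 0 ≤ ‖u 0 x‖ ^ 2 := by positivity
  have h2 := pot_le h0 h1 hu
  rw [← pow_mul] at h2
  have h3 := zero_le_one.trans (one_le_pot h0 h1 hu)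
  calc cutoff R x * (ρ 0 x * pot ε (‖u 0 x‖ ^ 2)) ≤ 1 * (ρ 0 x * pot ε (‖u 0 x‖ ^ 2)) := by
        gcongr; exact cutoff_le_one R x
    _ ≤ _ := by rw [one_mul]; gcongr

lemma _root_.CNS.MemTimeLp.ae_memLp {G : Type} [NormedAddCommGroup G] {T : ℝ} {f : ℝ → E3 → G}
    (h : MemTimeLp T 2 6 f) : ∀ᵐ t ∂(volume.restrict (Ioo 0 T)), MemLp (f t) 6 volume := by
  obtain ⟨hm, hn⟩ := h
  rw [Measure.volume_eq_prod, ← Measure.prod_restrict, Measure.restrict_univ] at hm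
  rw [timeNorm, eLpNorm_lt_top_iff_lintegral_rpow_enorm_lt_top (by norm_num) (by norm_num)] at hn
  simp only [enorm_eq_self] at hn
  have hmeas : AEMeasurable (fun t => eLpNorm (f t) 6 volume) (volume.restrict (Ioo 0 T)) := by
    have := (hm.enorm.pow_const (6 : ℝ≥0∞).toReal).lintegral_prod_right'
    refine (this.pow_const (1 / (6 : ℝ≥0∞).toReal)).congr (Eventually.of_forall fun t => ?_)
    simp only
    rw [eLpNorm_eq_lintegral_rpow_enorm_toReal (by norm_num) (by norm_num)]
    rfl
  filter_upwards [ae_lt_top' (hmeas.pow_const _) hn.ne, hm.prodMk_left] with t h1 h2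
  refine ⟨h2, ?_⟩
  by_contra hc
  rw [not_lt, top_le_iff] at hc
  rw [hc] at h1
  norm_num at h1

/-- By Fubini the equations hold at almost every time. The pressure is in L² because P² ≤ B²ρ^{2γ} ≤
B²(ρ + ρ^{q₁}). -/
lemma exists_ae_slice (F : ControlledFlow μ lam T q γ B q₁ N P ρ ρt Dρ u ut Du Dut D2u) :
    ∃ DP : ℝ → E3 → E3 →L[ℝ] ℝ, ∀ᵐ t ∂(volume.restrict (Ioo 0 T)),
      Slice μ lam (ρ t) (ρt t) (P t) (Dρ t) (DP t) (u t) (ut t) (Du t) (D2u t) := by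
  obtain ⟨DP, hw, heq⟩ := F.momentum
  refine ⟨DP, ?_⟩
  have conv : ∀ {p : ℝ × E3 → Prop},
      (∀ᵐ z ∂(volume.restrict (Ioc 0 T ×ˢ (univ : Set E3))), p z) →
      ∀ᵐ t ∂(volume.restrict (Ioo 0 T)), ∀ᵐ x, p (t, x) := fun h => by
    rw [Measure.volume_eq_prod, ← Measure.prod_restrict, Measure.restrict_univ,
      ← restrict_Ioo_eq_restrict_Ioc] at h
    exact Measure.ae_ae_of_ae_prod h
  filter_upwards [conv heq, conv F.mass, F.vel.timeL6.ae_memLp, F.pressure, F.density,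
    ae_restrict_mem measurableSet_Ioo] with t k1 k2 k3 k4 k5 ht
  have ht' := Ioo_subset_Icc_self ht
  refine ⟨F.dens.weakGrad t ht', F.dens.contL2.2.1 t ht', F.dens.gradL2.2.1 t ht',
    F.vel.weakGrad t ht', F.vel.weakHess t ht', F.vel.contL6.2.1 t ht', F.vel.gradL2.2.1 t ht',
    F.vel.hessL2.2.1 t ht', k3, hw t ht', ?_, k2, k1⟩
  have Pm := (hw t ht').1.aestronglyMeasurable
  refine (memLp_two_iff_integrable_sq Pm).2 ?_
  obtain ⟨M, hM⟩ := F.exists_moment_bound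
  refine (((hM t ht').1.add k5.1).const_mul (B ^ 2)).mono' (Pm.pow 2) ?_
  filter_upwards [k4, F.dens.nonneg t ht'] with x hx hx0
  rw [Real.norm_of_nonneg (by positivity), Pi.add_apply, abs_of_nonneg hx0]
  have e : (B * ρ t x ^ γ) ^ 2 = B ^ 2 * ρ t x ^ (2 * γ) := by
    rw [mul_pow, ← Real.rpow_natCast (ρ t x ^ γ), ← Real.rpow_mul hx0]
    norm_num [mul_comm]
  calc P t x ^ 2 = |P t x| ^ 2 := (sq_abs _).symm
    _ ≤ (B * ρ t x ^ γ) ^ 2 := by gcongr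
    _ = B ^ 2 * ρ t x ^ (2 * γ) := e
    _ ≤ _ := by gcongr; exact rpow_two_mul_le hx0 F.gam F.expo

end ControlledFlow

namespace ControlledFlow

variable {μ lam T q γ B q₁ N : ℝ} {P ρ ρt : ℝ → E3 → ℝ} {Dρ : ℝ → E3 → E3 →L[ℝ] ℝ}
  {u ut : ℝ → E3 → E3} {Du Dut : ℝ → E3 → E3 →L[ℝ] E3} {D2u : ℝ → E3 → E3 →L[ℝ] E3 →L[ℝ] E3}

/-- The three cutoff errors receive δ/3 each. Only the bound N on the density enters the limiting
constant; R₀ may depend on ε and on the solution. -/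
lemma exists_energyRHS_le (F : ControlledFlow μ lam T q γ B q₁ N P ρ ρt Dρ u ut Du Dut D2u)
    (hμ : 0 < μ) (hν : 0 ≤ μ + lam) {ε δ : ℝ} (h0 : 0 < ε) (h1 : ε ≤ 1) (hδ : 0 < δ) :
    ∃ R₀ : ℝ, 0 < R₀ ∧ ∀ R ≥ R₀, ∀ᵐ t ∂(volume.restrict (Ioo 0 T)),
      ∫ x, energyRHS μ lam ε (cutoff R) (ρ t) (P t) (u t) (Du t) x
        ≤ 2 * (61 / 20 * (5 / (2 * μ)) * B ^ 2) * (∫ x, cutoff R x * (ρ t x * pot ε (‖u t x‖ ^ 2)))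
          + (61 / 20 * (5 / (2 * μ)) * B ^ 2 * N + δ) := by
  obtain ⟨M, hM⟩ := F.exists_moment_bound
  obtain ⟨K, hK0, hK⟩ := exists_fderiv_cutoff_bound
  obtain ⟨C3, hC3⟩ := exists_integral_fderiv_cutoff_cube_le
  obtain ⟨L, hL⟩ : ∃ L, L = (61 / 20 * (1 / ε)) ^ 2 := ⟨_, rfl⟩
  obtain ⟨n, hn⟩ : ∃ n, n = 162 * (μ + (μ + lam)) ^ 2 := ⟨_, rfl⟩
  obtain ⟨c, hc⟩ : ∃ c, c = 61 / 20 * (5 / (2 * μ)) * B ^ 2 := ⟨_, rfl⟩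
  obtain ⟨G, hG⟩ : ∃ G, G = L * (18 * (B ^ 2 * (M + N)) + n * M) + C3 := ⟨_, rfl⟩
  have L0 : 0 ≤ L := by rw [hL]; positivity
  have n0 : 0 ≤ n := by rw [hn]; positivity
  have c0 : 0 ≤ c := by rw [hc]; positivity
  -- The order matters: `G` does not depend on R, so η is fixed first, then the Young constant `C`
  -- belonging to η, and only then R, large enough to make the L⁶ tail small against `C`.
  obtain ⟨η, hη⟩ : ∃ η, η = δ / (3 * (|G| + 1)) := ⟨_, rfl⟩
  have η0 : 0 < η := by rw [hη]; positivity
  have ηG : η * G ≤ δ / 3 := by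
    calc η * G ≤ η * (|G| + 1) := by
          gcongr; linarith [le_abs_self G]
      _ = δ / 3 := by rw [hη]; field_simp
  obtain ⟨C, C0, hC⟩ := exists_young η0
  have hτ0 : 0 < δ / (3 * (C + 1)) := by positivity
  obtain ⟨R₁, hR₁⟩ := ContLp.exists_tail_integral (n := 6) (f := u) (T := T)
    (by simpa using F.vel.contL6) (by norm_num) hτ0
  have hR₂ : 0 < K * (12 / ε) * (|M| + 1) * (3 / δ) := by positivity
  refine ⟨max R₁ (K * (12 / ε) * (|M| + 1) * (3 / δ)), hR₂.trans_le (le_max_right _ _),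
    fun R hR => ?_⟩
  have R0 : 0 < R := hR₂.trans_le ((le_max_right _ _).trans hR)
  have κM : K / R * (12 / ε) * M ≤ δ / 3 := by
    have hRR := (le_max_right _ _).trans hR
    have e1 : K / R * (12 / ε) * M ≤ K / R * (12 / ε) * (|M| + 1) := by
      gcongr; linarith [le_abs_self M]
    have e2 : K / R * (12 / ε) * (|M| + 1) = K * (12 / ε) * (|M| + 1) / R := by ring
    have e3 : K * (12 / ε) * (|M| + 1) / R ≤ δ / 3 := by
      rw [div_le_iff₀ R0]
      have := mul_le_mul_of_nonneg_right hRR (by positivity : 0 ≤ δ / 3)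
      have e4 : K * (12 / ε) * (|M| + 1) * (3 / δ) * (δ / 3) = K * (12 / ε) * (|M| + 1) := by
        field_simp
      linarith
    linarith
  obtain ⟨DP, hS⟩ := F.exists_ae_slice
  filter_upwards [hS, F.pressure, F.density, ae_restrict_mem measurableSet_Ioo] with t S hp hd ht
  have ht' := Ioo_subset_Icc_self ht
  obtain ⟨iρ, iu, iD, im, hm, hρ, hD⟩ := hM t ht'
  obtain ⟨ic, hc3⟩ := hC3 R R0
  have hE := S.integrable_energyRHS hμ hν h0 h1 (contDiff_cutoff R) (hasCompactSupport_cutoff R0)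
  have iI := F.integrable_cutoff_energy h0 h1 ht' R
  have itau : Integrable ((Metric.ball (0 : E3) R)ᶜ.indicator fun x => ‖u t x‖ ^ 6) volume :=
    iu.indicator measurableSet_ball.compl
  have tail : ∫ x, (Metric.ball (0 : E3) R)ᶜ.indicator (fun x => ‖u t x‖ ^ 6) x
      ≤ δ / (3 * (C + 1)) := by
    rw [integral_indicator measurableSet_ball.compl]
    exact hR₁ R ((le_max_left _ _).trans hR) t ht'
  have f1 : Integrable (fun x => c * ρ t x ^ q₁) volume := hd.1.const_mul c
  have f2 : Integrable (fun x => 2 * c * (cutoff R x * (ρ t x * pot ε (‖u t x‖ ^ 2)))) volume :=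
    iI.const_mul (2 * c)
  have f3 : Integrable (fun x => K / R * (12 / ε) * (|ρ t x| + |ρ t x| ^ 3 + ‖u t x‖ ^ 6)) volume :=
    im.const_mul _
  have f4a : Integrable (fun x => 18 * (B ^ 2 * (|ρ t x| + ρ t x ^ q₁))) volume :=
    ((iρ.add hd.1).const_mul (B ^ 2)).const_mul 18
  have f4b : Integrable (fun x => n * ‖Du t x‖ ^ 2) volume := iD.const_mul n
  have f4c : Integrable (fun x => L * (18 * (B ^ 2 * (|ρ t x| + ρ t x ^ q₁)) + n * ‖Du t x‖ ^ 2))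
    volume := (f4a.add f4b).const_mul L
  have f4d : Integrable (fun x => L * (18 * (B ^ 2 * (|ρ t x| + ρ t x ^ q₁)) + n * ‖Du t x‖ ^ 2)
    + ‖fderiv ℝ (cutoff R) x‖ ^ 3) volume := f4c.add ic
  have f4 : Integrable (fun x => η * (L * (18 * (B ^ 2 * (|ρ t x| + ρ t x ^ q₁)) + n * ‖Du t x‖ ^ 2)
    + ‖fderiv ℝ (cutoff R) x‖ ^ 3)) volume := f4d.const_mul η
  have f5 : Integrable (fun x => C * (Metric.ball (0 : E3) R)ᶜ.indicator (fun x => ‖u t x‖ ^ 6) x)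
    volume := itau.const_mul C
  have g12 : Integrable (fun x => c * ρ t x ^ q₁
    + 2 * c * (cutoff R x * (ρ t x * pot ε (‖u t x‖ ^ 2)))) volume := f1.add f2
  have g123 : Integrable (fun x => c * ρ t x ^ q₁
    + 2 * c * (cutoff R x * (ρ t x * pot ε (‖u t x‖ ^ 2)))
    + K / R * (12 / ε) * (|ρ t x| + |ρ t x| ^ 3 + ‖u t x‖ ^ 6)) volume := g12.add f3
  have g1234 : Integrable (fun x => c * ρ t x ^ q₁
    + 2 * c * (cutoff R x * (ρ t x * pot ε (‖u t x‖ ^ 2)))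
    + K / R * (12 / ε) * (|ρ t x| + |ρ t x| ^ 3 + ‖u t x‖ ^ 6)
    + η * (L * (18 * (B ^ 2 * (|ρ t x| + ρ t x ^ q₁)) + n * ‖Du t x‖ ^ 2)
      + ‖fderiv ℝ (cutoff R) x‖ ^ 3)) volume := g123.add f4
  have key := integral_mono_ae hE (g1234.add f5) (by
    filter_upwards [hp, F.dens.nonneg t ht'] with x hx hx0
    rw [energyRHS]
    have := energyRHS_le hμ hν h0 h1 F.gam F.expo η0 hC (B := B) (p := P t x) (a := ‖Du t x‖)
      (U := ‖u t x‖) (κ := K / R) (d := ‖fderiv ℝ (cutoff R) x‖)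
      (τ := (Metric.ball (0 : E3) R)ᶜ.indicator (fun x => ‖u t x‖ ^ 6) x)
      (cutoff_nonneg R x) (cutoff_le_one R x) (norm_nonneg _) (hK R R0 x) hx0 (norm_nonneg _) hx (mul_nonneg C0 (indicator_nonneg (fun _ _ => by positivity) _))
      (fun hdx => by
        rw [indicator_of_mem]
        rw [mem_compl_iff, mem_ball_zero_iff]
        intro hlt
        exact hdx (by rw [fderiv_cutoff_eq_zero R0 (Or.inl hlt), norm_zero]))
    rw [← hc, ← hL, ← hn] at this
    exact this)
  rw [integral_add' g1234 f5, integral_add g123 f4, integral_add g12 f3, integral_add f1 f2,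
    integral_const_mul, integral_const_mul, integral_const_mul, integral_const_mul,
    integral_const_mul, integral_add f4c ic, integral_const_mul, integral_add f4a f4b,
    integral_const_mul, integral_const_mul, integral_const_mul, integral_add iρ hd.1] at key
  have b1 : c * ∫ x, ρ t x ^ q₁ ≤ c * N := by gcongr; exact hd.2
  have b3 : K / R * (12 / ε) * ∫ x, (|ρ t x| + |ρ t x| ^ 3 + ‖u t x‖ ^ 6) ≤ δ / 3 :=
    le_trans (by gcongr) κM
  have b4 : η * (L * (18 * (B ^ 2 * ((∫ x, |ρ t x|) + ∫ x, ρ t x ^ q₁)) + n * ∫ x, ‖Du t x‖ ^ 2)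
      + ∫ x, ‖fderiv ℝ (cutoff R) x‖ ^ 3) ≤ δ / 3 := by
    refine le_trans ?_ ηG
    rw [hG]
    gcongr
    exact hd.2
  have b5 : C * ∫ x, (Metric.ball (0 : E3) R)ᶜ.indicator (fun x => ‖u t x‖ ^ 6) x ≤ δ / 3 := by
    calc _ ≤ C * (δ / (3 * (C + 1))) := by gcongr
      _ ≤ (C + 1) * (δ / (3 * (C + 1))) := by gcongr; linarith
      _ = δ / 3 := by field_simp
  rw [← hc]
  linarith

/-- Gronwall's lemma applied to the cutoff energy: its rate is bounded at almost every time by the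
spatial estimate, with coefficients free of ε and R apart from δ. -/
lemma exists_cutoff_energy_le (F : ControlledFlow μ lam T q γ B q₁ N P ρ ρt Dρ u ut Du Dut D2u)
    (hμ : 0 < μ) (hphys : 0 ≤ 2 * μ + 3 * lam) (hvisc : lam < 29 * μ / 3) (hN : 0 ≤ N)
    {ε δ : ℝ} (h0 : 0 < ε) (h1 : ε ≤ 1) (hδ : 0 < δ) :
    ∃ R₀ : ℝ, ∀ R ≥ R₀, ∀ t ∈ Icc 0 T, ∫ x, cutoff R x * (ρ t x * pot ε (‖u t x‖ ^ 2))
      ≤ Real.exp (2 * (61 / 20 * (5 / (2 * μ)) * B ^ 2) * t) *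
        ((∫ x, ρ 0 x * (4 * (1 + ‖u 0 x‖ ^ 4)))
          + (61 / 20 * (5 / (2 * μ)) * B ^ 2 * N + δ) * t) := by
  obtain ⟨R₀, hR₀, h⟩ := F.exists_energyRHS_le hμ (by linarith) h0 h1 hδ
  refine ⟨R₀, fun R hR t ht => ?_⟩
  have R0 : 0 < R := hR₀.trans_le hR
  obtain ⟨hJ, hI⟩ := integral_energy_eq F.T_pos h0 h1 F.q_gt F.dens.contL2 F.dens.contLq
    F.dens.weakTime F.dens.timeL2 F.vel.contL6 F.vel.weakTime F.vel.timeL6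
    (contDiff_cutoff R).continuous (hasCompactSupport_cutoff R0)
  have z0 : (0 : ℝ) ∈ Icc 0 T := ⟨le_rfl, F.T_pos.le⟩
  obtain ⟨DP, hS⟩ := F.exists_ae_slice
  have gr := le_of_integral_rate_le (T := T)
    (a := 2 * (61 / 20 * (5 / (2 * μ)) * B ^ 2)) (b := 61 / 20 * (5 / (2 * μ)) * B ^ 2 * N + δ)
    (I := fun t => ∫ x, cutoff R x * (ρ t x * pot ε (‖u t x‖ ^ 2))) (by positivity)
    (by positivity) hJ (fun s hs => by
      rw [← hI s hs]
      simp only [mul_sub]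
      rw [integral_sub (F.integrable_cutoff_energy h0 h1 hs R)
        (F.integrable_cutoff_energy h0 h1 z0 R)]
      ring) (by
      filter_upwards [h R hR, hS] with s hs S
      exact (S.integral_le_energyRHS hμ hphys hvisc h0 h1 (contDiff_cutoff R)
        (hasCompactSupport_cutoff R0) (cutoff_nonneg R)).trans hs) ht
  refine gr.trans ?_
  have hz := F.cutoff_energy_zero_le h0 h1 R
  exact mul_le_mul_of_nonneg_left (by linarith) (Real.exp_pos _).le

/-- The `r`-th velocity moment, `r = 61/20`, is controlled by its initial value. -/
theorem integral_moment_le (F : ControlledFlow μ lam T q γ B q₁ N P ρ ρt Dρ u ut Du Dut D2u)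
    (hμ : 0 < μ) (hphys : 0 ≤ 2 * μ + 3 * lam) (hvisc : lam < 29 * μ / 3) (hN : 0 ≤ N)
    {t : ℝ} (ht : t ∈ Icc 0 T) :
    Integrable (fun x => ρ t x * ‖u t x‖ ^ (61 / 20 : ℝ)) volume ∧
    ∫ x, ρ t x * ‖u t x‖ ^ (61 / 20 : ℝ)
      ≤ Real.exp (2 * (61 / 20 * (5 / (2 * μ)) * B ^ 2) * t) *
        ((∫ x, ρ 0 x * (4 * (1 + ‖u 0 x‖ ^ 4))) + 61 / 20 * (5 / (2 * μ)) * B ^ 2 * N * t) := by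
  obtain ⟨a, ha⟩ : ∃ a, a = Real.exp (2 * (61 / 20 * (5 / (2 * μ)) * B ^ 2) * t) := ⟨_, rfl⟩
  obtain ⟨b, hb⟩ : ∃ b, b = 61 / 20 * (5 / (2 * μ)) * B ^ 2 * N := ⟨_, rfl⟩
  obtain ⟨E₀, hE₀⟩ : ∃ E, E = ∫ x, ρ 0 x * (4 * (1 + ‖u 0 x‖ ^ 4)) := ⟨_, rfl⟩
  -- A single sequence drives all limits: ε_n is both the truncation parameter and the admitted
  -- error δ, and R_n ≥ n + 1 makes the cutoff eventually 1 at each point.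
  obtain ⟨ε, hε⟩ : ∃ ε : ℕ → ℝ, ε = fun n : ℕ => 1 / ((n : ℝ) + 1) := ⟨_, rfl⟩
  have e0 : ∀ n, 0 < ε n := fun n => by rw [hε]; positivity
  have e1 : ∀ n, ε n ≤ 1 := fun n => by
    rw [hε]; simp only; rw [div_le_one (by positivity)]; linarith [(Nat.cast_nonneg n : (0 : ℝ) ≤ n)]
  have elim : Tendsto ε atTop (𝓝 0) := by rw [hε]; exact tendsto_one_div_add_atTop_nhds_zero_nat
  have hR : ∀ n : ℕ, ∃ R : ℝ, (n : ℝ) + 1 ≤ R ∧ ∫ x, cutoff R x * (ρ t x * pot (ε n) (‖u t x‖ ^ 2))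
      ≤ a * (E₀ + (b + ε n) * t) := fun n => by
    obtain ⟨R₀, h⟩ := F.exists_cutoff_energy_le hμ hphys hvisc hN (e0 n) (e1 n) (e0 n)
    refine ⟨max R₀ (n + 1), le_max_right _ _, ?_⟩
    rw [ha, hb, hE₀]
    exact h _ (le_max_left _ _) t ht
  choose R hRn hRe using hR
  obtain ⟨f, hf⟩ : ∃ f : ℕ → E3 → ℝ, f = fun n x =>
    cutoff (R n) x * (ρ t x * pot (ε n) (‖u t x‖ ^ 2)) := ⟨_, rfl⟩
  have fi : ∀ n, Integrable (f n) volume := fun n => by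
    rw [hf]; exact F.integrable_cutoff_energy (e0 n) (e1 n) ht (R n)
  have f0 : ∀ n, 0 ≤ᵐ[volume] f n := fun n => by
    filter_upwards [F.dens.nonneg t ht] with x hx
    rw [hf]
    exact mul_nonneg (cutoff_nonneg _ _) (mul_nonneg hx
      (zero_le_one.trans (one_le_pot (e0 n) (e1 n) (by positivity))))
  -- The lower bound by wbase^(61/80) converges to (1 + |u|⁴)^(61/80), which is at least
  -- |u|^(61/20); Fatou's lemma then transfers the bound to the moment.
  have lower : ∀ᵐ x, ENNReal.ofReal (ρ t x * ‖u t x‖ ^ (61 / 20 : ℝ))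
      ≤ liminf (fun n => ENNReal.ofReal (f n x)) atTop := by
    filter_upwards [F.dens.nonneg t ht] with x hx
    have hw : Tendsto (fun n => wbase (ε n) (‖u t x‖ ^ 2) ^ (61 / 80 : ℝ)) atTop
        (𝓝 ((1 + (‖u t x‖ ^ 2) ^ 2) ^ (61 / 80 : ℝ))) := by
      have : Tendsto (fun n => wbase (ε n) (‖u t x‖ ^ 2)) atTop (𝓝 (1 + (‖u t x‖ ^ 2) ^ 2)) := by
        have h2 := (tendsto_const_nhds (x := 1 + (‖u t x‖ ^ 2) ^ 2)).div
          ((elim.mul_const ((‖u t x‖ ^ 2) ^ 2)).const_add 1) (by norm_num)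
        simp only [zero_mul, add_zero, div_one] at h2
        exact h2
      exact this.rpow_const (Or.inr (by norm_num))
    have hlim : Tendsto (fun n => ENNReal.ofReal (ρ t x * wbase (ε n) (‖u t x‖ ^ 2) ^ (61 / 80 : ℝ)))
        atTop (𝓝 (ENNReal.ofReal (ρ t x * (1 + (‖u t x‖ ^ 2) ^ 2) ^ (61 / 80 : ℝ)))) :=
      ENNReal.tendsto_ofReal (hw.const_mul _)
    have hle : ENNReal.ofReal (ρ t x * ‖u t x‖ ^ (61 / 20 : ℝ))
        ≤ ENNReal.ofReal (ρ t x * (1 + (‖u t x‖ ^ 2) ^ 2) ^ (61 / 80 : ℝ)) := by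
      refine ENNReal.ofReal_le_ofReal (mul_le_mul_of_nonneg_left ?_ hx)
      have e : ‖u t x‖ ^ (61 / 20 : ℝ) = ((‖u t x‖ ^ 2) ^ 2) ^ (61 / 80 : ℝ) := by
        rw [← pow_mul, ← Real.rpow_natCast, ← Real.rpow_mul (norm_nonneg _)]
        norm_num
      rw [e]
      exact Real.rpow_le_rpow (by positivity) (by linarith) (by norm_num)
    rw [← hlim.liminf_eq] at hle
    refine hle.trans (liminf_le_liminf ?_)
    obtain ⟨k, hk⟩ := exists_nat_ge ‖x‖
    filter_upwards [eventually_ge_atTop k] with n hn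
    refine ENNReal.ofReal_le_ofReal ?_
    have nk : (k : ℝ) ≤ n := by exact_mod_cast hn
    have Rn := hRn n
    have R0 : 0 < R n := by linarith [(Nat.cast_nonneg n : (0 : ℝ) ≤ n)]
    rw [hf]
    simp only
    rw [cutoff_eq_one R0 (by linarith), one_mul]
    exact mul_le_mul_of_nonneg_left (pot_ge (e0 n) (e1 n) (by positivity)) hx
  have upper : liminf (fun n => ∫⁻ x, ENNReal.ofReal (f n x)) atTop
      ≤ ENNReal.ofReal (a * (E₀ + b * t)) := by
    have hlim : Tendsto (fun n => ENNReal.ofReal (a * (E₀ + (b + ε n) * t))) atTop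
        (𝓝 (ENNReal.ofReal (a * (E₀ + b * t)))) := by
      refine ENNReal.tendsto_ofReal ?_
      have := (((elim.const_add b).mul_const t).const_add E₀).const_mul a
      rwa [add_zero] at this
    rw [← hlim.liminf_eq]
    refine liminf_le_liminf (Eventually.of_forall fun n => ?_)
    rw [← ofReal_integral_eq_lintegral_ofReal (fi n) (f0 n)]
    refine ENNReal.ofReal_le_ofReal ?_
    rw [hf]
    exact hRe n
  have fatou : ∫⁻ x, ENNReal.ofReal (ρ t x * ‖u t x‖ ^ (61 / 20 : ℝ))
      ≤ ENNReal.ofReal (a * (E₀ + b * t)) :=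
    ((lintegral_mono_ae lower).trans (lintegral_liminf_le'
      fun n => (fi n).1.aemeasurable.ennreal_ofReal)).trans upper
  have hm : AEStronglyMeasurable (fun x => ρ t x * ‖u t x‖ ^ (61 / 20 : ℝ)) volume :=
    (F.dens.contL2.2.1 t ht).1.mul
      ((F.vel.contL6.2.1 t ht).1.norm.aemeasurable.pow_const _).aestronglyMeasurable
  have hnn : 0 ≤ᵐ[volume] fun x => ρ t x * ‖u t x‖ ^ (61 / 20 : ℝ) := by
    filter_upwards [F.dens.nonneg t ht] with x hx
    exact mul_nonneg hx (by positivity)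
  have E0 : 0 ≤ E₀ := by
    rw [hE₀]
    refine integral_nonneg_of_ae ?_
    filter_upwards [F.dens.nonneg 0 ⟨le_rfl, F.T_pos.le⟩] with x hx
    exact mul_nonneg hx (by positivity)
  have rhs0 : 0 ≤ a * (E₀ + b * t) := by
    have := ht.1
    rw [ha, hb]
    positivity
  refine ⟨⟨hm, ?_⟩, ?_⟩
  · rw [hasFiniteIntegral_iff_ofReal hnn]
    exact fatou.trans_lt ENNReal.ofReal_lt_top
  · rw [integral_eq_lintegral_of_nonneg_ae hnn hm, ← ha, ← hb, ← hE₀]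
    exact ENNReal.toReal_le_of_le_ofReal rhs0 fatou

end ControlledFlow

/-! ### From the norm hypotheses to controlled flows, and conclusion. -/

lemma ae_eLpNorm_le_of_timeNorm_top {F : Type} [NormedAddCommGroup F] {T : ℝ} {p M : ℝ≥0∞}
    {f : ℝ → E3 → F} (h : timeNorm T ⊤ p f ≤ M) :
    ∀ᵐ t ∂(volume.restrict (Ioo 0 T)), eLpNorm (f t) p volume ≤ M := by
  rw [timeNorm, eLpNorm_exponent_top] at h
  filter_upwards [enorm_ae_le_eLpNormEssSup (fun t => eLpNorm (f t) p volume)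
    (volume.restrict (Ioo 0 T))] with t ht
  rw [enorm_eq_self] at ht
  exact ht.trans h

lemma InDensityClass.ae_integral_rpow_le {T T' q q₁ : ℝ} {ρ ρt : ℝ → E3 → ℝ}
    {Dρ : ℝ → E3 → E3 →L[ℝ] ℝ} (D : InDensityClass T q ρ Dρ ρt) (hT : T ≤ T') (hq₁ : 0 < q₁)
    {M : ℝ≥0} (h : timeNorm T' ⊤ (ENNReal.ofReal q₁) ρ ≤ M) :
    ∀ᵐ t ∂(volume.restrict (Ioo 0 T)),
      Integrable (fun x => ρ t x ^ q₁) volume ∧ ∫ x, ρ t x ^ q₁ ≤ (M : ℝ) ^ q₁ := by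
  have h' := (ae_eLpNorm_le_of_timeNorm_top h).filter_mono
    (ae_mono (Measure.restrict_mono_set volume (show Ioo 0 T ⊆ Ioo 0 T' from Ioo_subset_Ioo_right hT)))
  filter_upwards [h', ae_restrict_mem measurableSet_Ioo] with t ht htT
  have htT' := Ioo_subset_Icc_self htT
  obtain ⟨i, k⟩ := integral_rpow_norm_le hq₁
    ⟨(D.contL2.2.1 t htT').1, ht.trans_lt ENNReal.coe_lt_top⟩ ht
  have e : (fun x => ‖ρ t x‖ ^ q₁) =ᵐ[volume] fun x => ρ t x ^ q₁ := by
    filter_upwards [D.nonneg t htT'] with x hx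
    rw [Real.norm_of_nonneg hx]
  exact ⟨i.congr e, (integral_congr_ae e).symm.le.trans k⟩

lemma moment_constant_mono {a b E t T : ℝ} (ha : 0 ≤ a) (hb : 0 ≤ b) (hE : 0 ≤ E) (ht : 0 ≤ t)
    (htT : t ≤ T) : Real.exp (a * t) * (E + b * t) ≤ Real.exp (a * T) * (E + b * T) := by
  gcongr

lemma ControlledFlow.integral_moment_le_of_initial {μ lam T T' q γ B q₁ N : ℝ}
    {P ρ ρt : ℝ → E3 → ℝ} {Dρ : ℝ → E3 → E3 →L[ℝ] ℝ} {u ut : ℝ → E3 → E3}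
    {Du Dut : ℝ → E3 → E3 →L[ℝ] E3} {D2u : ℝ → E3 → E3 →L[ℝ] E3 →L[ℝ] E3} {ρ₀ : E3 → ℝ}
    {u₀ : E3 → E3} (F : ControlledFlow μ lam T q γ B q₁ N P ρ ρt Dρ u ut Du Dut D2u)
    (hμ : 0 < μ) (hphys : 0 ≤ 2 * μ + 3 * lam) (hvisc : lam < 29 * μ / 3) (hN : 0 ≤ N)
    (hρ₀ : ρ 0 =ᵐ[volume] ρ₀) (hu₀ : u 0 =ᵐ[volume] u₀) (hT : T ≤ T') {t : ℝ} (ht : t ∈ Icc 0 T) :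
    Integrable (fun x => ρ t x * ‖u t x‖ ^ (61 / 20 : ℝ)) volume ∧
    ∫ x, ρ t x * ‖u t x‖ ^ (61 / 20 : ℝ)
      ≤ Real.exp (2 * (61 / 20 * (5 / (2 * μ)) * B ^ 2) * T') *
        ((∫ x, ρ₀ x * (4 * (1 + ‖u₀ x‖ ^ 4))) + 61 / 20 * (5 / (2 * μ)) * B ^ 2 * N * T') := by
  obtain ⟨h1, h2⟩ := F.integral_moment_le hμ hphys hvisc hN ht
  have e : ∫ x, ρ 0 x * (4 * (1 + ‖u 0 x‖ ^ 4)) = ∫ x, ρ₀ x * (4 * (1 + ‖u₀ x‖ ^ 4)) := by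
    refine integral_congr_ae ?_
    filter_upwards [hρ₀, hu₀] with x hx1 hx2
    rw [hx1, hx2]
  have E0 : 0 ≤ ∫ x, ρ₀ x * (4 * (1 + ‖u₀ x‖ ^ 4)) := by
    rw [← e]
    refine integral_nonneg_of_ae ?_
    filter_upwards [F.dens.nonneg 0 ⟨le_rfl, F.T_pos.le⟩] with x hx
    exact mul_nonneg hx (by positivity)
  rw [e] at h2
  exact ⟨h1, h2.trans (moment_constant_mono (by positivity) (by positivity) E0 ht.1
    (ht.2.trans hT))⟩

end CNS

theorem lemma3p1 (μ lam : ℝ) (hμ : 0 < μ) (hphys : 0 ≤ 2 * μ + 3 * lam)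
    (hvisc : lam < 29 * μ / 3) :
    ∃ r : ℝ, 3 < r ∧ r < 7 / 2 ∧
      -- the isentropic system
      (∀ γ : ℝ, 1 < γ → ∃ Q : ℝ, 1 < Q ∧ ∀ q₁ : ℝ, Q ≤ q₁ →
        ∀ (ρ₀ : CNS.E3 → ℝ) (u₀ : CNS.E3 → CNS.E3), CNS.IsInitialDatum μ lam γ ρ₀ u₀ →
        ∀ Tstar : ℝ, 0 < Tstar → ∀ M : ℝ≥0, ∃ C : ℝ,
        ∀ (ρ : ℝ → CNS.E3 → ℝ) (u : ℝ → CNS.E3 → CNS.E3),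
          (∀ T : ℝ, 0 < T → T < Tstar → CNS.IsStrongSolution μ lam γ T ρ u) →
          ρ 0 =ᵐ[volume] ρ₀ → u 0 =ᵐ[volume] u₀ →
          CNS.timeNorm Tstar ⊤ (ENNReal.ofReal q₁) ρ ≤ (M : ℝ≥0∞) →
          ∀ T : ℝ, 0 ≤ T → T < Tstar → ∀ t ∈ Icc 0 T,
            Integrable (fun x => ρ t x * ‖u t x‖ ^ r) volume ∧
            ∫ x, ρ t x * ‖u t x‖ ^ r ≤ C) ∧
      -- the full system with bounded temperature
      (∃ Q : ℝ, 1 < Q ∧ ∀ q₁ : ℝ, Q ≤ q₁ →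
        ∀ R cv κ : ℝ, 0 < R → 0 < cv → 0 < κ →
        ∀ (ρ₀ : CNS.E3 → ℝ) (u₀ : CNS.E3 → CNS.E3) (θ₀ : CNS.E3 → ℝ),
          CNS.IsInitialDatumFull μ lam R κ ρ₀ u₀ θ₀ →
        ∀ Tstar : ℝ, 0 < Tstar → ∀ M : ℝ≥0, ∃ C : ℝ,
        ∀ (ρ : ℝ → CNS.E3 → ℝ) (u : ℝ → CNS.E3 → CNS.E3) (θ : ℝ → CNS.E3 → ℝ),
          (∀ T : ℝ, 0 < T → T < Tstar → CNS.IsStrongSolutionFull μ lam R cv κ T ρ u θ) →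
          ρ 0 =ᵐ[volume] ρ₀ → u 0 =ᵐ[volume] u₀ → θ 0 =ᵐ[volume] θ₀ →
          CNS.timeNorm Tstar ⊤ (ENNReal.ofReal q₁) ρ + CNS.timeNorm Tstar ⊤ ⊤ θ ≤ (M : ℝ≥0∞) →
          ∀ T : ℝ, 0 ≤ T → T < Tstar → ∀ t ∈ Icc 0 T,
            Integrable (fun x => ρ t x * ‖u t x‖ ^ r) volume ∧
            ∫ x, ρ t x * ‖u t x‖ ^ r ≤ C) := by
  -- The exponent is 2 + 21/20. In the full system the pressure is linear in the density, so the
  -- threshold 4γ becomes 4.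
  refine ⟨61 / 20, by norm_num, by norm_num, fun γ hγ => ⟨4 * γ, by linarith, ?_⟩, 4, by norm_num, ?_⟩
  · intro q₁ hq₁ ρ₀ u₀ _ Tstar _ M
    refine ⟨Real.exp (2 * (61 / 20 * (5 / (2 * μ)) * 1 ^ 2) * Tstar) *
      ((∫ x, ρ₀ x * (4 * (1 + ‖u₀ x‖ ^ 4)))
        + 61 / 20 * (5 / (2 * μ)) * 1 ^ 2 * (M : ℝ) ^ q₁ * Tstar), ?_⟩
    intro ρ u hsol hρ₀ hu₀ hM T hT hTs t ht
    obtain ⟨q, hq, -, Dρ, ρt, Du, D2u, ut, Dut, D, V, mass, mom⟩ :=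
      -- The midpoint is positive even when T = 0 and still lies below `Tstar`; the constant refers
      -- to `Tstar` only.
      hsol ((T + Tstar) / 2) (by linarith) (by linarith)
    have hT' : (T + Tstar) / 2 ≤ Tstar := by linarith
    have F : CNS.ControlledFlow μ lam ((T + Tstar) / 2) q γ 1 q₁ ((M : ℝ) ^ q₁)
        (fun t x => (ρ t x) ^ γ) ρ ρt Dρ u ut Du Dut D2u :=
      { T_pos := by linarith
        q_gt := hq
        gam := hγ.le
        expo := hq₁
        dens := D
        vel := V
        mass := mass
        momentum := mom
        pressure := by
          filter_upwards [ae_restrict_mem measurableSet_Ioo] with s hs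
          filter_upwards [D.nonneg s (Ioo_subset_Icc_self hs)] with x hx
          rw [abs_of_nonneg (Real.rpow_nonneg hx γ), one_mul]
        density := D.ae_integral_rpow_le hT' (by linarith) hM }
    exact F.integral_moment_le_of_initial hμ hphys hvisc (by positivity) hρ₀ hu₀ hT'
      ⟨ht.1, ht.2.trans (by linarith)⟩
  · intro q₁ hq₁ R cv κ hR _ _ ρ₀ u₀ θ₀ _ Tstar _ M
    refine ⟨Real.exp (2 * (61 / 20 * (5 / (2 * μ)) * (R * M) ^ 2) * Tstar) *
      ((∫ x, ρ₀ x * (4 * (1 + ‖u₀ x‖ ^ 4)))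
        + 61 / 20 * (5 / (2 * μ)) * (R * M) ^ 2 * (M : ℝ) ^ q₁ * Tstar), ?_⟩
    intro ρ u θ hsol hρ₀ hu₀ _ hM T hT hTs t ht
    obtain ⟨q, hq, -, Dρ, ρt, Du, D2u, ut, Dut, Dθ, D2θ, θt, Dθt, D, V, -, mass, mom, -⟩ :=
      hsol ((T + Tstar) / 2) (by linarith) (by linarith)
    have hT' : (T + Tstar) / 2 ≤ Tstar := by linarith
    have hθ := (CNS.ae_eLpNorm_le_of_timeNorm_top (le_add_self.trans hM)).filter_mono
      (ae_mono (Measure.restrict_mono_set volume (show Ioo 0 ((T + Tstar) / 2) ⊆ Ioo 0 Tstar from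
        Ioo_subset_Ioo_right hT')))
    -- Since |θ| ≤ M almost everywhere, |Rρθ| ≤ (RM)ρ, which is the controlled pressure law with γ =
    -- 1.
    have F : CNS.ControlledFlow μ lam ((T + Tstar) / 2) q 1 (R * M) q₁ ((M : ℝ) ^ q₁)
        (fun t x => R * ρ t x * θ t x) ρ ρt Dρ u ut Du Dut D2u :=
      { T_pos := by linarith
        q_gt := hq
        gam := le_rfl
        expo := by linarith
        dens := D
        vel := V
        mass := mass
        momentum := mom
        pressure := by
          filter_upwards [hθ, ae_restrict_mem measurableSet_Ioo] with s hs hsT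
          rw [eLpNorm_exponent_top] at hs
          filter_upwards [D.nonneg s (Ioo_subset_Icc_self hsT),
            enorm_ae_le_eLpNormEssSup (θ s) volume] with x hx hxθ
          have h1 : |θ s x| ≤ M := by
            have := hxθ.trans hs
            rw [enorm_le_coe] at this
            exact_mod_cast this
          rw [Real.rpow_one, abs_mul, abs_mul, abs_of_pos hR, abs_of_nonneg hx]
          calc R * ρ s x * |θ s x| ≤ R * ρ s x * M := by gcongr
            _ = R * M * ρ s x := by ring
        density := D.ae_integral_rpow_le hT' (by linarith) (le_self_add.trans hM) }
    exact F.integral_moment_le_of_initial hμ hphys hvisc (by positivity) hρ₀ hu₀ hT'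
      ⟨ht.1, ht.2.trans (by linarith)⟩
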